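/- An instance of the subset assignment problem consists of $n\ge 1$ items with sizes $\mathrm{size}(p)\in\mathbb N$, a set $\mathcal B$ of $d\ge 0$ bins with capacities $\mathrm{capacity}(b)\in\mathbb N$, and costs $\mathrm{cost}(p,S)\in\mathbb N$ for every item $p$ and every $S\subseteq\mathcal B$. Its LP relaxation is to minimize $\sum_p\sum_S \mathrm{cost}(p,S)\,x(p,S)$ over real $x(p,S)\ge 0$ subject to $\sum_S x(p,S)=\mathrm{size}(p)$ for every item $p$ and $\sum_{S\ni b}\sum_p x(p,S)\le \mathrm{capacity}(b)$ for every bin $b$. Let $Z=\max_p \mathrm{size}(p)$ be the maximum item size, and let $C=\max_{p,S}\mathrm{cost}(p,S)\,\mathrm{size}(p)$ be the maximum cost of storing an item on a subset of the bins (an item $p$ placed entirely on $S$ contributes $\mathrm{cost}(p,S)\,\mathrm{size}(p)$ to the objective). The algorithm MainLoop adds for each bin $b$ an extra item of size $\mathrm{capacity}(b)$ that can be placed on $\emptyset$ and on $\{b\}$ at cost $0$ (and nowhere else), and starts with the bins filled by the extra items and all original items on $\emptyset$. A preprocessing step generates all augmentation profiles, that is, all minimally linearly dependent sets $V=\{v_1,\dots,v_r\}\subseteq\{-1,0,1\}^d$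 for which the relation $\sum_i\alpha_i v_i=0$, $\alpha_1=1$, has $\alpha>0$. Then MainLoop repeats: FindAugmentation runs through all profiles and through the magnitudes $a=a_{\max}/2,a_{\max}/4,\dots,a_{\min}$, takes for each $v_i$ the cheapest move $(p_i,S_i,T_i)$ of mass of an item $p_i$ from $S_i$ to $T_i$ with $\vec T_i-\vec S_i=v_i$ and $x(p_i,S_i)\ge a\alpha_i$ (found in a balanced search tree, ordered by cost and augmented by the maximum mass), and returns the best augmentation found; it is applied with the largest possible magnitude; and Restore transforms the assignment into a basic feasible assignment of no larger cost, by cancelling linear dependencies among its fractional variables. MainLoop stops when no augmentation decreases the cost. Steps are counted on a unit-cost random access machine whose words hold rational numbers: arithmetic operations and comparisons cost $1$, and an operation on $d$-entry vectors or a memory access addressed by subsets of the bins or by $d$-entry vectors costs $O(d+1)$. Write $\lg y=\log\max(2,y)$. Then: (1) There are absolute constants $K,k\in\mathbb N$ such that, for all $d\ge 0$, $n\ge 1$ and every instance, MainLoop halts with an exact optimal solution of the LP relaxation after at most $$K\binom{3^d}{d+1}(d+1)^k\; n\,\lg(n)\,\lg(nC)\,\lg(Z)$$ steps; that is, it runs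 in time $O\bigl(\binom{3^d}{d+1}\operatorname{poly}(d)\,n\log n\,\log(nC)\,\log Z\bigr)$. (2) For every $d\ge 0$, the number $f(d)$ of augmentation profiles is at most $\binom{3^d}{d+1}$. -/

import Mathlib

namespace SubsetAssignment

/-! ## The problem -/

/-- An instance with `d` bins and `n` items.  All data are (nonnegative) integers. -/
structure Input (d n : ℕ) where
  size : Fin n → ℕ
  capacity : Fin d → ℕ
  cost : Fin n → Finset (Fin d) → ℕ

namespace Input

variable {d n : ℕ} (I : Input d n)

/-- Feasibility for the LP relaxation: `x p S` is the mass of item `p` placed on the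
set of bins `S`. -/
structure IsFeasible (x : Fin n → Finset (Fin d) → ℝ) : Prop where
  nonneg : ∀ p S, 0 ≤ x p S
  assigned : ∀ p, ∑ S, x p S = I.size p
  capacity_le : ∀ b, ∑ S with b ∈ S, ∑ p, x p S ≤ I.capacity b

/-- The objective function of the LP relaxation. -/
def totalCost (x : Fin n → Finset (Fin d) → ℝ) : ℝ :=
  ∑ p, ∑ S, (I.cost p S : ℝ) * x p S

/-- `x` is an exact optimal solution of the LP relaxation. -/
def IsOptimal (x : Fin n → Finset (Fin d) → ℝ) : Prop :=
  I.IsFeasible x ∧ ∀ y, I.IsFeasible y → I.totalCost x ≤ I.totalCost y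

/-- The maximum item size `Z`. -/
def maxSize : ℕ := Finset.univ.sup I.size

/-- The maximum storage cost `C`: placing all of item `p` on `S` contributes
`cost p S * size p` to the objective, and `C` is the largest such contribution. -/
def maxStorageCost : ℕ :=
  Finset.univ.sup fun p => Finset.univ.sup fun S => I.cost p S * I.size p

end Input

/-! ## Augmentation profiles -/

/-- The vectors over `{-1, 0, 1}` of length `d`. -/
abbrev SignVec (d : ℕ) := Fin d → SignType

/-- A sign vector as a rational vector. -/
def SignVec.toRat {d : ℕ} (v : SignVec d) : Fin d → ℚ := fun i => ((v i : SignType) : ℚ)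

/-- An augmentation profile: a minimally dependent set of vectors over `{-1, 0, 1}` that admits
a linear relation with positive coefficients. -/
structure IsProfile {d : ℕ} (V : Finset (SignVec d)) : Prop where
  dependent : ¬ LinearIndepOn ℚ SignVec.toRat (V : Set (SignVec d))
  minimal : ∀ W : Finset (SignVec d), W ⊂ V →
    LinearIndepOn ℚ SignVec.toRat (W : Set (SignVec d))
  positive : ∃ α : SignVec d → ℚ, (∀ v ∈ V, 0 < α v) ∧ ∑ v ∈ V, α v • v.toRat = 0

/-- The number `f(d)` of augmentation profiles in dimension `d`. -/
noncomputable def numProfiles (d : ℕ) : ℕ :=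
  {V : Finset (SignVec d) | IsProfile V}.ncard

/-! ## Programs with a step counter

A program of type `Prog α` may diverge (`none`) or return a value; the state is the number of
elementary steps executed so far.  The unit-cost conventions are those of a random access machine
whose words hold rational numbers, items, bins and indices:

* an arithmetic operation or a comparison on words costs 1;
* a `d`-bit vector, a set of bins, or a vector over `{-1, 0, 1}` has `d` entries; componentwise
  operations on vectors cost one step per scalar operation (or per copied entry);
* reading or writing a memory cell whose address consists of a bounded number of words and of sets
  of bins or sign vectors costs `d + 1`;
* every pass through a loop, every recursive call on a list or tree, and every inspected tree node
  costs at least 1, besides the cost of its body. -/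

abbrev Prog := StateT ℕ Option

/-- Return the value `a` at a cost of `k` steps. -/
def charge {α : Type} (k : ℕ) (a : α) : Prog α := do
  modify (· + k)
  pure a

/-- Spend `k` steps. -/
def tick (k : ℕ) : Prog Unit := charge k ()

/-- At most `k` passes of an unbounded iteration, `none` if they do not suffice. -/
def loopWithin {σ ρ : Type} (body : σ → Prog (σ ⊕ ρ)) : ℕ → σ → Prog ρ
  | 0, _ => fun _ => none
  | k + 1, s => do
    tick 1
    match ← body s with
    | .inl s' => loopWithin body k s'
    | .inr a => pure a

open Classical in
/-- Unbounded iteration: repeat `body` until it returns a final value.  The iteration diverges if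
no number of passes suffices (and a larger number of passes than needed changes nothing). -/
noncomputable def loop {σ ρ : Type} (body : σ → Prog (σ ⊕ ρ)) (s : σ) : Prog ρ := fun t =>
  if h : ∃ k, ((loopWithin body k s).run t).isSome then (loopWithin body (Nat.find h) s).run t
  else none

/-- Run through a list, updating a state. -/
def each {α σ : Type} (l : List α) (s : σ) (body : σ → α → Prog σ) : Prog σ :=
  match l with
  | [] => charge 1 s
  | a :: l => do
    tick 1
    let s ← body s a
    each l s body

/-! ### Elementary operations -/

def add (a b : ℚ) : Prog ℚ := charge 1 (a + b)
def sub (a b : ℚ) : Prog ℚ := charge 1 (a - b)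
def mul (a b : ℚ) : Prog ℚ := charge 1 (a * b)
def div (a b : ℚ) : Prog ℚ := charge 1 (a / b)
def le (a b : ℚ) : Prog Bool := charge 1 (decide (a ≤ b))
def lt (a b : ℚ) : Prog Bool := charge 1 (decide (a < b))
def isZero (a : ℚ) : Prog Bool := charge 1 (decide (a = 0))

/-- The minimum of a value and of an optional value found so far. -/
def optMin (best : Option ℚ) (q : ℚ) : Prog (Option ℚ) :=
  match best with
  | none => charge 1 (some q)
  | some b => charge 1 (some (min b q))

/-- Read a memory cell. -/
def fetch {ι β : Type} (d : ℕ) (f : ι → β) (i : ι) : Prog β := charge (d + 1) (f i)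

/-- Write a memory cell. -/
def store {ι β : Type} [DecidableEq ι] (d : ℕ) (f : ι → β) (i : ι) (y : β) : Prog (ι → β) :=
  charge (d + 1) (Function.update f i y)

/-- `c • v`. -/
def scale {m : ℕ} (c : ℚ) (v : Fin m → ℚ) : Prog (Fin m → ℚ) :=
  charge m fun i => c * v i

/-- `v - c • u`. -/
def axpy {m : ℕ} (c : ℚ) (u v : Fin m → ℚ) : Prog (Fin m → ℚ) :=
  charge (2 * m) fun i => v i - c * u i

/-- The first nonzero coordinate. -/
def findPivot {d : ℕ} (v : Fin d → ℚ) : Prog (Option (Fin d)) :=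
  charge d ((List.finRange d).find? fun i => decide (v i ≠ 0))

/-- The vector `T - S` of the net changes to the bins when a unit of mass moves from `S` to `T`. -/
def netChange {d : ℕ} (S T : Finset (Fin d)) : SignVec d := fun b =>
  if b ∈ T then (if b ∈ S then 0 else 1) else (if b ∈ S then -1 else 0)

def diff {d : ℕ} (S T : Finset (Fin d)) : Prog (SignVec d) := charge d (netChange S T)

/-- The list of all vectors over `{-1, 0, 1}` of length `d`. -/
def signVecs : (d : ℕ) → List (SignVec d)
  | 0 => [Fin.elim0]
  | d + 1 => [-1, 0, 1].flatMap fun s => (signVecs d).map fun v => Fin.cons s v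

/-- The list of all sets of bins. -/
def binSets (d : ℕ) : List (Finset (Fin d)) :=
  (List.finRange d).sublists.map List.toFinset

/-! ### Sorting -/

/-- Merge two sorted lists. -/
def merge {α : Type} (leq : α → α → Prog Bool) : List α → List α → Prog (List α)
  | [], r => charge 1 r
  | a :: l, [] => charge 1 (a :: l)
  | a :: l, b :: r => do
    tick 1
    if ← leq a b then
      let t ← merge leq l (b :: r)
      pure (a :: t)
    else
      let t ← merge leq (a :: l) r
      pure (b :: t)
termination_by l r => l.length + r.length

/-- Merge sort of a list with at most `2 ^ k` entries. -/
def mergeSortAux {α : Type} (leq : α → α → Prog Bool) : ℕ → List α → Prog (List α)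
  | 0, l => charge 1 l
  | k + 1, l => do
    tick (l.length + 1)
    let l₁ ← mergeSortAux leq k (l.take (2 ^ k))
    let l₂ ← mergeSortAux leq k (l.drop (2 ^ k))
    merge leq l₁ l₂

def mergeSort {α : Type} (leq : α → α → Prog Bool) (l : List α) : Prog (List α) := do
  tick (l.length + 1)
  mergeSortAux leq (Nat.clog 2 l.length) l

/-- All sublists of length `k`. -/
def sublistsOfLength {α : Type} : ℕ → List α → Prog (List (List α))
  | 0, _ => charge 1 [[]]
  | _ + 1, [] => charge 1 []
  | k + 1, a :: l => do
    let A ← sublistsOfLength k l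
    let B ← sublistsOfLength (k + 1) l
    charge (2 * A.length + 1) (A.map (a :: ·) ++ B)

/-! ### Gaussian elimination -/

/-- A row of the echelon form: the vector `vec`, with entry `1` at `pivot`, is the linear
combination of the input vectors with the coefficients `coef`. -/
structure Row (d m : ℕ) where
  pivot : Fin d
  vec : Fin d → ℚ
  coef : Fin m → ℚ

def dependencyAux {d m : ℕ} (vs : Fin m → Fin d → ℚ) :
    List (Fin m) → List (Row d m) → Prog (Option (Fin m → ℚ))
  | [], _ => charge 1 none
  | j :: js, rows => do
    tick 1
    let start ← charge (d + m) (vs j, (Pi.single j 1 : Fin m → ℚ))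
    let (v, c) ← each rows start fun (v, c) r => do
      let t ← charge 1 (v r.pivot)
      let v ← axpy t r.vec v
      let c ← axpy t r.coef c
      pure (v, c)
    match ← findPivot v with
    | none => pure (some c)
    | some i => do
      let t ← div 1 (v i)
      let v ← scale t v
      let c ← scale t c
      let rows ← charge (rows.length + 1) (rows ++ [⟨i, v, c⟩])
      dependencyAux vs js rows

/-- The coefficients of a linear dependency among the vectors of a finite family (with coefficient
`1` at the first vector that depends on its predecessors), or `none` if there is none. -/
def dependency {d m : ℕ} (vs : Fin m → Fin d → ℚ) : Prog (Option (Fin m → ℚ)) :=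
  dependencyAux vs (List.finRange m) []

/-! ## Preprocess -/

/-- An augmentation profile `{v₁, …, v_r}` with its coefficients `α₁ = 1, …, α_r`. -/
abbrev Profile (d : ℕ) := List (SignVec d × ℚ)

/-- Lexicographic comparison of sign vectors. -/
def vecLE {d : ℕ} (u v : SignVec d) : Prog Bool :=
  charge d (decide (List.ofFn u ≤ List.ofFn v))

/-- The entries of the vectors of a profile, in order. -/
def Profile.key {d : ℕ} (V : Profile d) : List (List SignType) := V.map fun t => List.ofFn t.1

/-- Lexicographic comparison of profiles. -/
def profileLE {d : ℕ} (V W : Profile d) : Prog Bool :=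
  charge ((d + 1) * (V.length + W.length + 1)) (decide (V.key ≤ W.key))

def profileEq {d : ℕ} (V W : Profile d) : Prog Bool :=
  charge ((d + 1) * (V.length + W.length + 1)) (decide (V.key = W.key))

/-- Remove adjacent repetitions. -/
def dedupAdjacent {d : ℕ} : List (Profile d) → Prog (List (Profile d))
  | [] => charge 1 []
  | [V] => charge 1 [V]
  | V :: W :: l => do
    tick 1
    let l' ← dedupAdjacent (W :: l)
    if ← profileEq V W then pure l' else pure (V :: l')

/-- Sort the vectors of a profile and rescale so that the first coefficient is `1`. -/
def normalize {d : ℕ} (V : Profile d) : Prog (Profile d) := do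
  let V ← mergeSort (fun s t => vecLE s.1 t.1) V
  match V with
  | [] => charge 1 []
  | (v, a) :: V => charge (V.length + 1) ((v, 1) :: V.map fun t => (t.1, t.2 / a))

/-- For linearly independent `L = [v₁, …, v_d]` and a vector `w`: solve `∑ αᵢ vᵢ = w`, and if
`α ≥ 0` return the profile that consists of `-w` and of the `vᵢ` with `αᵢ ≠ 0`. -/
def expand {d : ℕ} (L : List (SignVec d)) (w : SignVec d) : Prog (Option (Profile d)) := do
  let family ← charge ((d + 1) * (L.length + 1)) (L ++ [-w])
  match ← dependency fun j : Fin family.length => (family.get j).toRat with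
  | none => pure none
  | some α =>
    let V ← each (List.finRange family.length) (some []) fun (acc : Option (Profile d)) j => do
      match acc with
      | none => pure none
      | some V =>
        if ← lt (α j) 0 then pure none
        else if ← isZero (α j) then pure (some V)
        else charge (d + 1) (some ((family.get j, α j) :: V))
    match V with
    | none => pure none
    | some V => do
      let V ← normalize V
      pure (some V)

/-- Generate all augmentation profiles together with their coefficients. -/
def preprocess (d : ℕ) : Prog (List (Profile d)) := do
  let vecs ← charge ((d + 1) * 3 ^ d) (signVecs d)
  let subsets ← sublistsOfLength d vecs
  let P ← each subsets [] fun (P : List (Profile d)) L => do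
    let vs ← charge ((d + 1) * L.length) fun j : Fin L.length => (L.get j).toRat
    match ← dependency vs with
    | some _ => pure P
    | none =>
      each vecs P fun P w => do
        match ← expand L w with
        | none => pure P
        | some V => charge 1 (V :: P)
  let P ← mergeSort profileLE P
  dedupAdjacent P

/-! ## Items, moves and the search trees -/

/-- The items `p` of the algorithm: an extra item for every bin and the original items. -/
abbrev Item (d n : ℕ) := Fin d ⊕ Fin n

def Input.items {d n : ℕ} (_ : Input d n) : List (Item d n) :=
  (List.finRange d).map Sum.inl ++ (List.finRange n).map Sum.inr

/-- The cost of a placement, `none` standing for `∞`: the extra item of the bin `b` can be placed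
on `∅` and on `{b}`, at no cost. -/
def Input.extCost {d n : ℕ} (I : Input d n) : Item d n × Finset (Fin d) → Option ℚ
  | (.inl b, S) => if S = ∅ ∨ S = {b} then some 0 else none
  | (.inr p, S) => some (I.cost p S)

/-- The initial assignment: each bin is filled by its extra item, and the original items are
outside of the bins. -/
def Input.start {d n : ℕ} (I : Input d n) : Item d n × Finset (Fin d) → ℚ
  | (.inl b, S) => if S = {b} then I.capacity b else 0
  | (.inr p, S) => if S = ∅ then I.size p else 0

/-- The set on which an item is placed initially. -/
def startHome {d n : ℕ} : Item d n → Finset (Fin d)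
  | .inl b => {b}
  | .inr _ => ∅

/-- A move of mass of `item` from `src` to `dst`, with its cost
`cost(item, dst) - cost(item, src)`. -/
structure Move (d n : ℕ) where
  item : Item d n
  src : Finset (Fin d)
  dst : Finset (Fin d)
  cost : ℚ

/-- The cost of a move, `none` if one of the two placements has infinite cost. -/
def moveCost {d n : ℕ} (I : Input d n) (p : Item d n) (S T : Finset (Fin d)) :
    Prog (Option ℚ) := do
  match ← fetch d I.extCost (p, S) with
  | none => pure none
  | some a =>
    match ← fetch d I.extCost (p, T) with
    | none => pure none
    | some b => do
      let c ← sub b a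
      pure (some c)

/-- A balanced search tree over moves, in the order of their costs.  The leaf of a move
`(p, S, T)` holds the current mass `x(p, S)`, and every node is augmented by the maximum mass
below it. -/
inductive Tree (d n : ℕ) where
  | empty
  | leaf (m : Move d n) (mass : ℚ)
  | node (top : ℚ) (left right : Tree d n)

namespace Tree

variable {d n : ℕ}

/-- The maximum mass, read off at the root. -/
def top : Tree d n → ℚ
  | empty => 0
  | leaf _ y => y
  | node t _ _ => t

def join (l r : Tree d n) : Prog (Tree d n) := charge 3 (node (max l.top r.top) l r)

/-- Build a tree of depth `k` from the first `2 ^ k` moves of a list, and return the others. -/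
def build (x : Item d n × Finset (Fin d) → ℚ) :
    ℕ → List (Move d n) → Prog (Tree d n × List (Move d n))
  | 0, [] => charge 1 (empty, [])
  | 0, m :: l => do
    let y ← fetch d x (m.item, m.src)
    charge 1 (leaf m y, l)
  | k + 1, l => do
    let (t₁, l) ← build x k l
    let (t₂, l) ← build x k l
    let t ← join t₁ t₂
    pure (t, l)

/-- Change the mass at the leaf number `i` of a tree of depth `k`. -/
def update : ℕ → ℕ → ℚ → Tree d n → Prog (Tree d n)
  | 0, _, y, leaf m _ => charge 1 (leaf m y)
  | k + 1, i, y, node _ l r => do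
    tick 3
    if i < 2 ^ k then
      let l ← update k i y l
      join l r
    else
      let r ← update k (i - 2 ^ k) y r
      join l r
  | _, _, _, t => charge 1 t

/-- Find the first move (hence a move of minimum cost) with mass at least `x₀ > 0`. -/
def query (x₀ : ℚ) : Tree d n → Prog (Option (Move d n))
  | empty => charge 1 none
  | leaf m y => do
    if ← le x₀ y then pure (some m) else pure none
  | node _ l r => do
    tick 1
    if ← le x₀ l.top then query x₀ l else query x₀ r

end Tree

/-- The memory of the algorithm. -/
structure Memory (d n : ℕ) where
  /-- The current assignment. -/
  x : Item d n × Finset (Fin d) → ℚ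
  /-- The chosen set `S_p` for each item `p`, with `x(p, S_p) > 0` if `size p > 0`. -/
  home : Item d n → Finset (Fin d)
  /-- The list `X` of the `(p, S)` with `S ≠ S_p` and `0 < x(p, S)`. -/
  frac : List (Item d n × Finset (Fin d))
  /-- For each `v`, the search tree of the moves `(p, S, T)` with `T - S = v`, and its depth. -/
  moves : SignVec d → ℕ × Tree d n
  /-- The number of the leaf of the move `(p, S, T)` in its tree. -/
  pos : Item d n × Finset (Fin d) × Finset (Fin d) → ℕ

variable {d n : ℕ} (I : Input d n)

/-- Set `x(p, S)` to `y` and update the search trees. -/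
def setMass (st : Memory d n) (p : Item d n) (S : Finset (Fin d)) (y : ℚ) :
    Prog (Memory d n) := do
  let x ← store d st.x (p, S) y
  let moves ← each (binSets d) st.moves fun moves T => do
    match ← moveCost I p S T with
    | none => pure moves
    | some _ =>
      let v ← diff S T
      let (k, t) ← fetch d moves v
      let i ← fetch d st.pos (p, S, T)
      let t ← t.update k i y
      store d moves v (k, t)
  pure { st with x := x, moves := moves }

/-- The initial memory: the initial assignment and its search trees. -/
def setup : Prog (Memory d n) := do
  -- tabulate the initial assignment, the placement costs and the lists of items and sets
  let sets ← charge ((d + 1) * 2 ^ d) (binSets d)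
  let vecs ← charge ((d + 1) * 3 ^ d) (signVecs d)
  let x ← charge (3 * (d + 1) * (d + n) * 2 ^ d) I.start
  let home ← charge ((d + 1) * (d + n)) startHome
  -- collect the moves by their vectors
  let buckets ← charge (3 ^ d) fun _ : SignVec d => ([] : List (Move d n))
  let buckets ← each I.items buckets fun buckets p =>
    each sets buckets fun buckets S =>
      each sets buckets fun buckets T => do
        match ← moveCost I p S T with
        | none => pure buckets
        | some c =>
          let v ← diff S T
          let l ← fetch d buckets v
          store d buckets v (⟨p, S, T, c⟩ :: l)
  -- sort each bucket by cost and build its tree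
  let (moves, pos) ← each vecs
      ((fun _ => (0, Tree.empty), fun _ => 0) : (SignVec d → ℕ × Tree d n) ×
        (Item d n × Finset (Fin d) × Finset (Fin d) → ℕ)) fun (moves, pos) v => do
    let l ← fetch d buckets v
    let l ← mergeSort (fun m m' => le m.cost m'.cost) l
    let k ← charge (l.length + 1) (Nat.clog 2 l.length)
    let (t, _) ← Tree.build x k l
    let moves ← store d moves v (k, t)
    let pos ← each l.zipIdx pos fun pos (m, i) => store d pos (m.item, m.src, m.dst) i
    pure (moves, pos)
  pure { x := x, home := home, frac := [], moves := moves, pos := pos }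

/-! ## FindAugmentation -/

/-- Bounds `(a_max, a_min)` for the magnitudes of (cost-decreasing) augmentations; `a_min` is
rounded down so that `a_max / a_min` is a power of `2`. -/
noncomputable def magnitudeBounds : Prog (ℚ × ℚ) := do
  let Z ← each (List.finRange n) (1 : ℚ) fun Z p => do
    let s ← fetch 0 I.size p
    charge 1 (max Z s)
  let D ← each (List.finRange d) (1 : ℚ) fun D _ => mul D d
  let aMax ← mul D Z
  let D₂ ← mul D D
  let D₃ ← mul (d + 1) D₂
  let lower ← div 1 D₃
  let aMin ← loop (fun a : ℚ => do
    if ← le a lower then pure (.inr a)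
    else
      let a ← div a 2
      pure (.inl a)) aMax
  pure (aMax, aMin)

/-- An augmentation: its moves `(pᵢ, Sᵢ, Tᵢ)` and its coefficients `αᵢ`. -/
abbrev Augmentation (d n : ℕ) := List (Move d n × ℚ)

/-- For each vector `vᵢ` of the profile, the cheapest move `(pᵢ, Sᵢ, Tᵢ)` such that
`x(pᵢ, Sᵢ) ≥ a αᵢ`, and the cost `∑ a cᵢ αᵢ`; `none` if there is no such move for some `i`. -/
def matchProfile (st : Memory d n) (V : Profile d) (a : ℚ) :
    Prog (Option (Augmentation d n × ℚ)) :=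
  each V (some ([], 0)) fun acc (v, α) => do
    match acc with
    | none => pure none
    | some (A, total) =>
      let y ← mul a α
      let (_, t) ← fetch d st.moves v
      match ← t.query y with
      | none => pure none
      | some m =>
        let c ← mul m.cost y
        let total ← add total c
        charge 1 (some ((m, α) :: A, total))

/-- The best augmentation found over all profiles and all magnitudes `a_max / 2 ^ j`; `none` if no
augmentation decreases the cost. -/
noncomputable def findAugmentation (P : List (Profile d)) (aMax aMin : ℚ) (st : Memory d n) :
    Prog (Option (Augmentation d n)) := do
  let a₀ ← div aMax 2
  let (_, A) ← each P ((0, none) : ℚ × Option (Augmentation d n)) fun best V =>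
    loop (fun ((a, best) : ℚ × ℚ × Option (Augmentation d n)) => do
      if ← lt a aMin then pure (.inr best)
      else
        let found ← matchProfile st V a
        let a' ← div a 2
        match found with
        | none => pure (.inl (a', best))
        | some (A, current) =>
          if ← lt current best.1 then pure (.inl (a', (current, some A)))
          else pure (.inl (a', best))) (a₀, best)
  pure A

/-! ## Restore -/

/-- Membership of a pair in a list, by a scan. -/
def scan (q : Item d n × Finset (Fin d)) (l : List (Item d n × Finset (Fin d))) : Prog Bool :=
  charge ((d + 1) * (l.length + 1)) (l.any fun r => decide (r = q))

/-- Recompute `S_p` (where `x(p, S_p)` has become `0`) and `X` from a list of candidates for the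
fractional variables. -/
def tidy (st : Memory d n) (candidates : List (Item d n × Finset (Fin d))) :
    Prog (Memory d n) := do
  let (home, X) ← each candidates (st.home, []) fun (home, X) (p, S) => do
    let y ← fetch d st.x (p, S)
    if ← isZero y then pure (home, X)
    else
      let H ← fetch d home p
      if ← charge d (decide (S = H)) then pure (home, X)
      else
        let z ← fetch d st.x (p, H)
        if ← isZero z then
          let home ← store d home p S
          pure (home, X)
        else if ← scan (p, S) X then pure (home, X)
        else charge 1 (home, (p, S) :: X)
  pure { st with home := home, frac := X }

/-- Move the mass `δ` of `p` from `S` to `T`. -/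
def shift (st : Memory d n) (p : Item d n) (S T : Finset (Fin d)) (δ : ℚ) :
    Prog (Memory d n) := do
  let y ← fetch d st.x (p, S)
  let y ← sub y δ
  let st ← setMass I st p S y
  let z ← fetch d st.x (p, T)
  let z ← add z δ
  setMass I st p T z

/-- One pass of the loop of `restore`, for `X = {x(p₁, S₁), …, x(p_r, S_r)}` and a dependency
`∑ βᵢ (Sᵢ - S_{pᵢ}) = 0`: apply it in the direction that does not increase the cost, until one of
the variables becomes `0`. -/
def cancel (st : Memory d n) (X : List (Item d n × Finset (Fin d)))
    (β : Fin X.length → ℚ) : Prog (Memory d n) := do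
  let indices := List.finRange X.length
  let total ← each indices (0 : ℚ) fun total i => do
    let (p, S) := X.get i
    let H ← fetch d st.home p
    match ← moveCost I p H S with
    | none => pure total
    | some c =>
      let c ← mul (β i) c
      add total c
  let β ← if ← lt 0 total then scale (-1) β else charge 1 β
  -- the largest magnitude that keeps all variables nonnegative
  let a ← each indices none fun a i => do
    let (p, S) := X.get i
    let a ← if ← lt (β i) 0 then do
        let y ← fetch d st.x (p, S)
        let q ← div y (-β i)
        optMin a q
      else pure a
    let net ← each indices (0 : ℚ) fun net j => do
      if ← charge 1 (decide ((X.get j).1 = p)) then add net (β j) else pure net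
    if ← lt 0 net then
      let H ← fetch d st.home p
      let y ← fetch d st.x (p, H)
      let q ← div y net
      optMin a q
    else pure a
  match a with
  | none => pure st
  | some a => do
    let st ← each indices st fun st i => do
      let (p, S) := X.get i
      let H ← fetch d st.home p
      let δ ← mul a (β i)
      shift I st p H S δ
    tidy st X

/-- Transform the current assignment into a basic feasible assignment. -/
noncomputable def restore (st : Memory d n) : Prog (Memory d n) :=
  loop (fun st : Memory d n => do
    let X := st.frac
    let vs ← charge (2 * (d + 1) * (X.length + 1)) fun j : Fin X.length =>
      (netChange (st.home (X.get j).1) (X.get j).2).toRat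
    match ← dependency vs with
    | none => pure (.inr st)
    | some β => do
      let st ← cancel I st X β
      pure (.inl st)) st

/-! ## MainLoop -/

/-- The maximum magnitude with which an augmentation can be applied: the minimum over the pairs
`(p, S)` of `x(p, S) / α(p, S)`, where `α(p, S)` is the sum of the `αᵢ` with
`(pᵢ, Sᵢ) = (p, S)`. -/
def maxMagnitude (st : Memory d n) (A : Augmentation d n) : Prog (Option ℚ) :=
  each A none fun a (m, _) => do
    let s ← each A (0 : ℚ) fun s (m', α') => do
      if ← charge (d + 1) (decide (m'.item = m.item ∧ m'.src = m.src)) then add s α' else pure s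
    let y ← fetch d st.x (m.item, m.src)
    let q ← div y s
    optMin a q

/-- Apply an augmentation with the largest possible magnitude. -/
def applyAugmentation (st : Memory d n) (A : Augmentation d n) : Prog (Memory d n) := do
  match ← maxMagnitude st A with
  | none => pure st
  | some a => do
    let st ← each A st fun st (m, α) => do
      let δ ← mul a α
      shift I st m.item m.src m.dst δ
    let candidates ← charge (A.length + st.frac.length + 1)
      (A.map (fun t => (t.1.item, t.1.dst)) ++ st.frac)
    tidy st candidates

/-- The whole algorithm.  It returns the masses of the original items. -/
noncomputable def mainLoop : Prog (Fin n → Finset (Fin d) → ℚ) := do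
  let st ← setup I
  let P ← preprocess d
  let (aMax, aMin) ← magnitudeBounds I
  loop (fun st : Memory d n => do
    match ← findAugmentation P aMax aMin st with
    | none => pure (.inr fun p S => st.x (.inr p, S))
    | some A => do
      let st ← applyAugmentation I st A
      let st ← restore I st
      pure (.inl st)) st

/-- `HaltsWith prog a t`: the program `prog` halts with the value `a` after exactly `t` steps. -/
def HaltsWith {α : Type} (prog : Prog α) (a : α) (t : ℕ) : Prop :=
  prog.run 0 = some (a, t)

/-- The logarithm, read as `log 2` at arguments below `2`. -/
noncomputable def lg (y : ℝ) : ℝ := Real.log (max 2 y)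

end SubsetAssignment

/-!
The theorem bounds the running time of a local search on the LP relaxation, and it holds because
the optimality gap shrinks geometrically while it cannot become arbitrarily small.

*Circuits.*  If `y` is a feasible assignment, the difference between the current assignment `x` and
`y` splits into moves of mass (`coupling`), and the sum of the vectors of these moves is zero.  Such
a nonnegative relation among sign vectors is a conical combination of the relations of augmentation
profiles, which are the positive circuits of the vector configuration `{-1, 0, 1} ^ d`
(`sum_nonneg_of_profiles`).  Hence some augmentation realizes a fair share of the difference: if no
tested augmentation gains more than `B`, then `cost x - cost y ≤ 2 * B * (n + 2 * d)`
(`GainAtMost.gap_le`).  A penalty of `2 * B / x(p, S)` per unit of mass taken from `(p, S)` accounts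
for the limited supply at `(p, S)`; in total it contributes `2 * B` for every pair in the support of
`x`, and a basic assignment has at most `n + 2 * d` such pairs.

*Geometric decrease.*  An augmentation found by `findAugmentation` may take mass from the same
place up to `d + 1` times, so applying it with the largest possible magnitude gains at least
`B / (d + 1)` (`applyAugmentation_runs`).  The gap is therefore multiplied by at most
`contraction d n = 1 - 1 / (2 * (d + 1) * (n + 2 * d))` in every pass.

*Termination.*  By Cramer's rule the masses of a basic assignment have a common denominator of at
most `d ^ d` (`Valid.exists_denominator`).  Hence an improvement from one basic assignment to
another one is at least `1 / (d ^ d) ^ 2`, and as the initial gap is at most `n * C`, there are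
`O(poly(d) * n * log (n * C))` passes (`contraction_pow_mul_lt`, `mainLoop_runs`).  The same
denominators bound the magnitudes that have to be tested (`magnitudeBounds_runs`).

*Steps.*  `Runs` is a program logic with exact step counts; every subroutine gets a specification of
its result and its time.  The time bounds are compared up to factors polynomial in `d` by `PolyLE`,
using `3 ^ d * C(3 ^ d, d) ≤ 2 * (d + 1) * C(3 ^ d, d + 1)` for the number of generated profiles
(`profileBound_le`) and `27 ^ d ≤ 9 * C(3 ^ d, d + 1)` for the other exponential terms
(`pow_le_choose`).

*Number of profiles.*  A profile without one of its vectors is independent and extends by sign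
vectors to a basis of the space.  Adding the omitted vector gives a set of `d + 1` vectors that
contains no other circuit, so profiles inject into the sets of that size (`numProfiles_le`).
-/

namespace SubsetAssignment

/-! ### Reasoning about programs with a step counter -/

/-- `Runs m Q`: the program `m` halts, whatever the step counter shows at the start, with a fixed
value `a` after a fixed number `s` of steps, and `Q a s` holds. -/
def Runs {α : Type} (m : Prog α) (Q : α → ℕ → Prop) : Prop :=
  ∃ a s, (∀ t, m t = some (a, t + s)) ∧ Q a s

namespace Runs

variable {α β σ ρ : Type}

theorem mono {m : Prog α} {Q R : α → ℕ → Prop} (h : Runs m Q) (hQ : ∀ a s, Q a s → R a s) :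
    Runs m R := by
  obtain ⟨a, s, hm, hq⟩ := h
  exact ⟨a, s, hm, hQ a s hq⟩

theorem bind {m : Prog α} {f : α → Prog β} {Q : β → ℕ → Prop}
    (h : Runs m fun a s => Runs (f a) fun b s' => Q b (s + s')) : Runs (m >>= f) Q := by
  obtain ⟨a, s, hm, b, s', hf, hq⟩ := h
  refine ⟨b, s + s', fun t => ?_, hq⟩
  change (m t >>= fun r => f r.1 r.2) = _
  rw [hm t]
  change f a (t + s) = _
  rw [hf, add_assoc]

/-- The bind rule for a first program that is already specified. -/
theorem seq {m : Prog α} {f : α → Prog β} {R : α → ℕ → Prop} {Q : β → ℕ → Prop}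
    (h : Runs m R) (hf : ∀ a s, R a s → Runs (f a) fun b s' => Q b (s + s')) :
    Runs (m >>= f) Q :=
  (h.mono hf).bind

theorem pure {a : α} {Q : α → ℕ → Prop} (h : Q a 0) : Runs (pure a : Prog α) Q :=
  ⟨a, 0, fun _ => rfl, h⟩

theorem charge {k : ℕ} {a : α} {Q : α → ℕ → Prop} (h : Q a k) : Runs (charge k a) Q :=
  ⟨a, k, fun _ => rfl, h⟩

theorem charge_bind {k : ℕ} {a : α} {f : α → Prog β} {Q : β → ℕ → Prop}
    (h : Runs (f a) fun b s => Q b (k + s)) : Runs (SubsetAssignment.charge k a >>= f) Q :=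
  bind (charge h)

theorem pure_bind {a : α} {f : α → Prog β} {Q : β → ℕ → Prop}
    (h : Runs (f a) Q) : Runs ((Pure.pure a : Prog α) >>= f) Q :=
  bind (pure (by simpa using h))

/-- A pass through a list, with an invariant that depends on the part of the list that has been
processed. -/
theorem each {l : List α} {s : σ} {body : σ → α → Prog σ} (T : ℕ) (Inv : List α → σ → Prop)
    (h0 : Inv [] s)
    (step : ∀ done a rest s, l = done ++ a :: rest → Inv done s →
      Runs (body s a) fun s' c => c ≤ T ∧ Inv (done ++ [a]) s') :
    Runs (each l s body) fun s' c => c ≤ l.length * (T + 1) + 1 ∧ Inv l s' := by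
  suffices H : ∀ (rest done : List α) (s : σ), l = done ++ rest → Inv done s →
      Runs (SubsetAssignment.each rest s body)
        fun s' c => c ≤ rest.length * (T + 1) + 1 ∧ Inv l s' from H l [] s rfl h0
  intro rest
  induction rest with
  | nil =>
    intro done s hl hi
    refine charge ⟨by simp, ?_⟩
    simpa [hl] using hi
  | cons a rest ih =>
    intro done s hl hi
    refine charge_bind (seq (step done a rest s hl hi) fun s' c ⟨hc, hi'⟩ => ?_)
    refine (ih (done ++ [a]) s' (by simp [hl]) hi').mono fun s'' c' ⟨hc', h⟩ => ⟨?_, h⟩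
    simp only [List.length_cons, add_mul, one_mul]
    omega

theorem loopWithin_mono {body : σ → Prog (σ ⊕ ρ)} {k k' : ℕ} (hk : k ≤ k') {s : σ} {t : ℕ}
    {r : ρ × ℕ} (h : loopWithin body k s t = some r) : loopWithin body k' s t = some r := by
  induction k generalizing k' s t with
  | zero => cases h
  | succ k ih =>
    obtain ⟨k', rfl⟩ : ∃ j, k' = j + 1 := ⟨k' - 1, by omega⟩
    change (body s (t + 1) >>= fun q => _) = _ at h
    change (body s (t + 1) >>= fun q => _) = _
    cases hb : body s (t + 1) with
    | none => rw [hb] at h; cases h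
    | some q =>
      rw [hb] at h
      obtain ⟨q | q, t'⟩ := q
      · exact ih (by omega) h
      · exact h

theorem loop_of_loopWithin {body : σ → Prog (σ ⊕ ρ)} {k : ℕ} {s : σ} {Q : ρ → ℕ → Prop}
    (h : Runs (loopWithin body k s) Q) : Runs (loop body s) Q := by
  obtain ⟨a, c, hm, hq⟩ := h
  refine ⟨a, c, fun t => ?_, hq⟩
  have hex : ∃ k, ((loopWithin body k s).run t).isSome :=
    ⟨k, by change (loopWithin body k s t).isSome = true; rw [hm]; rfl⟩
  classical
  have hfind := Nat.find_spec hex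
  have hle : Nat.find hex ≤ k :=
    Nat.find_min' hex (by change (loopWithin body k s t).isSome = true; rw [hm]; rfl)
  obtain ⟨r, hr⟩ := Option.isSome_iff_exists.mp hfind
  have h1 : loopWithin body k s t = some r := loopWithin_mono hle hr
  have h2 : loop body s t = (loopWithin body (Nat.find hex) s).run t := by
    unfold loop
    rw [dif_pos hex]
  rw [h2]
  refine hr.trans ?_
  rw [← h1, hm]

/-- An unbounded iteration halts if every pass either returns or passes to a state of smaller
rank. -/
theorem loop {body : σ → Prog (σ ⊕ ρ)} (T : ℕ) (Inv : ℕ → σ → Prop) (Q : ρ → Prop)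
    (step : ∀ k s, Inv k s → Runs (body s) fun r c => c ≤ T ∧
      match r with
      | .inl s' => ∃ k' < k, Inv k' s'
      | .inr a => Q a)
    (k : ℕ) (s : σ) (h0 : Inv k s) :
    Runs (SubsetAssignment.loop body s) fun a c => c ≤ (k + 1) * (T + 1) ∧ Q a := by
  refine loop_of_loopWithin (k := k + 1) ?_
  suffices H : ∀ N k s, k < N → Inv k s →
      Runs (loopWithin body N s) fun a c => c ≤ (k + 1) * (T + 1) ∧ Q a from
    H (k + 1) k s (by omega) h0
  intro N
  induction N with
  | zero => intro k s hk; omega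
  | succ N ih =>
    intro k s hk hi
    refine charge_bind (seq (step k s hi) ?_)
    rintro (s' | a) c ⟨hc, hr⟩
    · obtain ⟨k', hk', hi'⟩ := hr
      refine (ih k' s' (by omega) hi').mono fun a c' ⟨hc', hq⟩ => ⟨?_, hq⟩
      have : (k' + 1) * (T + 1) ≤ k * (T + 1) := Nat.mul_le_mul_right _ hk'
      simp only [add_mul, one_mul] at *
      omega
    · exact pure ⟨by simp only [add_mul, one_mul]; omega, hr⟩

theorem haltsWith {m : Prog α} {Q : α → ℕ → Prop} (h : Runs m Q) :
    ∃ a s, HaltsWith m a s ∧ Q a s := by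
  obtain ⟨a, s, hm, hq⟩ := h
  exact ⟨a, s, (hm 0).trans (by rw [zero_add]), hq⟩

end Runs

/-! ### Sorting -/

section Sorting

variable {α : Type}

theorem merge_runs (leq : α → α → Prog Bool) (r : α → α → Prop) (c : ℕ)
    (l₁ l₂ : List α)
    (hleq : ∀ a ∈ l₁, ∀ b ∈ l₂, Runs (leq a b) fun q s => s ≤ c ∧ (q = true ↔ r a b)) :
    Runs (merge leq l₁ l₂) fun l s => s ≤ (l₁.length + l₂.length) * (c + 1) + 1 ∧
      l.Perm (l₁ ++ l₂) ∧ ((∀ a b, r a b ∨ r b a) → (∀ a b d, r a b → r b d → r a d) →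
        l₁.Pairwise r → l₂.Pairwise r → l.Pairwise r) := by
  induction l₁, l₂ using merge.induct with
  | case1 l₂ =>
    rw [merge]
    exact Runs.charge ⟨by omega, by simp, fun _ _ _ h => h⟩
  | case2 a l =>
    rw [merge]
    exact Runs.charge ⟨by omega, by simp, fun _ _ h _ => h⟩
  | case3 a l b l' ih₁ ih₂ =>
    rw [merge]
    refine Runs.charge_bind (Runs.seq (hleq a (by simp) b (by simp)) ?_)
    rintro q s ⟨hs, hq⟩
    by_cases h : q = true
    · rw [if_pos h]
      refine Runs.seq (ih₁ fun a ha b hb => hleq a (by simp [ha]) b hb) ?_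
      rintro t s' ⟨hs', hp, hsort⟩
      refine Runs.pure ⟨?_, ?_, ?_⟩
      · simp only [List.length_cons, add_mul, one_mul] at *
        omega
      · simpa using hp
      · intro htot htr h₁ h₂
        refine List.pairwise_cons.mpr ⟨fun x hx => ?_, hsort htot htr h₁.of_cons h₂⟩
        have hx' := hp.mem_iff.mp hx
        rcases List.mem_append.mp hx' with hx' | hx'
        · exact List.rel_of_pairwise_cons h₁ hx'
        · rcases List.mem_cons.mp hx' with rfl | hx'
          · exact hq.mp h
          · exact htr _ _ _ (hq.mp h) (List.rel_of_pairwise_cons h₂ hx')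
    · rw [if_neg h]
      refine Runs.seq (ih₂ fun a ha b hb => hleq a ha b (by simp [hb])) ?_
      rintro t s' ⟨hs', hp, hsort⟩
      refine Runs.pure ⟨?_, ?_, ?_⟩
      · simp only [List.length_cons, add_mul, one_mul] at *
        omega
      · refine (hp.cons b).trans ?_
        simpa using (List.perm_middle (a := b) (l₁ := a :: l) (l₂ := l')).symm
      · intro htot htr h₁ h₂
        have hba : r b a := (htot a b).resolve_left fun hab => h (hq.mpr hab)
        refine List.pairwise_cons.mpr ⟨fun x hx => ?_, hsort htot htr h₁ h₂.of_cons⟩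
        have hx' := hp.mem_iff.mp hx
        rcases List.mem_append.mp hx' with hx' | hx'
        · rcases List.mem_cons.mp hx' with rfl | hx'
          · exact hba
          · exact htr _ _ _ hba (List.rel_of_pairwise_cons h₁ hx')
        · exact List.rel_of_pairwise_cons h₂ hx'

theorem mergeSortAux_runs (leq : α → α → Prog Bool) (r : α → α → Prop) (c k : ℕ)
    (l : List α) (hl : l.length ≤ 2 ^ k)
    (hleq : ∀ a ∈ l, ∀ b ∈ l, Runs (leq a b) fun q s => s ≤ c ∧ (q = true ↔ r a b)) :
    Runs (mergeSortAux leq k l) fun l' s => s ≤ 2 ^ k * ((k + 1) * (2 * (c + 2))) ∧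
      l'.Perm l ∧ ((∀ a b, r a b ∨ r b a) → (∀ a b d, r a b → r b d → r a d) →
        l'.Pairwise r) := by
  induction k generalizing l with
  | zero =>
    refine Runs.charge ⟨by omega, List.Perm.refl _, fun _ _ => ?_⟩
    match l, hl with
    | [], _ => simp
    | [a], _ => simp
  | succ k ih =>
    refine Runs.charge_bind ?_
    refine Runs.seq (ih (l.take (2 ^ k)) (by simp) fun a ha b hb =>
      hleq a (List.mem_of_mem_take ha) b (List.mem_of_mem_take hb)) ?_
    rintro l₁ s₁ ⟨hs₁, hp₁, hr₁⟩
    refine Runs.seq (ih (l.drop (2 ^ k)) (by rw [List.length_drop, pow_succ] at *; omega)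
      fun a ha b hb => hleq a (List.mem_of_mem_drop ha) b (List.mem_of_mem_drop hb)) ?_
    rintro l₂ s₂ ⟨hs₂, hp₂, hr₂⟩
    refine (merge_runs leq r c l₁ l₂ fun a ha b hb =>
      hleq a (List.mem_of_mem_take (hp₁.mem_iff.mp ha)) b
        (List.mem_of_mem_drop (hp₂.mem_iff.mp hb))).mono ?_
    rintro l' s₃ ⟨hs₃, hp₃, hr₃⟩
    refine ⟨?_, hp₃.trans ?_, fun htot htr => hr₃ htot htr (hr₁ htot htr) (hr₂ htot htr)⟩
    · have hlen : l₁.length + l₂.length = l.length := by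
        rw [hp₁.length_eq, hp₂.length_eq, ← List.length_append, List.take_append_drop]
      have h1 : (l₁.length + l₂.length) * (c + 1) ≤ 2 ^ (k + 1) * (c + 1) :=
        Nat.mul_le_mul_right _ (hlen ▸ hl)
      have h2 : 1 ≤ 2 ^ k := Nat.one_le_two_pow
      have h3 : 2 ^ k * 1 ≤ 2 ^ k * (c + 1) := Nat.mul_le_mul_left _ (by omega)
      have e1 : 2 ^ (k + 1) * ((k + 1 + 1) * (2 * (c + 2))) =
          2 * (2 ^ k * ((k + 1) * (2 * (c + 2)))) + 2 * (2 ^ (k + 1) * (c + 1)) +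
            2 * 2 ^ (k + 1) := by ring
      have e2 : 2 ^ (k + 1) = 2 * 2 ^ k := by ring
      omega
    · exact (hp₁.append hp₂).trans (by rw [List.take_append_drop])

/-- An upper bound for the number of steps of `mergeSort` on `len` entries, with comparisons
of cost `c`. -/
def sortTime (len c : ℕ) : ℕ := (2 * len + 1) * ((Nat.clog 2 len + 2) * (2 * (c + 2)))

theorem two_pow_clog_le (m : ℕ) : 2 ^ Nat.clog 2 m ≤ 2 * m + 1 := by
  rcases Nat.lt_or_ge 1 m with h | h
  · have h1 := Nat.pow_pred_clog_lt_self (b := 2) (by norm_num) h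
    have h2 : 0 < Nat.clog 2 m := Nat.clog_pos (by norm_num) h
    obtain ⟨j, hj⟩ : ∃ j, Nat.clog 2 m = j + 1 := ⟨_, (Nat.succ_pred_eq_of_pos h2).symm⟩
    rw [hj] at h1 ⊢
    simp only [Nat.pred_succ, pow_succ] at *
    omega
  · rw [Nat.clog_of_right_le_one h]
    omega

theorem mergeSort_runs (leq : α → α → Prog Bool) (r : α → α → Prop) (c : ℕ) (l : List α)
    (hleq : ∀ a ∈ l, ∀ b ∈ l, Runs (leq a b) fun q s => s ≤ c ∧ (q = true ↔ r a b)) :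
    Runs (mergeSort leq l) fun l' s => s ≤ sortTime l.length c ∧
      l'.Perm l ∧ ((∀ a b, r a b ∨ r b a) → (∀ a b d, r a b → r b d → r a d) →
        l'.Pairwise r) := by
  refine Runs.charge_bind ((mergeSortAux_runs leq r c _ l
    (Nat.le_pow_clog (by norm_num) _) hleq).mono ?_)
  rintro l' s ⟨hs, h⟩
  refine ⟨?_, h⟩
  have h1 := Nat.mul_le_mul_right ((Nat.clog 2 l.length + 1) * (2 * (c + 2)))
    (two_pow_clog_le l.length)
  have h2 : (2 * l.length + 1) * 1 ≤ (2 * l.length + 1) * (2 * (c + 2)) :=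
    Nat.mul_le_mul_left _ (by omega)
  have e : sortTime l.length c = (2 * l.length + 1) * ((Nat.clog 2 l.length + 1) * (2 * (c + 2)))
    + (2 * l.length + 1) * (2 * (c + 2)) := by unfold sortTime; ring
  omega

/-- An upper bound for the number of steps of `sublistsOfLength k` on a list of length `m`. -/
def sublistsTime : ℕ → ℕ → ℕ
  | 0, _ => 1
  | _ + 1, 0 => 1
  | k + 1, m + 1 => sublistsTime k m + sublistsTime (k + 1) m + (2 * m.choose k + 1)

theorem sublistsOfLength_runs (k : ℕ) (l : List α) :
    Runs (sublistsOfLength k l) fun L s => s ≤ sublistsTime k l.length ∧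
      L.length = l.length.choose k ∧ ∀ l', l' ∈ L ↔ l'.Sublist l ∧ l'.length = k := by
  induction l generalizing k with
  | nil =>
    cases k with
    | zero =>
      rw [sublistsOfLength]
      refine Runs.charge ⟨by simp [sublistsTime], by simp, fun l' => ?_⟩
      simp
    | succ k =>
      rw [sublistsOfLength]
      refine Runs.charge ⟨by simp [sublistsTime], by simp, fun l' => ?_⟩
      simp only [List.not_mem_nil, List.sublist_nil, false_iff, not_and]
      rintro rfl
      simp
  | cons a l ih =>
    cases k with
    | zero =>
      rw [sublistsOfLength]
      refine Runs.charge ⟨by simp [sublistsTime], by simp, fun l' => ?_⟩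
      simp +contextual [List.length_eq_zero_iff]
    | succ k =>
      rw [sublistsOfLength]
      refine Runs.seq (ih k) ?_
      rintro A s₁ ⟨h₁, hA, hA'⟩
      refine Runs.seq (ih (k + 1)) ?_
      rintro B s₂ ⟨h₂, hB, hB'⟩
      refine Runs.charge ⟨?_, ?_, fun l' => ?_⟩
      · simp only [List.length_cons, sublistsTime, hA]
        omega
      · simp [hA, hB, Nat.choose_succ_succ]
      · simp only [List.mem_append, List.mem_map, hA', hB', List.sublist_cons_iff]
        constructor
        · rintro (⟨r, ⟨hr, rfl⟩, rfl⟩ | ⟨h, h'⟩)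
          · exact ⟨Or.inr ⟨r, rfl, hr⟩, by simp⟩
          · exact ⟨Or.inl h, h'⟩
        · rintro ⟨h | ⟨r, rfl, hr⟩, h'⟩
          · exact Or.inr ⟨h, h'⟩
          · exact Or.inl ⟨r, ⟨hr, by simpa using h'⟩, rfl⟩

theorem sublistsTime_lt (k m : ℕ) : sublistsTime k m <
    2 * ∑ j ∈ Finset.range (k + 1), (m + 1).choose j + 2 * (k * m.choose k) := by
  induction m generalizing k with
  | zero =>
    have : 1 ≤ ∑ j ∈ Finset.range (k + 1), (0 + 1).choose j := by
      rw [Finset.sum_range_succ']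
      simp
    cases k <;> simp only [sublistsTime] <;> omega
  | succ m ih =>
    cases k with
    | zero => simp [sublistsTime]
    | succ k =>
      have h1 := ih k
      have h2 := ih (k + 1)
      have e1 : ∑ j ∈ Finset.range (k + 1 + 1), (m + 1 + 1).choose j =
          ∑ j ∈ Finset.range (k + 1 + 1), (m + 1).choose j +
            ∑ j ∈ Finset.range (k + 1), (m + 1).choose j := by
        rw [Finset.sum_range_succ' _ (k + 1), Finset.sum_range_succ' _ (k + 1)]
        simp only [Nat.choose_succ_succ (m + 1), Finset.sum_add_distrib, Nat.choose_zero_right]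
        ring
      have e2 : (k + 1) * (m + 1).choose (k + 1) =
          k * m.choose k + m.choose k + (k + 1) * m.choose (k + 1) := by
        rw [Nat.choose_succ_succ]
        ring
      simp only [sublistsTime]
      rw [e1, e2]
      omega

end Sorting

/-! ### Gaussian elimination -/

section Dependency

open Submodule

variable {d m : ℕ}

/-- The space spanned by the rows of an echelon form. -/
def rowSpan (rows : List (Row d m)) : Submodule ℚ (Fin d → ℚ) :=
  span ℚ {u | ∃ r ∈ rows, r.vec = u}

theorem vec_mem_rowSpan {rows : List (Row d m)} {r : Row d m} (hr : r ∈ rows) :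
    r.vec ∈ rowSpan rows := subset_span ⟨r, hr, rfl⟩

theorem rowSpan_mono {rows rows' : List (Row d m)} (h : ∀ r ∈ rows, r ∈ rows') :
    rowSpan rows ≤ rowSpan rows' :=
  span_mono fun _ ⟨r, hr, hu⟩ => ⟨r, h r hr, hu⟩

theorem eq_zero_of_mem_rowSpan {rows : List (Row d m)} (hunit : ∀ r ∈ rows, r.vec r.pivot = 1)
    (hzero : rows.Pairwise fun r r' => r'.vec r.pivot = 0) {u : Fin d → ℚ}
    (hu : u ∈ rowSpan rows) (hpiv : ∀ r ∈ rows, u r.pivot = 0) : u = 0 := by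
  induction rows generalizing u with
  | nil => simpa [rowSpan] using hu
  | cons r rows ih =>
    obtain ⟨hr, hrows⟩ := List.pairwise_cons.mp hzero
    have hset : {u | ∃ r' ∈ r :: rows, r'.vec = u} =
        insert r.vec {u | ∃ r' ∈ rows, r'.vec = u} := by
      ext u
      simp [eq_comm]
    rw [rowSpan, hset, mem_span_insert] at hu
    obtain ⟨t, u', hu', rfl⟩ := hu
    have h1 : u' r.pivot = 0 := by
      refine span_induction (p := fun w _ => w r.pivot = 0) ?_ rfl ?_ ?_ hu'
      · rintro w ⟨r', hr', rfl⟩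
        exact hr r' hr'
      · intro x y _ _ hx hy
        simp [hx, hy]
      · intro a x _ hx
        simp [hx]
    have h2 := hpiv r (by simp)
    have h3 : t = 0 := by
      simpa [h1, hunit r (by simp)] using h2
    subst h3
    simp only [zero_smul, zero_add] at hpiv ⊢
    exact ih (fun r' h => hunit r' (by simp [h])) hrows hu' fun r' h => hpiv r' (by simp [h])

/-- The state of Gaussian elimination: `rows` is an echelon form of the vectors of the list `done`
of indices, all of which were found to be independent of their predecessors. -/
structure Echelon (vs : Fin m → Fin d → ℚ) (done : List (Fin m)) (rows : List (Row d m)) :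
    Prop where
  comb : ∀ r ∈ rows, r.vec = ∑ i, r.coef i • vs i
  supp : ∀ r ∈ rows, ∀ i, i ∉ done → r.coef i = 0
  unit : ∀ r ∈ rows, r.vec r.pivot = 1
  zero : rows.Pairwise fun r r' => r'.vec r.pivot = 0
  span : ∀ i ∈ done, vs i ∈ rowSpan rows
  indep : LinearIndepOn ℚ vs {i | i ∈ done}
  length : rows.length = done.length

/-- Reduction of the vector of index `j` by the rows of the echelon form. -/
theorem reduce_runs {vs : Fin m → Fin d → ℚ} {done : List (Fin m)} {rows : List (Row d m)}
    (h : Echelon vs done rows) {j : Fin m} (hj : j ∉ done) :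
    Runs (each rows (vs j, (Pi.single j 1 : Fin m → ℚ)) fun (v, c) r => do
      let t ← charge 1 (v r.pivot)
      let v ← axpy t r.vec v
      let c ← axpy t r.coef c
      pure (v, c)) fun vc s => s ≤ rows.length * (2 * d + 2 * m + 2) + 1 ∧
        vc.1 = ∑ i, vc.2 i • vs i ∧ vc.2 j = 1 ∧ (∀ i, i ∉ done → i ≠ j → vc.2 i = 0) ∧
        vs j - vc.1 ∈ rowSpan rows ∧ ∀ r ∈ rows, vc.1 r.pivot = 0 := by
  refine (Runs.each (2 * d + 2 * m + 1) (fun (seen : List (Row d m))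
    (vc : (Fin d → ℚ) × (Fin m → ℚ)) => vc.1 = ∑ i, vc.2 i • vs i ∧ vc.2 j = 1 ∧
      (∀ i, i ∉ done → i ≠ j → vc.2 i = 0) ∧ vs j - vc.1 ∈ rowSpan rows ∧
      ∀ r ∈ seen, vc.1 r.pivot = 0) ?_ ?_).mono fun vc s ⟨hs, hi⟩ => ⟨hs, hi⟩
  · refine ⟨?_, by simp, fun i _ hij => by simp [hij], by simp, by simp⟩
    simp [Pi.single_apply]
  · rintro seen r rest ⟨v, c⟩ hrows ⟨h1, h2, h3, h4, h5⟩
    simp only at h1 h2 h3 h4 h5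
    have hr : r ∈ rows := by simp [hrows]
    refine Runs.charge_bind (Runs.charge_bind (Runs.charge_bind (Runs.pure ?_)))
    refine ⟨by omega, ?_, ?_, ?_, ?_, ?_⟩
    · have hv : (fun i => v i - v r.pivot * r.vec i) = v - v r.pivot • r.vec := by
        ext i; simp
      change (fun i => v i - v r.pivot * r.vec i) = _
      rw [hv, h.comb r hr]
      simp only [sub_smul, Finset.sum_sub_distrib, mul_smul, ← Finset.smul_sum]
      rw [← h.comb r hr, ← h1]
    · change c j - v r.pivot * r.coef j = 1
      rw [h.supp r hr j hj, h2]
      ring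
    · intro i hi hij
      change c i - v r.pivot * r.coef i = 0
      rw [h.supp r hr i hi, h3 i hi hij]
      ring
    · have : vs j - (fun i => v i - v r.pivot * r.vec i) = (vs j - v) + v r.pivot • r.vec := by
        ext i; simp; ring
      change vs j - (fun i => v i - v r.pivot * r.vec i) ∈ _
      rw [this]
      exact add_mem h4 (smul_mem _ _ (vec_mem_rowSpan hr))
    · intro r' hr'
      change v r'.pivot - v r.pivot * r.vec r'.pivot = 0
      rcases List.mem_append.mp hr' with hr' | hr'
      · have := h.zero
        rw [hrows, List.pairwise_append] at this
        rw [h5 r' hr', this.2.2 r' hr' r (by simp)]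
        ring
      · obtain rfl : r' = r := by simpa using hr'
        rw [h.unit r' hr]
        ring

/-- A further vector, reduced to `v ≠ 0`, extends the echelon form. -/
theorem Echelon.snoc {vs : Fin m → Fin d → ℚ} {done : List (Fin m)} {rows : List (Row d m)}
    (h : Echelon vs done rows) {j : Fin m} {v : Fin d → ℚ} {c : Fin m → ℚ}
    (h1 : v = ∑ i, c i • vs i) (h3 : ∀ i, i ∉ done → i ≠ j → c i = 0)
    (h4 : vs j - v ∈ rowSpan rows) (h5 : ∀ r ∈ rows, v r.pivot = 0) {r₀ : Row d m} {a : ℚ}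
    (ha : a ≠ 0) (hpiv : v r₀.pivot = a) (hvec : r₀.vec = a⁻¹ • v)
    (hcoef : r₀.coef = a⁻¹ • c) :
    Echelon vs (done ++ [j]) (rows ++ [r₀]) := by
  have hle : rowSpan rows ≤ rowSpan (rows ++ [r₀]) := rowSpan_mono fun r hr => by simp [hr]
  constructor
  · intro r hr
    rcases List.mem_append.mp hr with hr | hr
    · exact h.comb r hr
    · obtain rfl := List.mem_singleton.mp hr
      rw [hvec, hcoef, h1, Finset.smul_sum]
      simp [mul_smul]
  · intro r hr k hk
    simp only [List.mem_append, List.mem_singleton, not_or] at hk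
    rcases List.mem_append.mp hr with hr | hr
    · exact h.supp r hr k hk.1
    · obtain rfl := List.mem_singleton.mp hr
      simp [hcoef, h3 k hk.1 hk.2]
  · intro r hr
    rcases List.mem_append.mp hr with hr | hr
    · exact h.unit r hr
    · obtain rfl := List.mem_singleton.mp hr
      simp [hvec, hpiv, ha]
  · refine List.pairwise_append.mpr ⟨h.zero, by simp, fun r hr r' hr' => ?_⟩
    obtain rfl := List.mem_singleton.mp hr'
    simp [hvec, h5 r hr]
  · intro k hk
    rcases List.mem_append.mp hk with hk | hk
    · exact hle (h.span k hk)
    · obtain rfl := List.mem_singleton.mp hk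
      have e : vs k = (vs k - v) + a • r₀.vec := by
        rw [hvec, smul_smul, mul_inv_cancel₀ ha]
        simp
      rw [e]
      exact add_mem (hle h4) (smul_mem _ _ (vec_mem_rowSpan (by simp)))
  · have hset : {k | k ∈ done ++ [j]} = insert j {k | k ∈ done} := by
      ext k; simp [or_comm]
    rw [hset]
    refine h.indep.insert fun hspan => ha ?_
    have hsub : Submodule.span ℚ (vs '' {k | k ∈ done}) ≤ rowSpan rows := by
      rw [Submodule.span_le]
      rintro _ ⟨k, hk, rfl⟩
      exact h.span k hk
    have hv0 : v = 0 := by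
      refine eq_zero_of_mem_rowSpan h.unit h.zero ?_ h5
      have := sub_mem (hsub hspan) h4
      simpa using this
    rw [← hpiv, hv0]
    rfl
  · simp [h.length]

/-- An upper bound for the number of steps of `dependency` on `m` vectors of length `d`. -/
def depTime (d m : ℕ) : ℕ := m * (m * (2 * d + 2 * m + 2) + 3 * d + 3 * m + 5) + 1

theorem dependencyAux_runs {vs : Fin m → Fin d → ℚ} (rest done : List (Fin m))
    (rows : List (Row d m)) (hl : List.finRange m = done ++ rest) (h : Echelon vs done rows) :
    Runs (dependencyAux vs rest rows) fun o s =>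
      s ≤ rest.length * (m * (2 * d + 2 * m + 2) + 3 * d + 3 * m + 5) + 1 ∧
      (o = none → LinearIndependent ℚ vs) ∧
      ∀ c, o = some c → ∑ i, c i • vs i = 0 ∧ ∃ j, c j = 1 ∧ ∀ i, j < i → c i = 0 := by
  induction rest generalizing done rows with
  | nil =>
    rw [dependencyAux]
    refine Runs.charge ⟨by simp, fun _ => ?_, by simp⟩
    have := h.indep
    rw [List.append_nil] at hl
    have hset : {i | i ∈ List.finRange m} = Set.univ := by ext; simp
    rwa [← hl, hset, linearIndepOn_univ_iff] at this
  | cons j js ih =>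
    have hnodup := List.nodup_finRange m
    have hlt : (List.finRange m).Pairwise (· < ·) := List.pairwise_lt_finRange m
    rw [hl] at hnodup hlt
    have hj : j ∉ done := by
      intro hjd
      exact (List.nodup_append.mp hnodup).2.2 j hjd j (by simp) rfl
    have hlen : rows.length ≤ m := by
      rw [h.length]
      have := congrArg List.length hl
      simp at this
      omega
    have hlen' : rows.length * (2 * d + 2 * m + 2) ≤ m * (2 * d + 2 * m + 2) :=
      Nat.mul_le_mul_right _ hlen
    rw [dependencyAux]
    refine Runs.charge_bind (Runs.charge_bind (Runs.seq (reduce_runs h hj) ?_))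
    rintro ⟨v, c⟩ s ⟨hs, h1, h2, h3, h4, h5⟩
    refine Runs.charge_bind ?_
    simp only at h1 h2 h3 h4 h5
    cases hf : (List.finRange d).find? fun i => decide (v i ≠ 0) with
    | none =>
      have hv : v = 0 := by
        ext i
        have := List.find?_eq_none.mp hf i (by simp)
        simpa using this
      refine Runs.pure ⟨?_, by simp, ?_⟩
      · simp only [List.length_cons, add_mul, one_mul]
        omega
      · rintro c' hc
        obtain rfl : c = c' := by simpa using hc
        refine ⟨by rw [← h1, hv], j, h2, fun i hi => h3 i ?_ hi.ne'⟩
        intro hid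
        exact absurd ((List.pairwise_append.mp hlt).2.2 i hid j (by simp)) hi.asymm
    | some i =>
      have hvi : v i ≠ 0 := by simpa using List.find?_some hf
      refine Runs.charge_bind (Runs.charge_bind (Runs.charge_bind (Runs.charge_bind ?_)))
      refine (ih (done ++ [j]) _ (by simp [hl]) (h.snoc h1 h3 h4 h5 hvi rfl
        (by ext k; simp) (by ext k; simp))).mono fun o s' ⟨hs', ho⟩ => ⟨?_, ho⟩
      simp only [List.length_cons, add_mul, one_mul]
      omega

theorem dependency_runs (vs : Fin m → Fin d → ℚ) :
    Runs (dependency vs) fun o s => s ≤ depTime d m ∧ (o = none → LinearIndependent ℚ vs) ∧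
      ∀ c, o = some c → ∑ i, c i • vs i = 0 ∧ ∃ j, c j = 1 ∧ ∀ i, j < i → c i = 0 := by
  refine (dependencyAux_runs (vs := vs) (List.finRange m) [] [] rfl ?_).mono ?_
  · exact ⟨by simp, by simp, by simp, by simp, by simp, by simp, rfl⟩
  · rintro o s ⟨hs, h⟩
    exact ⟨by simpa [depTime] using hs, h⟩

end Dependency

/-! ### Sign vectors and determinants -/

section SignVectors

open Submodule

variable {d : ℕ}

theorem card_signVec : Fintype.card (SignVec d) = 3 ^ d := by
  have : Fintype.card SignType = 3 := rfl
  simp [this]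

theorem abs_signType_le_one (s : SignType) : |((s : SignType) : ℤ)| ≤ 1 := by
  cases s <;> decide

theorem signType_cast_rat (s : SignType) : ((s : SignType) : ℚ) = (((s : SignType) : ℤ) : ℚ) := by
  cases s <;> simp

theorem one_le_self_pow_self (d : ℕ) : 1 ≤ d ^ d := by
  rcases Nat.eq_zero_or_pos d with rfl | h
  · simp
  · exact Nat.one_le_pow _ _ h

/-- The determinant of an `r × r` matrix over `{-1, 0, 1}` is at most `r!` in absolute value. -/
theorem abs_det_le_factorial {r : ℕ} (M : Matrix (Fin r) (Fin r) ℤ) (hM : ∀ i j, |M i j| ≤ 1) :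
    |M.det| ≤ (r.factorial : ℤ) := by
  rw [Matrix.det_apply]
  refine (Finset.abs_sum_le_sum_abs _ _).trans ?_
  have : ∀ σ ∈ (Finset.univ : Finset (Equiv.Perm (Fin r))),
      |Equiv.Perm.sign σ • ∏ i, M (σ i) i| ≤ 1 := by
    intro σ _
    have h1 : |∏ i, M (σ i) i| ≤ 1 := by
      rw [Finset.abs_prod]
      exact Finset.prod_le_one (fun _ _ => abs_nonneg _) fun i _ => hM _ _
    rcases Int.units_eq_one_or (Equiv.Perm.sign σ) with h | h <;> simpa [h] using h1
  refine (Finset.sum_le_card_nsmul _ _ _ this).trans ?_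
  simp [Finset.card_univ, Fintype.card_perm]

/-- Cramer's rule: the coefficients of an integer combination of independent sign vectors have a
common denominator of size at most `d ^ d`. -/
theorem exists_common_denominator_fin {r : ℕ} (u : Fin r → SignVec d)
    (hu : LinearIndependent ℚ fun j => (u j).toRat) (c : Fin r → ℚ) (b : Fin d → ℤ)
    (hc : ∀ k, ∑ j, c j * (u j).toRat k = b k) :
    ∃ Δ : ℕ, 0 < Δ ∧ Δ ≤ d ^ d ∧ ∀ j, ∃ z : ℤ, (Δ : ℚ) * c j = z := by
  set U : Matrix (Fin r) (Fin d) ℚ := fun j => (u j).toRat with hU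
  have hrank : U.rank = r := by
    have h := LinearIndependent.rank_matrix (M := U) hu
    simpa using h
  have hrow : Module.finrank ℚ (span ℚ (Set.range U.transpose)) = r :=
    (Matrix.rank_eq_finrank_span_cols U).symm.trans hrank
  obtain ⟨f, hf, -, hind⟩ := exists_fun_fin_finrank_span_eq ℚ (Set.range U.transpose)
  -- a choice of `r` coordinates on which the vectors stay independent
  choose g hg using hf
  have hle : r ≤ d := by
    have := hu.fintype_card_le_finrank
    simpa using this
  let e : Fin r ≃ Fin (Module.finrank ℚ (span ℚ (Set.range U.transpose))) := finCongr hrow.symm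
  let M : Matrix (Fin r) (Fin r) ℤ := fun i j => ((u j (g (e i)) : SignType) : ℤ)
  have hMQ : ∀ i j, ((M i j : ℤ) : ℚ) = U j (g (e i)) := fun i j => (signType_cast_rat _).symm
  have hdetQ : (M.map (Int.cast : ℤ → ℚ)).det ≠ 0 := by
    have hli : LinearIndependent ℚ (M.map (Int.cast : ℤ → ℚ)).row := by
      have h2 : (M.map (Int.cast : ℤ → ℚ)).row = f ∘ e := by
        ext i j
        change ((M i j : ℤ) : ℚ) = f (e i) j
        rw [hMQ, ← hg (e i)]
        rfl
      rw [h2]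
      exact hind.comp e e.injective
    have := Matrix.linearIndependent_rows_iff_isUnit.mp hli
    rw [Matrix.isUnit_iff_isUnit_det] at this
    exact this.ne_zero
  have hmap : (M.map (Int.cast : ℤ → ℚ)).det = ((M.det : ℤ) : ℚ) :=
    (Int.cast_det M).symm
  have hdet : M.det ≠ 0 := by
    intro h0
    apply hdetQ
    rw [hmap, h0]
    simp
  refine ⟨M.det.natAbs, Int.natAbs_pos.mpr hdet, ?_, ?_⟩
  · have h1 := abs_det_le_factorial M fun i j => abs_signType_le_one _
    have h2 : M.det.natAbs ≤ r.factorial := by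
      zify
      exact h1
    exact h2.trans ((Nat.factorial_le hle).trans (Nat.factorial_le_pow d))
  · have key : ∀ j, ∃ z : ℤ, ((M.det : ℤ) : ℚ) * c j = z := by
      intro j
      have hMc : (M.map (Int.cast : ℤ → ℚ)).mulVec c = fun i => ((b (g (e i)) : ℤ) : ℚ) := by
        ext i
        rw [← hc]
        simp only [Matrix.mulVec, dotProduct, Matrix.map_apply, hMQ]
        exact Finset.sum_congr rfl fun j _ => mul_comm _ _
      have hadj : (M.map (Int.cast : ℤ → ℚ)).adjugate.mulVec
          ((M.map (Int.cast : ℤ → ℚ)).mulVec c) = ((M.det : ℤ) : ℚ) • c := by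
        rw [Matrix.mulVec_mulVec, Matrix.adjugate_mul, hmap, Matrix.smul_mulVec,
          Matrix.one_mulVec]
      refine ⟨(M.adjugate.mulVec fun i => b (g (e i))) j, ?_⟩
      have h3 := congrFun hadj j
      rw [hMc] at h3
      simp only [Pi.smul_apply, smul_eq_mul] at h3
      rw [← h3]
      have h4 : (M.map (Int.cast : ℤ → ℚ)).adjugate = M.adjugate.map (Int.cast : ℤ → ℚ) :=
        ((Int.castRingHom ℚ).map_adjugate M).symm
      rw [h4]
      simp [Matrix.mulVec, dotProduct]
    intro j
    obtain ⟨z, hz⟩ := key j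
    rcases Int.natAbs_eq M.det with h | h
    · exact ⟨z, by rw [← hz, ← Int.cast_natCast, ← h]⟩
    · refine ⟨-z, ?_⟩
      have : ((M.det.natAbs : ℕ) : ℚ) = -((M.det : ℤ) : ℚ) := by
        have h' : ((M.det.natAbs : ℕ) : ℤ) = - M.det := by omega
        rw [← Int.cast_natCast, h', Int.cast_neg]
      rw [this, neg_mul, hz]
      simp

theorem exists_common_denominator {ι : Type*} [Fintype ι] (u : ι → SignVec d)
    (hu : LinearIndependent ℚ fun j => (u j).toRat) (c : ι → ℚ) (b : Fin d → ℤ)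
    (hc : ∀ k, ∑ j, c j * (u j).toRat k = b k) :
    ∃ Δ : ℕ, 0 < Δ ∧ Δ ≤ d ^ d ∧ ∀ j, ∃ z : ℤ, (Δ : ℚ) * c j = z := by
  let e := Fintype.equivFin ι
  obtain ⟨Δ, h0, h1, h2⟩ := exists_common_denominator_fin (u ∘ e.symm)
    (hu.comp e.symm e.symm.injective) (c ∘ e.symm) b (fun k => by
      rw [← hc k]
      exact Equiv.sum_comp e.symm fun j => c j * (u j).toRat k)
  exact ⟨Δ, h0, h1, fun j => by simpa using h2 (e j)⟩

theorem exists_signVec_extension {W : Finset (SignVec d)}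
    (hW : LinearIndepOn ℚ SignVec.toRat (W : Set (SignVec d))) :
    ∃ L : Finset (SignVec d), W ⊆ L ∧ L.card = d ∧
      LinearIndepOn ℚ SignVec.toRat (L : Set (SignVec d)) := by
  classical
  obtain ⟨b, -, hWb, hspan, hb⟩ := exists_linearIndepOn_extension hW (Set.subset_univ _)
  have hbf : b.Finite := Set.toFinite b
  obtain ⟨L, rfl⟩ := hbf.exists_finset_coe
  refine ⟨L, by exact_mod_cast hWb, ?_, hb⟩
  have htop : span ℚ (SignVec.toRat '' (L : Set (SignVec d))) = ⊤ := by
    rw [eq_top_iff, ← (Pi.basisFun ℚ (Fin d)).span_eq, span_le]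
    rintro _ ⟨i, rfl⟩
    refine hspan ⟨Pi.single i 1, Set.mem_univ _, ?_⟩
    ext k
    by_cases h : k = i
    · subst h; simp [SignVec.toRat]
    · simp [SignVec.toRat, h]
  have h1 := finrank_span_eq_card (R := ℚ) (b := fun x : (L : Set (SignVec d)) => x.1.toRat) hb
  have h2 : Set.range (fun x : (L : Set (SignVec d)) => x.1.toRat) =
      SignVec.toRat '' (L : Set (SignVec d)) := by
    rw [Set.image_eq_range]
  rw [h2, htop] at h1
  simpa using h1.symm

end SignVectors

/-! ### Augmentation profiles as circuits -/

section Circuits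

variable {d : ℕ}

namespace IsProfile

variable {V : Finset (SignVec d)}

theorem nonempty (hV : IsProfile V) : V.Nonempty := by
  rw [Finset.nonempty_iff_ne_empty]
  rintro rfl
  exact hV.dependent (by simp)

theorem erase_indep (hV : IsProfile V) {v : SignVec d} (hv : v ∈ V) :
    LinearIndepOn ℚ SignVec.toRat ((V.erase v : Finset (SignVec d)) : Set (SignVec d)) :=
  hV.minimal _ (Finset.erase_ssubset hv)

theorem card_le (hV : IsProfile V) : V.card ≤ d + 1 := by
  obtain ⟨v, hv⟩ := hV.nonempty
  obtain ⟨L, hL, hc, -⟩ := exists_signVec_extension (hV.erase_indep hv)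
  have := Finset.card_le_card hL
  rw [Finset.card_erase_of_mem hv] at this
  omega

theorem one_div_le_coef (hV : IsProfile V) {α : SignVec d → ℚ} (hα : ∀ v ∈ V, 0 < α v)
    (hrel : ∑ v ∈ V, α v • v.toRat = 0) {v₀ v : SignVec d} (hv₀ : v₀ ∈ V) (h1 : α v₀ = 1)
    (hv : v ∈ V) : 1 / (d ^ d : ℚ) ≤ α v := by
  have hD : (1 : ℚ) ≤ (d : ℚ) ^ d := by exact_mod_cast one_le_self_pow_self d
  by_cases h : v = v₀
  · rw [h, h1, div_le_one (by linarith)]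
    exact hD
  · obtain ⟨Δ, hΔ0, hΔ, hz⟩ := exists_common_denominator
      (fun w : (V.erase v₀ : Finset (SignVec d)) => w.1) (hV.erase_indep hv₀) (fun w => α w.1)
      (fun k => -((v₀ k : SignType) : ℤ)) (by
        intro k
        have h2 := congrFun hrel k
        rw [← Finset.add_sum_erase _ _ hv₀, h1] at h2
        simp only [Pi.add_apply, Finset.sum_apply, Pi.smul_apply, smul_eq_mul, one_mul,
          Pi.zero_apply] at h2
        refine (Finset.sum_coe_sort (V.erase v₀) fun w => α w * w.toRat k).trans ?_
        push_cast
        have : v₀.toRat k = ((v₀ k : SignType) : ℚ) := rfl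
        linarith)
    obtain ⟨z, hz⟩ := hz ⟨v, Finset.mem_erase.mpr ⟨h, hv⟩⟩
    have hΔ' : (0 : ℚ) < Δ := by exact_mod_cast hΔ0
    have hΔD : (Δ : ℚ) ≤ (d : ℚ) ^ d := by exact_mod_cast hΔ
    have hzpos : (0 : ℚ) < z := by rw [← hz]; exact mul_pos hΔ' (hα v hv)
    have hz1 : (1 : ℚ) ≤ z := by exact_mod_cast (by exact_mod_cast hzpos : (0 : ℤ) < z)
    rw [div_le_iff₀ (by linarith)]
    have := mul_le_mul_of_nonneg_right hΔD (hα v hv).le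
    simp only at hz
    linarith

theorem coef_le (hV : IsProfile V) {α : SignVec d → ℚ} (hα : ∀ v ∈ V, 0 < α v)
    (hrel : ∑ v ∈ V, α v • v.toRat = 0) {v₀ v : SignVec d} (hv₀ : v₀ ∈ V) (h1 : α v₀ = 1)
    (hv : v ∈ V) : α v ≤ (d ^ d : ℚ) := by
  have hD : (1 : ℚ) ≤ (d : ℚ) ^ d := by exact_mod_cast one_le_self_pow_self d
  have hv' := hα v hv
  have := hV.one_div_le_coef (α := fun w => (α v)⁻¹ * α w)
    (fun w hw => mul_pos (inv_pos.mpr hv') (hα w hw))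
    (by simp only [mul_smul, ← Finset.smul_sum, hrel, smul_zero]) hv
    (inv_mul_cancel₀ hv'.ne') hv₀
  rw [h1, mul_one, one_div] at this
  exact (inv_le_inv₀ (by linarith) hv').mp this

end IsProfile

/-- A profile is the only circuit in a suitable set of `d + 1` sign vectors, which gives an
injection from the profiles to the sets of that size. -/
theorem numProfiles_le (d : ℕ) : numProfiles d ≤ (3 ^ d).choose (d + 1) := by
  classical
  have hex : ∀ V : Finset (SignVec d), IsProfile V → ∃ W : Finset (SignVec d), V ⊆ W ∧
      W.card = d + 1 ∧ ∃ v ∈ V,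
        LinearIndepOn ℚ SignVec.toRat ((W.erase v : Finset (SignVec d)) : Set (SignVec d)) := by
    intro V hV
    obtain ⟨v, hv⟩ := hV.nonempty
    obtain ⟨L, hL, hc, hLi⟩ := exists_signVec_extension (hV.erase_indep hv)
    have hvL : v ∉ L := by
      intro hvL
      refine hV.dependent (hLi.mono ?_)
      intro w hw
      by_cases h : w = v
      · rw [h]; exact hvL
      · exact hL (Finset.mem_erase.mpr ⟨h, hw⟩)
    refine ⟨insert v L, ?_, by rw [Finset.card_insert_of_notMem hvL, hc], v, hv, ?_⟩
    · intro w hw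
      by_cases h : w = v
      · simp [h]
      · exact Finset.mem_insert_of_mem (hL (Finset.mem_erase.mpr ⟨h, hw⟩))
    · rwa [Finset.erase_insert hvL]
  choose! F hF using hex
  have huniq : ∀ V V' W : Finset (SignVec d), IsProfile V → IsProfile V' → V ⊆ W → V' ⊆ W →
      (∃ v ∈ V, LinearIndepOn ℚ SignVec.toRat ((W.erase v : Finset (SignVec d)) :
        Set (SignVec d))) → V ⊆ V' := by
    rintro V V' W hV hV' hVW hVW' ⟨v, hv, hind⟩
    obtain ⟨α, hα, hrel⟩ := hV.positive
    obtain ⟨α', hα', hrel'⟩ := hV'.positive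
    have hv' : v ∈ V' := by
      by_contra hv'
      refine hV'.dependent (hind.mono ?_)
      intro w hw
      exact Finset.mem_erase.mpr ⟨fun h => hv' (h ▸ hw), hVW' hw⟩
    have e1 : ∑ w ∈ W, (if w ∈ V then α w else 0) • w.toRat = 0 := by
      rw [← hrel, ← Finset.sum_subset hVW fun w _ hw => by simp [hw]]
      exact Finset.sum_congr rfl fun w hw => by simp [hw]
    have e2 : ∑ w ∈ W, (if w ∈ V' then α' w else 0) • w.toRat = 0 := by
      rw [← hrel', ← Finset.sum_subset hVW' fun w _ hw => by simp [hw]]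
      exact Finset.sum_congr rfl fun w hw => by simp [hw]
    have e3 : ∑ w ∈ W, (α' v * (if w ∈ V then α w else 0) -
        α v * (if w ∈ V' then α' w else 0)) • w.toRat = 0 := by
      simp only [sub_smul, mul_smul, Finset.sum_sub_distrib, ← Finset.smul_sum, e1, e2,
        smul_zero, sub_zero]
    rw [← Finset.add_sum_erase _ _ (hVW hv)] at e3
    simp only [hv, hv', if_true] at e3
    rw [mul_comm (α' v), sub_self, zero_smul, zero_add] at e3
    intro w hw
    by_contra hw'
    have hwv : w ≠ v := fun h => hw' (h ▸ hv')
    have := linearIndepOn_finset_iff.mp hind _ e3 w (Finset.mem_erase.mpr ⟨hwv, hVW hw⟩)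
    simp only [hw, hw', if_true, if_false, mul_zero, sub_zero] at this
    exact (mul_pos (hα' v hv') (hα w hw)).ne' this
  have hinj : Set.InjOn F {V | IsProfile V} := by
    intro V hV V' hV' h
    obtain ⟨h1, -, h3⟩ := hF V hV
    obtain ⟨h1', -, h3'⟩ := hF V' hV'
    refine Finset.Subset.antisymm ?_ ?_
    · exact huniq V V' (F V) hV hV' h1 (h ▸ h1') h3
    · exact huniq V' V (F V') hV' hV h1' (h ▸ h1) h3'
  have hcard : ((Finset.univ.powersetCard (d + 1) : Finset (Finset (SignVec d))) :
      Set (Finset (SignVec d))).ncard = (3 ^ d).choose (d + 1) := by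
    rw [Set.ncard_coe_finset, Finset.card_powersetCard, Finset.card_univ, card_signVec]
  refine le_trans (Set.ncard_le_ncard_of_injOn F ?_ hinj (Finset.finite_toSet _)) hcard.le
  intro V hV
  simp [(hF V hV).2.1]

/-- A real relation among rational vectors that is linearly independent over `ℚ` is trivial: it
is mapped to rational relations by the `ℚ`-linear functionals on `ℝ`. -/
theorem real_relation_eq_zero {W : Finset (SignVec d)}
    (hW : LinearIndepOn ℚ SignVec.toRat (W : Set (SignVec d))) {g : SignVec d → ℝ}
    (hg : ∀ k, ∑ v ∈ W, g v * (v.toRat k : ℝ) = 0) : ∀ v ∈ W, g v = 0 := by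
  intro v hv
  rw [← Module.forall_dual_apply_eq_zero_iff ℚ]
  intro φ
  refine linearIndepOn_finset_iff.mp hW (fun v => φ (g v)) ?_ v hv
  ext k
  have h := congrArg φ (hg k)
  rw [map_sum, map_zero] at h
  rw [Finset.sum_apply, Pi.zero_apply, ← h]
  refine Finset.sum_congr rfl fun w _ => ?_
  have : g w * (w.toRat k : ℝ) = (w.toRat k) • g w := by
    rw [Rat.smul_def, mul_comm]
  rw [this, map_smul]
  simp [mul_comm]

/-- Subtracting the largest admissible multiple of `β` from `g > 0` on `W` removes an element
of the support. -/
theorem exists_ratio_min {W : Finset (SignVec d)} {g β : SignVec d → ℝ} (hg : ∀ v ∈ W, 0 < g v)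
    (hβ : ∃ v ∈ W, 0 < β v) :
    ∃ t, 0 < t ∧ (∀ v ∈ W, 0 ≤ g v - t * β v) ∧ ∃ v ∈ W, 0 < β v ∧ g v - t * β v = 0 := by
  have hne : (W.filter fun v => 0 < β v).Nonempty := by
    obtain ⟨v, hv, h⟩ := hβ
    exact ⟨v, Finset.mem_filter.mpr ⟨hv, h⟩⟩
  obtain ⟨v, hv, hmin⟩ := Finset.exists_min_image _ (fun v => g v / β v) hne
  obtain ⟨hvW, hvβ⟩ := Finset.mem_filter.mp hv
  have ht : 0 < g v / β v := div_pos (hg v hvW) hvβ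
  refine ⟨g v / β v, ht, fun w hw => ?_, v, hvW, hvβ, ?_⟩
  · by_cases h : 0 < β w
    · have := hmin w (Finset.mem_filter.mpr ⟨hw, h⟩)
      rw [le_div_iff₀ h] at this
      linarith
    · have := mul_nonneg ht.le (neg_nonneg.mpr (not_lt.mp h))
      have := hg w hw
      linarith
  · rw [div_mul_cancel₀ _ hvβ.ne']
    ring

/-- A set with a positive real relation contains a profile. -/
theorem exists_profile_subset (W : Finset (SignVec d)) (hW : W.Nonempty) (g : SignVec d → ℝ)
    (hg : ∀ v ∈ W, 0 < g v) (hrel : ∀ k, ∑ v ∈ W, g v * (v.toRat k : ℝ) = 0) :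
    ∃ V ⊆ W, IsProfile V := by
  classical
  induction W using Finset.strongInduction generalizing g with
  | H W ih =>
  -- a relation with a smaller support leads to a smaller set with a positive relation
  have hred : ∀ β : SignVec d → ℝ, (∀ k, ∑ v ∈ W, β v * (v.toRat k : ℝ) = 0) →
      (∃ v ∈ W, 0 < β v) → (∀ t : ℝ, ∃ v ∈ W, g v - t * β v ≠ 0) → ∃ V ⊆ W, IsProfile V := by
    intro β hβ hpos hne
    obtain ⟨t, ht, hnn, v, hvW, -, hv0⟩ := exists_ratio_min hg hpos
    have hrel' : ∀ k, ∑ v ∈ W, (g v - t * β v) * (v.toRat k : ℝ) = 0 := by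
      intro k
      have h1 := hrel k
      have h2 := hβ k
      simp only [sub_mul, mul_assoc, Finset.sum_sub_distrib, ← Finset.mul_sum, h1, h2]
      simp
    obtain ⟨V, hV, hVp⟩ := ih (W.filter fun v => g v - t * β v ≠ 0)
      (Finset.filter_ssubset.mpr ⟨v, hvW, by simp [hv0]⟩)
      (by obtain ⟨w, hw, hw'⟩ := hne t; exact ⟨w, Finset.mem_filter.mpr ⟨hw, hw'⟩⟩)
      (fun v => g v - t * β v)
      (fun w hw => lt_of_le_of_ne (hnn w (Finset.mem_filter.mp hw).1)
        (Finset.mem_filter.mp hw).2.symm)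
      (fun k => by
        refine (Finset.sum_filter_of_ne fun w _ h => ?_).trans (hrel' k)
        exact left_ne_zero_of_mul h)
    exact ⟨V, hV.trans (Finset.filter_subset _ _), hVp⟩
  -- the same for relations of arbitrary sign
  have hred' : ∀ β : SignVec d → ℝ, (∀ k, ∑ v ∈ W, β v * (v.toRat k : ℝ) = 0) →
      (∃ v ∈ W, β v ≠ 0) → (∀ t : ℝ, ∃ v ∈ W, g v - t * β v ≠ 0) → ∃ V ⊆ W, IsProfile V := by
    intro β hβ ⟨v, hv, hvβ⟩ hne
    rcases lt_or_gt_of_ne hvβ with h | h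
    · refine hred (fun v => -β v) (fun k => ?_) ⟨v, hv, by linarith⟩ fun t => ?_
      · simp [neg_mul, hβ k]
      · obtain ⟨w, hw, h⟩ := hne (-t)
        exact ⟨w, hw, by simpa using h⟩
    · exact hred β hβ ⟨v, hv, h⟩ hne
  have hcast : ∀ (Y : Finset (SignVec d)) (β : SignVec d → ℚ), ∑ v ∈ Y, β v • v.toRat = 0 →
      ∀ k, ∑ v ∈ Y, (β v : ℝ) * (v.toRat k : ℝ) = 0 := by
    intro Y β hβ k
    have := congrFun hβ k
    simp only [Finset.sum_apply, Pi.smul_apply, smul_eq_mul, Pi.zero_apply] at this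
    exact_mod_cast this
  by_cases hmin : ∀ Y : Finset (SignVec d), Y ⊂ W →
      LinearIndepOn ℚ SignVec.toRat (Y : Set (SignVec d))
  · have hdep : ¬ LinearIndepOn ℚ SignVec.toRat (W : Set (SignVec d)) := by
      intro hind
      obtain ⟨v, hv⟩ := hW
      exact (hg v hv).ne' (real_relation_eq_zero hind hrel v hv)
    have hdep' := hdep
    rw [linearIndepOn_finset_iff] at hdep
    push Not at hdep
    obtain ⟨β, hβ, v, hv, hvβ⟩ := hdep
    by_cases hprop : ∃ t : ℝ, ∀ v ∈ W, g v - t * β v = 0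
    · obtain ⟨t, ht⟩ := hprop
      refine ⟨W, Finset.Subset.refl _, hdep', hmin, ?_⟩
      have ht0 : t ≠ 0 := by
        rintro rfl
        have := ht v hv
        have := hg v hv
        simp_all
      rcases lt_or_gt_of_ne ht0 with h | h
      · refine ⟨fun v => -β v, fun w hw => ?_, by simp [hβ]⟩
        have h1 := hg w hw
        have h2 := ht w hw
        have h3 : (β w : ℝ) < 0 := by
          by_contra h4
          have := mul_nonneg (neg_nonneg.mpr h.le) (not_lt.mp h4)
          linarith
        have : β w < 0 := by exact_mod_cast h3
        simpa using this
      · refine ⟨β, fun w hw => ?_, hβ⟩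
        have h1 := hg w hw
        have h2 := ht w hw
        have h3 : 0 < (β w : ℝ) := by
          by_contra h4
          have := mul_nonneg h.le (neg_nonneg.mpr (not_lt.mp h4))
          linarith
        exact_mod_cast h3
    · push Not at hprop
      exact hred' (fun v => β v) (hcast W β hβ) ⟨v, hv, by exact_mod_cast hvβ⟩ hprop
  · push Not at hmin
    obtain ⟨Y, hY, hdep⟩ := hmin
    rw [linearIndepOn_finset_iff] at hdep
    push Not at hdep
    obtain ⟨β, hβ, v, hv, hvβ⟩ := hdep
    have hβW : ∑ v ∈ W, (if v ∈ Y then β v else 0) • v.toRat = 0 := by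
      rw [← hβ, ← Finset.sum_subset hY.1 fun w _ hw => by simp [hw]]
      exact Finset.sum_congr rfl fun w hw => by simp [hw]
    refine hred' (fun v => ((if v ∈ Y then β v else 0 : ℚ) : ℝ)) (hcast W _ hβW)
      ⟨v, hY.1 hv, by simp [hv, hvβ]⟩ fun t => ?_
    obtain ⟨w, hw, hwY⟩ := Finset.exists_of_ssubset hY
    exact ⟨w, hw, by simpa [hwY] using (hg w hw).ne'⟩

/-- A linear functional that is nonnegative on the profiles is nonnegative on all nonnegative
relations, because these are conical combinations of profiles. -/
theorem sum_nonneg_of_profiles (φ : SignVec d → ℝ) (g : SignVec d → ℝ) (W : Finset (SignVec d))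
    (hg : ∀ v ∈ W, 0 < g v) (hrel : ∀ k, ∑ v ∈ W, g v * (v.toRat k : ℝ) = 0)
    (hφ : ∀ V ⊆ W, IsProfile V → ∃ α : SignVec d → ℚ, (∀ v ∈ V, 0 < α v) ∧
      ∑ v ∈ V, α v • v.toRat = 0 ∧ 0 ≤ ∑ v ∈ V, (α v : ℝ) * φ v) :
    0 ≤ ∑ v ∈ W, g v * φ v := by
  classical
  induction W using Finset.strongInduction generalizing g with
  | H W ih =>
  rcases W.eq_empty_or_nonempty with rfl | hne
  · simp
  obtain ⟨V, hVW, hV⟩ := exists_profile_subset W hne g hg hrel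
  obtain ⟨α, hα, hαrel, hαφ⟩ := hφ V hVW hV
  set β : SignVec d → ℝ := fun v => if v ∈ V then (α v : ℝ) else 0 with hβ
  have hext : ∀ f : SignVec d → ℝ, ∑ v ∈ W, β v * f v = ∑ v ∈ V, (α v : ℝ) * f v := by
    intro f
    rw [← Finset.sum_subset hVW fun w _ hw => by simp [hβ, hw]]
    exact Finset.sum_congr rfl fun w hw => by simp [hβ, hw]
  have hβrel : ∀ k, ∑ v ∈ W, β v * (v.toRat k : ℝ) = 0 := by
    intro k
    rw [hext]
    have := congrFun hαrel k
    simp only [Finset.sum_apply, Pi.smul_apply, smul_eq_mul, Pi.zero_apply] at this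
    exact_mod_cast this
  obtain ⟨v₀, hv₀⟩ := hV.nonempty
  obtain ⟨t, ht, hnn, v, hvW, -, hv0⟩ := exists_ratio_min (W := W) (g := g) (β := β) hg
    ⟨v₀, hVW hv₀, by simp only [hβ, hv₀, if_true]; exact_mod_cast hα v₀ hv₀⟩
  have hrel' : ∀ k, ∑ v ∈ W, (g v - t * β v) * (v.toRat k : ℝ) = 0 := by
    intro k
    simp only [sub_mul, mul_assoc, Finset.sum_sub_distrib, ← Finset.mul_sum, hrel k, hβrel k]
    simp
  have h1 := ih (W.filter fun v => g v - t * β v ≠ 0)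
    (Finset.filter_ssubset.mpr ⟨v, hvW, by simp [hv0]⟩) (fun v => g v - t * β v)
    (fun w hw => lt_of_le_of_ne (hnn w (Finset.mem_filter.mp hw).1)
      (Finset.mem_filter.mp hw).2.symm)
    (fun k => (Finset.sum_filter_of_ne fun w _ h => left_ne_zero_of_mul h).trans (hrel' k))
    (fun V hV => hφ V (hV.trans (Finset.filter_subset _ _)))
  rw [Finset.sum_filter_of_ne fun w _ h => left_ne_zero_of_mul h] at h1
  simp only [sub_mul, mul_assoc, Finset.sum_sub_distrib, ← Finset.mul_sum, hext φ] at h1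
  have := mul_nonneg ht.le hαφ
  linarith

end Circuits

/-! ### Generating the augmentation profiles -/

section Preprocess

variable {d : ℕ}

theorem length_signVecs : ∀ d, (signVecs d).length = 3 ^ d
  | 0 => rfl
  | d + 1 => by
    simp [signVecs, length_signVecs d]
    ring

theorem mem_signVecs : ∀ (d : ℕ) (v : SignVec d), v ∈ signVecs d
  | 0, v => by
    rw [signVecs, List.mem_singleton]
    exact Subsingleton.elim _ _
  | d + 1, v => by
    rw [signVecs, List.mem_flatMap]
    refine ⟨v 0, ?_, List.mem_map.mpr ⟨Fin.tail v, mem_signVecs d _, Fin.cons_self_tail v⟩⟩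
    cases v 0 <;> decide

theorem nodup_signVecs : ∀ d, (signVecs d).Nodup
  | 0 => by simp [signVecs]
  | d + 1 => by
    rw [signVecs, List.nodup_flatMap]
    refine ⟨fun s _ => (nodup_signVecs d).map fun u u' h =>
      Fin.cons_right_injective (α := fun _ => SignType) s h, ?_⟩
    have : ([-1, 0, 1] : List SignType).Nodup := by decide
    refine List.Pairwise.imp (fun {s s'} hss v hv hv' => ?_) this
    obtain ⟨u, -, rfl⟩ := List.mem_map.mp hv
    obtain ⟨u', -, h⟩ := List.mem_map.mp hv'
    exact hss (congrFun h 0).symm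

/-- The vectors of a list of vectors with coefficients. -/
def Profile.support (V : Profile d) : Finset (SignVec d) := (V.map Prod.fst).toFinset

/-- A list of distinct vectors with positive coefficients that represents an augmentation profile
and its linear relation, up to a factor. -/
structure RepresentsProfile (V : Profile d) : Prop where
  isProfile : IsProfile V.support
  nodup : (V.map Prod.fst).Nodup
  pos : ∀ t ∈ V, 0 < t.2
  rel : (V.map fun t => t.2 • t.1.toRat).sum = 0

/-- A list that represents an augmentation profile, with `1` among its coefficients. -/
structure NormalizedProfile (V : Profile d) : Prop extends RepresentsProfile V where
  unit : ∃ t ∈ V, t.2 = 1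

theorem RepresentsProfile.length_le {V : Profile d} (h : RepresentsProfile V) :
    V.length ≤ d + 1 := by
  have := h.isProfile.card_le
  rwa [Profile.support, List.toFinset_card_of_nodup h.nodup, List.length_map] at this

theorem RepresentsProfile.ne_nil {V : Profile d} (h : RepresentsProfile V) : V ≠ [] := by
  rintro rfl
  simpa [Profile.support] using h.isProfile.nonempty

/-- The coefficients of a profile as a function on the sign vectors. -/
def Profile.coef (V : Profile d) (v : SignVec d) : ℚ :=
  (V.map fun t => if t.1 = v then t.2 else 0).sum

theorem Profile.coef_eq {V : Profile d} (h : (V.map Prod.fst).Nodup) {t : SignVec d × ℚ}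
    (ht : t ∈ V) : V.coef t.1 = t.2 := by
  induction V with
  | nil => simp at ht
  | cons s V ih =>
    rw [List.map_cons, List.nodup_cons] at h
    have hzero : ∀ v, v ∉ V.map Prod.fst → (V.map fun t => if t.1 = v then t.2 else 0).sum = 0 := by
      intro v hv
      refine List.sum_eq_zero fun x hx => ?_
      obtain ⟨t, ht, rfl⟩ := List.mem_map.mp hx
      rw [if_neg]
      rintro rfl
      exact hv (List.mem_map.mpr ⟨t, ht, rfl⟩)
    rw [Profile.coef, List.map_cons, List.sum_cons]
    rcases List.mem_cons.mp ht with rfl | ht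
    · rw [hzero _ h.1]
      simp
    · rw [if_neg, zero_add]
      · exact ih h.2 ht
      · intro e
        exact h.1 (e ▸ List.mem_map.mpr ⟨t, ht, rfl⟩)

theorem Profile.sum_support {M : Type*} [AddCommMonoid M] {V : Profile d}
    (h : (V.map Prod.fst).Nodup) (f : SignVec d → ℚ → M) :
    ∑ v ∈ V.support, f v (V.coef v) = (V.map fun t => f t.1 t.2).sum := by
  rw [Profile.support, List.sum_toFinset _ h, List.map_map]
  refine congrArg List.sum (List.map_congr_left fun t ht => ?_)
  simp only [Function.comp_apply]
  rw [Profile.coef_eq h ht]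

theorem RepresentsProfile.coef_pos {V : Profile d} (h : RepresentsProfile V) :
    ∀ v ∈ V.support, 0 < V.coef v := by
  intro v hv
  obtain ⟨t, ht, rfl⟩ := List.mem_map.mp (List.mem_toFinset.mp hv)
  rw [Profile.coef_eq h.nodup ht]
  exact h.pos t ht

theorem RepresentsProfile.coef_rel {V : Profile d} (h : RepresentsProfile V) :
    ∑ v ∈ V.support, V.coef v • v.toRat = 0 := by
  rw [Profile.sum_support h.nodup fun v a => a • v.toRat, h.rel]

theorem NormalizedProfile.bounds {V : Profile d} (h : NormalizedProfile V)
    {t : SignVec d × ℚ} (ht : t ∈ V) : 1 / (d ^ d : ℚ) ≤ t.2 ∧ t.2 ≤ (d ^ d : ℚ) := by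
  obtain ⟨t₀, ht₀, h1⟩ := h.unit
  have hmem : ∀ t ∈ V, t.1 ∈ V.support := fun t ht =>
    List.mem_toFinset.mpr (List.mem_map.mpr ⟨t, ht, rfl⟩)
  rw [← Profile.coef_eq h.nodup ht₀] at h1
  rw [← Profile.coef_eq h.nodup ht]
  exact ⟨h.isProfile.one_div_le_coef h.coef_pos h.coef_rel (hmem _ ht₀) h1 (hmem _ ht),
    h.isProfile.coef_le h.coef_pos h.coef_rel (hmem _ ht₀) h1 (hmem _ ht)⟩

theorem RepresentsProfile.perm {V W : Profile d} (h : RepresentsProfile V) (hp : W.Perm V) :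
    RepresentsProfile W ∧ W.support = V.support := by
  have hs : W.support = V.support := by
    ext v
    simp only [Profile.support, List.mem_toFinset]
    exact (hp.map _).mem_iff
  exact ⟨⟨hs ▸ h.isProfile, (hp.map _).nodup_iff.mpr h.nodup,
    fun t ht => h.pos t (hp.mem_iff.mp ht), (hp.map _).sum_eq.trans h.rel⟩, hs⟩

theorem RepresentsProfile.div {V : Profile d} (h : RepresentsProfile V) {a : ℚ} (ha : 0 < a) :
    RepresentsProfile (V.map fun t => (t.1, t.2 / a)) ∧
      Profile.support (V.map fun t => (t.1, t.2 / a)) = V.support := by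
  have hm : (V.map fun t => (t.1, t.2 / a)).map Prod.fst = V.map Prod.fst := by
    rw [List.map_map]
    rfl
  have hs : Profile.support (V.map fun t => (t.1, t.2 / a)) = V.support := by
    rw [Profile.support, hm]
    rfl
  refine ⟨⟨hs ▸ h.isProfile, hm ▸ h.nodup, ?_, ?_⟩, hs⟩
  · intro t ht
    obtain ⟨t', ht', rfl⟩ := List.mem_map.mp ht
    exact div_pos (h.pos t' ht') ha
  · have := congrArg (fun v => a⁻¹ • v) h.rel
    rw [smul_zero] at this
    rw [← this, List.smul_sum, List.map_map, List.map_map]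
    refine congrArg List.sum (List.map_congr_left fun t _ => ?_)
    simp [smul_smul, div_eq_inv_mul]

theorem sortTime_mono {m m' : ℕ} (h : m ≤ m') (c : ℕ) : sortTime m c ≤ sortTime m' c := by
  unfold sortTime
  have := Nat.clog_mono_right 2 h
  gcongr

theorem normalize_runs {V : Profile d} (h : RepresentsProfile V) :
    Runs (normalize V) fun W s => s ≤ sortTime (d + 1) d + (d + 2) ∧ NormalizedProfile W ∧
      W.support = V.support := by
  have hlen := h.length_le
  refine Runs.seq (mergeSort_runs _ (fun s t => decide (List.ofFn s.1 ≤ List.ofFn t.1) = true)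
    d V fun a _ b _ => Runs.charge ⟨le_rfl, Iff.rfl⟩) ?_
  rintro W s ⟨hs, hp, -⟩
  have hs' := hs.trans (sortTime_mono hlen d)
  obtain ⟨hW, hsupp⟩ := h.perm hp
  have hlen' := hW.length_le
  match W, hW with
  | [], hW => exact absurd rfl hW.ne_nil
  | (v, a) :: W, hW =>
    have ha : 0 < a := hW.pos (v, a) (by simp)
    obtain ⟨h1, h2⟩ := hW.div ha
    simp only [List.map_cons, div_self ha.ne'] at h1 h2
    refine Runs.charge ⟨?_, ⟨h1, (v, 1), by simp, rfl⟩, h2.trans hsupp⟩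
    simp only [List.length_cons] at hlen'
    omega

/-- A nonnegative relation of a family that has, up to a factor, no other relation is supported
on a profile. -/
theorem isProfile_of_relation {ι : Type*} [Fintype ι] [DecidableEq ι] (u : ι → SignVec d) (l : ι)
    (huniq : ∀ γ : ι → ℚ, ∑ j, γ j • (u j).toRat = 0 → γ l = 0 → ∀ j, γ j = 0) (α : ι → ℚ)
    (hα : ∑ j, α j • (u j).toRat = 0) (hl : α l = 1) (hnn : ∀ j, 0 ≤ α j) :
    Function.Injective u ∧
      IsProfile ((Finset.univ.filter fun j => α j ≠ 0).image u) := by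
  have hprop : ∀ γ : ι → ℚ, ∑ j, γ j • (u j).toRat = 0 → ∀ j, γ j = γ l * α j := by
    intro γ hγ j
    have := huniq (fun j => γ j - γ l * α j)
      (by simp only [sub_smul, mul_smul, Finset.sum_sub_distrib, ← Finset.smul_sum, hγ, hα]
          simp) (by simp [hl]) j
    linarith
  have hinj : Function.Injective u := by
    intro i j hij
    by_contra hne
    have h1 : ∑ k, ((Pi.single i 1 - Pi.single j 1 : ι → ℚ) k) • (u k).toRat = 0 := by
      simp only [Pi.sub_apply, sub_smul, Finset.sum_sub_distrib]
      simp [Pi.single_apply, hij]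
    have h2 := hprop _ h1
    -- the relation `u i - u j = 0` takes both signs, unlike the multiples of `α`
    have hi := h2 i
    have hj := h2 j
    simp only [Pi.sub_apply, Pi.single_eq_same, Pi.single_eq_of_ne hne,
      Pi.single_eq_of_ne (Ne.symm hne), sub_zero, zero_sub] at hi hj
    rcases le_total 0 ((Pi.single i 1 : ι → ℚ) l - (Pi.single j 1 : ι → ℚ) l) with h | h
    · have := mul_nonneg h (hnn j)
      linarith
    · have := mul_nonneg (neg_nonneg.mpr h) (hnn i)
      linarith
  refine ⟨hinj, ?_⟩
  set S := (Finset.univ.filter fun j => α j ≠ 0).image u with hS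
  have hsum : ∀ g : SignVec d → ℚ, (∀ v, v ∉ S → g v = 0) →
      ∑ v ∈ S, g v • v.toRat = ∑ j, g (u j) • (u j).toRat := by
    intro g hg
    rw [hS, Finset.sum_image fun i _ j _ h => hinj h]
    refine Finset.sum_subset (Finset.filter_subset _ _) fun j _ hj => ?_
    rw [hg (u j), zero_smul]
    intro h
    obtain ⟨i, hi, hij⟩ := Finset.mem_image.mp h
    exact hj (hinj hij ▸ hi)
  let A : SignVec d → ℚ := fun v => ∑ j, if u j = v then α j else 0
  have hA : ∀ j, A (u j) = α j := by
    intro j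
    simp only [A]
    rw [Finset.sum_eq_single j] <;> simp +contextual [hinj.eq_iff]
  have hA0 : ∀ v, v ∉ S → A v = 0 := by
    intro v hv
    refine Finset.sum_eq_zero fun j _ => ?_
    split_ifs with h
    · by_contra h0
      exact hv (Finset.mem_image.mpr ⟨j, by simp [h0], h⟩)
    · rfl
  have hArel : ∑ v ∈ S, A v • v.toRat = 0 := by
    rw [hsum A hA0]
    simp only [hA, hα]
  have hApos : ∀ v ∈ S, 0 < A v := by
    intro v hv
    obtain ⟨j, hj, rfl⟩ := Finset.mem_image.mp hv
    rw [hA]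
    exact lt_of_le_of_ne (hnn j) (Finset.mem_filter.mp hj).2.symm
  refine ⟨?_, ?_, A, hApos, hArel⟩
  · rw [linearIndepOn_finset_iff]
    intro h
    have hlS : u l ∈ S := Finset.mem_image.mpr ⟨l, by simp [hl], rfl⟩
    have := h A hArel _ hlS
    rw [hA, hl] at this
    exact one_ne_zero this
  · intro T hT
    rw [linearIndepOn_finset_iff]
    intro f hf
    obtain ⟨v₀, hv₀, hv₀T⟩ := Finset.exists_of_ssubset hT
    obtain ⟨j₀, hj₀, rfl⟩ := Finset.mem_image.mp hv₀
    have h1 : ∑ j, (if u j ∈ T then f (u j) else 0) • (u j).toRat = 0 := by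
      rw [← hsum (fun v => if v ∈ T then f v else 0) fun v hv => if_neg fun h => hv (hT.1 h), ← hf,
        ← Finset.sum_subset hT.1 fun w _ hw => by simp [hw]]
      exact Finset.sum_congr rfl fun w hw => by simp [hw]
    have h2 := hprop _ h1
    have h3 := h2 j₀
    rw [if_neg hv₀T] at h3
    have h4 := (mul_eq_zero.mp h3.symm).resolve_right (Finset.mem_filter.mp hj₀).2
    intro v hv
    obtain ⟨j, -, rfl⟩ := Finset.mem_image.mp (hT.1 hv)
    have h5 := h2 j
    rwa [h4, zero_mul, if_pos hv] at h5

/-- An upper bound for the number of steps of `expand`. -/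
def expandTime (d : ℕ) : ℕ :=
  (d + 1) * (d + 1) + depTime d (d + 1) + ((d + 1) * (d + 4) + 1) +
    (sortTime (d + 1) d + (d + 2))

/-- The loop of `expand`: collect the vectors with nonzero coefficients, or find a negative
coefficient. -/
theorem collect_runs {F : List (SignVec d)} (α : Fin F.length → ℚ) :
    Runs (each (List.finRange F.length) (some []) fun (acc : Option (Profile d)) j => do
      match acc with
      | none => pure none
      | some V =>
        if ← lt (α j) 0 then pure none
        else if ← isZero (α j) then pure (some V)
        else charge (d + 1) (some ((F.get j, α j) :: V))) fun o s =>
      s ≤ F.length * (d + 4) + 1 ∧ (o = none → ∃ j, α j < 0) ∧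
      ∀ V, o = some V → (∀ j, 0 ≤ α j) ∧
        V = (((List.finRange F.length).filter fun j => α j ≠ 0).map
          fun j => (F.get j, α j)).reverse := by
  refine (Runs.each (d + 3) (fun (done : List (Fin F.length)) (o : Option (Profile d)) =>
    (o = none → ∃ j, α j < 0) ∧ ∀ V, o = some V → (∀ j ∈ done, 0 ≤ α j) ∧
      V = ((done.filter fun j => α j ≠ 0).map fun j => (F.get j, α j)).reverse) ?_ ?_).mono ?_
  · simp
  · rintro done j rest o - ⟨h1, h2⟩
    match o, h1, h2 with
    | none, h1, h2 => exact Runs.pure ⟨by omega, fun _ => h1 rfl, by simp⟩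
    | some V, h1, h2 =>
      obtain ⟨h3, h4⟩ := h2 V rfl
      refine Runs.charge_bind ?_
      by_cases hneg : α j < 0
      · simp only [hneg, decide_true, if_true]
        exact Runs.pure ⟨by omega, fun _ => ⟨j, hneg⟩, by simp⟩
      · simp only [hneg, decide_false, Bool.false_eq_true, if_false]
        refine Runs.charge_bind ?_
        have hmem : ∀ k ∈ done ++ [j], 0 ≤ α k := by
          intro k hk
          rcases List.mem_append.mp hk with hk | hk
          · exact h3 k hk
          · rw [List.mem_singleton.mp hk]
            exact not_lt.mp hneg
        by_cases h0 : α j = 0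
        · simp only [h0, decide_true, if_true]
          refine Runs.pure ⟨by omega, by simp, ?_⟩
          rintro V' hV'
          obtain rfl : V = V' := by simpa using hV'
          refine ⟨hmem, ?_⟩
          rw [h4]
          simp [List.filter_append, h0]
        · simp only [h0, decide_false, Bool.false_eq_true, if_false]
          refine Runs.charge ⟨by omega, by simp, ?_⟩
          rintro V' hV'
          obtain rfl : (F.get j, α j) :: V = V' := by simpa using hV'
          refine ⟨hmem, ?_⟩
          rw [h4]
          simp [List.filter_append, h0]
  · rintro o s ⟨hs, h1, h2⟩
    refine ⟨by simpa using hs, h1, fun V hV => ?_⟩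
    obtain ⟨h3, h4⟩ := h2 V hV
    exact ⟨fun j => h3 j (by simp), h4⟩

theorem sum_get_append_singleton {M : Type*} [AddCommMonoid M] (L : List (SignVec d))
    (w : SignVec d) (l : Fin (L ++ [w]).length) (hl : l.1 = L.length)
    (g : Fin (L ++ [w]).length → M) :
    ∑ j, g j = ∑ j : Fin L.length, g ⟨j.1, by simp⟩ + g l := by
  have hlen : L.length + 1 = (L ++ [w]).length := by simp
  rw [← Equiv.sum_comp (finCongr hlen) g, Fin.sum_univ_castSucc]
  congr 1
  congr 1
  exact Fin.ext hl.symm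

theorem expand_runs {L : List (SignVec d)} (hlen : L.length = d)
    (hL : LinearIndependent ℚ fun j : Fin L.length => (L.get j).toRat) (w : SignVec d) :
    Runs (expand L w) fun o s => s ≤ expandTime d ∧ (∀ V, o = some V → NormalizedProfile V) ∧
      ∀ W, IsProfile W → -w ∈ W → W.erase (-w) ⊆ L.toFinset →
        ∃ V, o = some V ∧ Profile.support V = W := by
  refine Runs.charge_bind ?_
  have hF : (L ++ [-w]).length = d + 1 := by simp [hlen]
  have hget : ∀ j : Fin L.length, (L ++ [-w]).get ⟨j.1, by simp⟩ = L.get j := by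
    intro j
    simp
  have hgetl : ∀ l : Fin (L ++ [-w]).length, l.1 = L.length → (L ++ [-w]).get l = -w := by
    intro l hl
    simp [hl]
  obtain ⟨l, hl⟩ : ∃ l : Fin (L ++ [-w]).length, l.1 = L.length :=
    ⟨⟨L.length, by simp⟩, rfl⟩
  have huniq : ∀ γ : Fin (L ++ [-w]).length → ℚ,
      ∑ j, γ j • ((L ++ [-w]).get j).toRat = 0 → γ l = 0 → ∀ j, γ j = 0 := by
    intro γ hγ hγl j
    rw [sum_get_append_singleton L (-w) l hl, hγl, zero_smul, add_zero] at hγ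
    simp only [hget] at hγ
    have h := Fintype.linearIndependent_iff.mp hL _ hγ
    by_cases hj : j.1 < L.length
    · exact h ⟨j.1, hj⟩
    · have : j = l := by
        have := j.2
        simp only [List.length_append, List.length_singleton] at this
        exact Fin.ext (by omega)
      rw [this, hγl]
  refine Runs.seq (dependency_runs _) ?_
  rintro o s ⟨hs, hnone, hsome⟩
  rw [hF] at hs
  match o, hnone, hsome with
  | none, hnone, _ =>
    have := (hnone rfl).fintype_card_le_finrank
    simp [hlen] at this
  | some α, _, hsome =>
    obtain ⟨hrel, j₀, hj₀, hgt⟩ := hsome α rfl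
    have hαl : α l = 1 := by
      by_cases h : j₀ = l
      · rw [← h, hj₀]
      · have hlt : j₀ < l := by
          have := j₀.2
          simp only [List.length_append, List.length_singleton] at this
          refine lt_of_le_of_ne (Fin.le_def.mpr ?_) h
          omega
        have := huniq α hrel (hgt l hlt) j₀
        rw [hj₀] at this
        exact absurd this one_ne_zero
    have hcompl : ∀ W, IsProfile W → -w ∈ W → W.erase (-w) ⊆ L.toFinset →
        (∀ j, 0 ≤ α j) ∧ (Finset.univ.filter fun j => α j ≠ 0).image
          (fun j => (L ++ [-w]).get j) = W := by
      intro W hW hwW hWL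
      obtain ⟨β, hβ, hβrel⟩ := hW.positive
      have hLinj : Function.Injective fun j : Fin L.length => L.get j := by
        intro i j hij
        exact hL.injective (by simp only at hij ⊢; rw [hij])
      have hLnd : L.Nodup := List.nodup_iff_injective_get.mpr hLinj
      have hLon : LinearIndepOn ℚ SignVec.toRat {v | v ∈ L} := by
        have h2 : LinearIndepOn ℚ SignVec.toRat (Set.range fun j : Fin L.length => L.get j) :=
          (linearIndepOn_range_iff hLinj SignVec.toRat).mpr hL
        exact h2.mono fun v hv => List.mem_iff_get.mp hv
      have hwL : -w ∉ L := by
        intro hwL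
        refine hW.dependent (hLon.mono fun v hv => ?_)
        by_cases h : v = -w
        · rw [h]; exact hwL
        · exact List.mem_toFinset.mp (hWL (Finset.mem_erase.mpr ⟨h, hv⟩))
      have hnd : (L ++ [-w]).Nodup := by
        rw [List.nodup_append]
        exact ⟨hLnd, by simp, fun a ha b hb h => hwL (by
          rw [List.mem_singleton] at hb
          rw [← hb, ← h]
          exact ha)⟩
      have hinj : Function.Injective (fun j => (L ++ [-w]).get j) :=
        List.nodup_iff_injective_get.mp hnd
      have hWr : ∀ v ∈ W, ∃ j, (L ++ [-w]).get j = v := by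
        intro v hv
        have : v ∈ L ++ [-w] := by
          by_cases h : v = -w
          · simp [h]
          · exact List.mem_append_left _
              (List.mem_toFinset.mp (hWL (Finset.mem_erase.mpr ⟨h, hv⟩)))
        exact List.mem_iff_get.mp this
      have hγ : ∑ j, (if (L ++ [-w]).get j ∈ W then β ((L ++ [-w]).get j) else 0) •
          ((L ++ [-w]).get j).toRat = 0 := by
        rw [← hβrel]
        have e1 : ∑ v ∈ W, β v • v.toRat =
            ∑ v ∈ W, (if v ∈ W then β v else 0) • v.toRat :=
          Finset.sum_congr rfl fun v hv => by simp [hv]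
        have hsub : W ⊆ Finset.univ.image fun j => (L ++ [-w]).get j := by
          intro v hv
          obtain ⟨j, hj⟩ := hWr v hv
          exact Finset.mem_image.mpr ⟨j, Finset.mem_univ _, hj⟩
        rw [e1, Finset.sum_subset hsub fun v _ hv => by simp [hv],
          Finset.sum_image fun i _ j _ h => hinj h]
      have hγl : (if (L ++ [-w]).get l ∈ W then β ((L ++ [-w]).get l) else 0) = β (-w) := by
        rw [hgetl l hl, if_pos hwW]
      have hprop : ∀ j, (if (L ++ [-w]).get j ∈ W then β ((L ++ [-w]).get j) else 0) =
          β (-w) * α j := by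
        intro j
        have := huniq (fun j => (if (L ++ [-w]).get j ∈ W then β ((L ++ [-w]).get j) else 0) -
            β (-w) * α j)
          (by
            simp only [sub_smul, mul_smul, Finset.sum_sub_distrib, ← Finset.smul_sum]
            rw [hγ, hrel]
            simp) (by
            rw [hγl, hαl]
            ring) j
        linarith
      have hpos := hβ _ hwW
      refine ⟨fun j => ?_, ?_⟩
      · have h1 : 0 ≤ β (-w) * α j := by
          rw [← hprop]
          split_ifs with h
          · exact (hβ _ h).le
          · exact le_rfl
        exact nonneg_of_mul_nonneg_right h1 hpos
      · ext v
        simp only [Finset.mem_image, Finset.mem_filter, Finset.mem_univ, true_and]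
        constructor
        · rintro ⟨j, hj, rfl⟩
          by_contra h
          have := hprop j
          rw [if_neg h] at this
          exact hj ((mul_eq_zero.mp this.symm).resolve_left hpos.ne')
        · intro hv
          obtain ⟨j, rfl⟩ := hWr v hv
          refine ⟨j, fun h => ?_, rfl⟩
          have := hprop j
          rw [if_pos hv, h, mul_zero] at this
          exact (hβ _ hv).ne' this
    refine Runs.seq (collect_runs α) ?_
    rintro o s₁ ⟨hs₁, hcnone, hcsome⟩
    rw [hF] at hs₁
    match o, hcnone, hcsome with
    | none, hcnone, _ =>
      refine Runs.pure ⟨?_, by simp, ?_⟩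
      · unfold expandTime
        rw [hlen]
        omega
      · intro W hW hwW hWL
        obtain ⟨j, hj⟩ := hcnone rfl
        exact absurd ((hcompl W hW hwW hWL).1 j) (not_le.mpr hj)
    | some V, _, hcsome =>
      obtain ⟨hnn, hV⟩ := hcsome V rfl
      obtain ⟨hinj, hprof⟩ := isProfile_of_relation (fun j => (L ++ [-w]).get j) l huniq α hrel
        hαl hnn
      have hsupp : Profile.support V = (Finset.univ.filter fun j => α j ≠ 0).image
          (fun j => (L ++ [-w]).get j) := by
        ext v
        simp only [Profile.support, hV, List.mem_toFinset, List.mem_map, List.mem_reverse,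
          List.mem_filter, List.mem_finRange, true_and, Finset.mem_image, Finset.mem_filter,
          Finset.mem_univ, decide_eq_true_eq]
        constructor
        · rintro ⟨_, ⟨j, hj, rfl⟩, rfl⟩
          exact ⟨j, hj, rfl⟩
        · rintro ⟨j, hj, rfl⟩
          exact ⟨_, ⟨j, hj, rfl⟩, rfl⟩
      have hrep : RepresentsProfile V := by
        refine ⟨hsupp ▸ hprof, ?_, ?_, ?_⟩
        · rw [hV, List.map_reverse, List.map_map, List.nodup_reverse]
          exact ((List.nodup_finRange _).filter _).map hinj
        · intro t ht
          rw [hV, List.mem_reverse] at ht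
          obtain ⟨j, hj, rfl⟩ := List.mem_map.mp ht
          have := (List.mem_filter.mp hj).2
          exact lt_of_le_of_ne (hnn j) (Ne.symm (by simpa using this))
        · rw [hV, List.map_reverse, List.sum_reverse, List.map_map]
          rw [← hrel, ← List.sum_toFinset _ ((List.nodup_finRange _).filter _)]
          simp only [Function.comp_apply]
          refine Finset.sum_subset (Finset.subset_univ _) fun j _ hj => ?_
          have : α j = 0 := by simpa using hj
          rw [this, zero_smul]
      refine Runs.seq (normalize_runs hrep) ?_
      rintro V' s₂ ⟨hs₂, hnorm, hsupp'⟩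
      refine Runs.pure ⟨?_, ?_, ?_⟩
      · unfold expandTime
        rw [hlen]
        omega
      · rintro V'' hV''
        obtain rfl : V' = V'' := by simpa using hV''
        exact hnorm
      · intro W hW hwW hWL
        exact ⟨V', rfl, by rw [hsupp', hsupp, (hcompl W hW hwW hWL).2]⟩

/-- The profile with the support `W` is on the list. -/
def Lists (P : List (Profile d)) (W : Finset (SignVec d)) : Prop :=
  ∃ V ∈ P, Profile.support V = W

theorem key_eq_iff {V W : Profile d} : V.key = W.key ↔ V.map Prod.fst = W.map Prod.fst := by
  have h : ∀ U : Profile d, U.key = (U.map Prod.fst).map List.ofFn := fun U => by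
    rw [Profile.key, List.map_map]
    rfl
  rw [h, h]
  exact (List.map_injective_iff.mpr List.ofFn_injective).eq_iff

theorem dedupAdjacent_runs (l : List (Profile d)) (hl : ∀ V ∈ l, V.length ≤ d + 1) :
    Runs (dedupAdjacent l) fun l' s =>
      s ≤ l.length * ((d + 1) * (2 * d + 3) + 1) + 1 ∧ l'.length ≤ l.length ∧
      (∀ V ∈ l', V ∈ l) ∧ ∀ V ∈ l, ∃ V' ∈ l', V'.key = V.key := by
  induction l with
  | nil =>
    rw [dedupAdjacent]
    exact Runs.charge ⟨by simp, by simp, by simp, by simp⟩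
  | cons V l ih =>
    match l, ih with
    | [], _ =>
      rw [dedupAdjacent]
      exact Runs.charge ⟨by simp, by simp, by simp, by simp⟩
    | W :: l, ih =>
      rw [dedupAdjacent]
      refine Runs.charge_bind (Runs.seq (ih fun U hU => hl U (by simp [hU])) ?_)
      rintro l' s ⟨hs, hlen, hsub, hcov⟩
      have hV := hl V (by simp)
      have hW := hl W (by simp)
      have hc : (d + 1) * (V.length + W.length + 1) ≤ (d + 1) * (2 * d + 3) :=
        Nat.mul_le_mul_left _ (by omega)
      have hcost : (W :: l).length * ((d + 1) * (2 * d + 3) + 1) + ((d + 1) * (2 * d + 3) + 1) =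
          (V :: W :: l).length * ((d + 1) * (2 * d + 3) + 1) := by
        simp only [List.length_cons]
        ring
      refine Runs.charge_bind ?_
      by_cases h : V.key = W.key
      · simp only [h, decide_true, if_true]
        refine Runs.pure ⟨by omega, ?_, fun U hU => List.mem_cons_of_mem _ (hsub U hU), ?_⟩
        · simp only [List.length_cons] at *
          omega
        · intro U hU
          rcases List.mem_cons.mp hU with rfl | hU
          · rw [h]
            exact hcov W (by simp)
          · exact hcov U hU
      · simp only [h, decide_false, Bool.false_eq_true, if_false]
        refine Runs.pure ⟨by omega, ?_, ?_, ?_⟩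
        · simp only [List.length_cons] at *
          omega
        · intro U hU
          rcases List.mem_cons.mp hU with rfl | hU
          · simp
          · exact List.mem_cons_of_mem _ (hsub U hU)
        · intro U hU
          rcases List.mem_cons.mp hU with rfl | hU
          · exact ⟨U, by simp, rfl⟩
          · obtain ⟨V', hV', h'⟩ := hcov U hU
            exact ⟨V', List.mem_cons_of_mem _ hV', h'⟩

/-- An upper bound for the length of the list of profiles. -/
def profileBound (d : ℕ) : ℕ := (3 ^ d).choose d * 3 ^ d

/-- An upper bound for the number of steps of `preprocess`. -/
def preprocessTime (d : ℕ) : ℕ :=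
  (d + 1) * 3 ^ d + sublistsTime d (3 ^ d) +
    ((3 ^ d).choose d *
      ((d + 1) * d + depTime d d + (3 ^ d * (expandTime d + 2) + 1) + 1) + 1) +
    sortTime (profileBound d) ((d + 1) * (2 * d + 3)) +
    (profileBound d * ((d + 1) * (2 * d + 3) + 1) + 1)

/-- The profiles obtained from one independent set of vectors. -/
theorem expandAll_runs {L : List (SignVec d)} (hlen : L.length = d)
    (hL : LinearIndependent ℚ fun j : Fin L.length => (L.get j).toRat) (P : List (Profile d))
    (hP : ∀ V ∈ P, NormalizedProfile V) :
    Runs (each (signVecs d) P fun P w => do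
        match ← expand L w with
        | none => pure P
        | some V => charge 1 (V :: P)) fun P' s =>
      s ≤ 3 ^ d * (expandTime d + 2) + 1 ∧ P'.length ≤ P.length + 3 ^ d ∧
      (∀ V ∈ P, V ∈ P') ∧ (∀ V ∈ P', NormalizedProfile V) ∧
      ∀ W, IsProfile W → (∃ v ∈ W, W.erase v ⊆ L.toFinset) → Lists P' W := by
  refine (Runs.each (expandTime d + 1) (fun (done : List (SignVec d)) (P' : List (Profile d)) =>
    P'.length ≤ P.length + done.length ∧ (∀ V ∈ P, V ∈ P') ∧ (∀ V ∈ P', NormalizedProfile V) ∧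
      ∀ w ∈ done, ∀ W, IsProfile W → -w ∈ W → W.erase (-w) ⊆ L.toFinset → Lists P' W)
    ⟨by simp, fun V hV => hV, hP, by simp⟩ ?_).mono ?_
  · rintro done w rest P' - ⟨h1, h2, h3, h4⟩
    refine Runs.seq (expand_runs hlen hL w) ?_
    rintro o s ⟨hs, hnorm, hcompl⟩
    match o, hnorm, hcompl with
    | none, _, hcompl =>
      refine Runs.pure ⟨by omega, by simp; omega, h2, h3, ?_⟩
      intro w' hw' W hW hwW hWL
      rcases List.mem_append.mp hw' with hw' | hw'
      · exact h4 w' hw' W hW hwW hWL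
      · obtain rfl := List.mem_singleton.mp hw'
        obtain ⟨V, hV, -⟩ := hcompl W hW hwW hWL
        cases hV
    | some V, hnorm, hcompl =>
      refine Runs.charge ⟨by omega, by simp; omega,
        fun U hU => List.mem_cons_of_mem _ (h2 U hU), ?_, ?_⟩
      · intro U hU
        rcases List.mem_cons.mp hU with rfl | hU
        · exact hnorm U rfl
        · exact h3 U hU
      · intro w' hw' W hW hwW hWL
        rcases List.mem_append.mp hw' with hw' | hw'
        · obtain ⟨U, hU, h⟩ := h4 w' hw' W hW hwW hWL
          exact ⟨U, List.mem_cons_of_mem _ hU, h⟩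
        · obtain rfl := List.mem_singleton.mp hw'
          obtain ⟨U, hU, h⟩ := hcompl W hW hwW hWL
          obtain rfl : V = U := by simpa using hU
          exact ⟨V, by simp, h⟩
  · rintro P' s ⟨hs, h1, h2, h3, h4⟩
    rw [length_signVecs] at hs h1
    refine ⟨hs, h1, h2, h3, ?_⟩
    rintro W hW ⟨v, hv, hWL⟩
    exact h4 (-v) (mem_signVecs d _) W hW (by rwa [neg_neg]) (by rwa [neg_neg])

theorem preprocess_runs (d : ℕ) :
    Runs (preprocess d) fun P s => s ≤ preprocessTime d ∧ P.length ≤ profileBound d ∧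
      (∀ V ∈ P, NormalizedProfile V) ∧ ∀ W, IsProfile W → Lists P W := by
  refine Runs.charge_bind (Runs.seq (sublistsOfLength_runs d (signVecs d)) ?_)
  rintro subsets s₁ ⟨hs₁, hlen, hmem⟩
  rw [length_signVecs] at hs₁ hlen
  refine Runs.seq (Runs.each
    ((d + 1) * d + depTime d d + (3 ^ d * (expandTime d + 2) + 1))
    (fun (done : List (List (SignVec d))) (P : List (Profile d)) =>
      P.length ≤ done.length * 3 ^ d ∧ (∀ V ∈ P, NormalizedProfile V) ∧
      ∀ L ∈ done, LinearIndependent ℚ (fun j : Fin L.length => (L.get j).toRat) →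
        ∀ W, IsProfile W → (∃ v ∈ W, W.erase v ⊆ L.toFinset) → Lists P W)
    ⟨by simp, by simp, by simp⟩ ?_) ?_
  · rintro done L rest P hsub ⟨h1, h2, h3⟩
    have hLlen : L.length = d := ((hmem L).mp (by simp [hsub])).2
    refine Runs.charge_bind (Runs.seq (dependency_runs _) ?_)
    rintro o s ⟨hs, hnone, hsome⟩
    rw [hLlen] at hs
    match o, hnone, hsome with
    | none, hnone, _ =>
      refine (expandAll_runs hLlen (hnone rfl) P h2).mono ?_
      rintro P' s' ⟨hs', hl', hsub', hnorm', hcompl'⟩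
      refine ⟨by rw [hLlen]; omega, ?_, hnorm', ?_⟩
      · simp only [List.length_append, List.length_singleton, add_mul, one_mul]
        omega
      · intro L' hL' hind W hW hWL
        rcases List.mem_append.mp hL' with hL' | hL'
        · obtain ⟨V, hV, h⟩ := h3 L' hL' hind W hW hWL
          exact ⟨V, hsub' V hV, h⟩
        · obtain rfl := List.mem_singleton.mp hL'
          exact hcompl' W hW hWL
    | some c, _, hsome =>
      refine Runs.pure ⟨by rw [hLlen]; omega, ?_, h2, ?_⟩
      · simp only [List.length_append, List.length_singleton, add_mul, one_mul]
        exact h1.trans (Nat.le_add_right _ _)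
      · intro L' hL' hind W hW hWL
        rcases List.mem_append.mp hL' with hL' | hL'
        · exact h3 L' hL' hind W hW hWL
        · obtain rfl := List.mem_singleton.mp hL'
          obtain ⟨hrel, j, hj, -⟩ := hsome c rfl
          have := Fintype.linearIndependent_iff.mp hind c hrel j
          rw [hj] at this
          exact absurd this one_ne_zero
  rintro P s₂ ⟨hs₂, h1, h2, h3⟩
  rw [hlen] at hs₂ h1
  have hcompl : ∀ W, IsProfile W → Lists P W := by
    intro W hW
    obtain ⟨v, hv⟩ := hW.nonempty
    obtain ⟨L, hWL, hcard, hind⟩ := exists_signVec_extension (hW.erase_indep hv)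
    -- the members of `L` in the order of `signVecs d`
    set l := (signVecs d).filter fun v => v ∈ L with hl
    have hnd : l.Nodup := (nodup_signVecs d).filter _
    have hlL : l.toFinset = L := by
      ext v
      simp [hl, mem_signVecs]
    have hll : l.length = d := by
      rw [← List.toFinset_card_of_nodup hnd, hlL, hcard]
    refine h3 l ((hmem l).mpr ⟨List.filter_sublist, hll⟩) ?_ W hW ⟨v, hv, hlL ▸ hWL⟩
    refine (linearIndepOn_range_iff (List.nodup_iff_injective_get.mp hnd) SignVec.toRat).mp ?_
    refine hind.mono ?_
    rintro _ ⟨j, rfl⟩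
    rw [← hlL]
    exact List.mem_toFinset.mpr (List.get_mem _ _)
  refine Runs.seq (mergeSort_runs profileLE (fun V W => decide (V.key ≤ W.key) = true)
    ((d + 1) * (2 * d + 3)) P fun V hV W hW => Runs.charge ⟨?_, Iff.rfl⟩) ?_
  · have hV' := (h2 V hV).length_le
    have hW' := (h2 W hW).length_le
    exact Nat.mul_le_mul_left _ (by omega)
  rintro P₁ s₃ ⟨hs₃, hperm, -⟩
  have hnorm₁ : ∀ V ∈ P₁, NormalizedProfile V := fun V hV => h2 V (hperm.mem_iff.mp hV)
  refine (dedupAdjacent_runs P₁ fun V hV => (hnorm₁ V hV).length_le).mono ?_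
  rintro P₂ s₄ ⟨hs₄, hlen₂, hsub₂, hcov₂⟩
  have hlen₁ : P₁.length ≤ profileBound d := hperm.length_eq.trans_le h1
  refine ⟨?_, hlen₂.trans hlen₁, fun V hV => hnorm₁ V (hsub₂ V hV), ?_⟩
  · have e1 := sortTime_mono h1 ((d + 1) * (2 * d + 3))
    have e2 := Nat.mul_le_mul_right ((d + 1) * (2 * d + 3) + 1) hlen₁
    change _ ≤ profileBound d at h1
    have e3 : sortTime ((3 ^ d).choose d * 3 ^ d) ((d + 1) * (2 * d + 3)) =
      sortTime (profileBound d) ((d + 1) * (2 * d + 3)) := rfl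
    unfold preprocessTime
    omega
  · intro W hW
    obtain ⟨V, hV, hVW⟩ := hcompl W hW
    obtain ⟨V', hV', hkey⟩ := hcov₂ V (hperm.mem_iff.mpr hV)
    refine ⟨V', hV', ?_⟩
    rw [← hVW, Profile.support, Profile.support, key_eq_iff.mp hkey]

end Preprocess

/-! ### Search trees -/

section Trees

variable {d n : ℕ}

/-- The tree of depth `k` whose leaf number `i` is given by `f i`. -/
def mkTree : ℕ → (ℕ → Option (Move d n × ℚ)) → Tree d n
  | 0, f => match f 0 with
    | none => .empty
    | some (m, y) => .leaf m y
  | k + 1, f => .node (max (mkTree k f).top (mkTree k fun i => f (2 ^ k + i)).top)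
      (mkTree k f) (mkTree k fun i => f (2 ^ k + i))

theorem mkTree_congr {k : ℕ} {f g : ℕ → Option (Move d n × ℚ)} (h : ∀ i < 2 ^ k, f i = g i) :
    mkTree k f = mkTree k g := by
  induction k generalizing f g with
  | zero => simp only [mkTree, h 0 (by simp)]
  | succ k ih =>
    have h1 : mkTree k f = mkTree k g := ih fun i hi => h i (by rw [pow_succ]; omega)
    have h2 : (mkTree k fun i => f (2 ^ k + i)) = mkTree k fun i => g (2 ^ k + i) :=
      ih fun i hi => h _ (by rw [pow_succ]; omega)
    rw [mkTree, mkTree, h1, h2]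

theorem le_top_mkTree_iff {x₀ : ℚ} (hx : 0 < x₀) (k : ℕ) (f : ℕ → Option (Move d n × ℚ)) :
    x₀ ≤ (mkTree k f).top ↔ ∃ i < 2 ^ k, ∃ m y, f i = some (m, y) ∧ x₀ ≤ y := by
  induction k generalizing f with
  | zero =>
    rw [mkTree]
    cases hf : f 0 with
    | none => simp [Tree.top, hf, hx]
    | some my =>
      obtain ⟨m, y⟩ := my
      simp [Tree.top, hf]
  | succ k ih =>
    rw [mkTree, Tree.top, le_max_iff, ih, ih]
    constructor
    · rintro (⟨i, hi, h⟩ | ⟨i, hi, h⟩)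
      · exact ⟨i, by rw [pow_succ]; omega, h⟩
      · exact ⟨2 ^ k + i, by rw [pow_succ]; omega, h⟩
    · rintro ⟨i, hi, h⟩
      by_cases hik : i < 2 ^ k
      · exact Or.inl ⟨i, hik, h⟩
      · refine Or.inr ⟨i - 2 ^ k, by rw [pow_succ] at hi; omega, ?_⟩
        rwa [show 2 ^ k + (i - 2 ^ k) = i by omega]

theorem Tree.update_runs (k i : ℕ) (hi : i < 2 ^ k) (y : ℚ) (f : ℕ → Option (Move d n × ℚ))
    (m : Move d n) (y₀ : ℚ) (hf : f i = some (m, y₀)) :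
    Runs (Tree.update k i y (mkTree k f)) fun t s => s ≤ 6 * k + 1 ∧
      t = mkTree k (Function.update f i (some (m, y))) := by
  induction k generalizing i f with
  | zero =>
    obtain rfl : i = 0 := by simpa using hi
    rw [mkTree, hf]
    exact Runs.charge ⟨by simp, by simp [mkTree]⟩
  | succ k ih =>
    rw [mkTree, Tree.update]
    refine Runs.charge_bind ?_
    by_cases hik : i < 2 ^ k
    · rw [if_pos hik]
      refine Runs.seq (ih i hik f hf) ?_
      rintro t s ⟨hs, rfl⟩
      refine Runs.charge ⟨by omega, ?_⟩
      have : (mkTree k fun j => Function.update f i (some (m, y)) (2 ^ k + j)) =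
          mkTree k fun j => f (2 ^ k + j) :=
        mkTree_congr fun j _ => Function.update_of_ne (by omega) _ _
      rw [mkTree, this]
    · rw [if_neg hik]
      refine Runs.seq (ih (i - 2 ^ k) (by rw [pow_succ] at hi; omega) (fun j => f (2 ^ k + j))
        (by rwa [show 2 ^ k + (i - 2 ^ k) = i by omega])) ?_
      rintro t s ⟨hs, rfl⟩
      refine Runs.charge ⟨by omega, ?_⟩
      have h1 : mkTree k (Function.update f i (some (m, y))) = mkTree k f :=
        mkTree_congr fun j _ => Function.update_of_ne (by omega) _ _
      have h2 : (mkTree k fun j => Function.update f i (some (m, y)) (2 ^ k + j)) =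
          mkTree k (Function.update (fun j => f (2 ^ k + j)) (i - 2 ^ k) (some (m, y))) := by
        refine mkTree_congr fun j _ => ?_
        by_cases hj : j = i - 2 ^ k
        · subst hj
          rw [Function.update_self, show 2 ^ k + (i - 2 ^ k) = i by omega, Function.update_self]
        · rw [Function.update_of_ne hj, Function.update_of_ne (by omega)]
      rw [mkTree, h1, h2]

theorem Tree.query_runs {x₀ : ℚ} (hx : 0 < x₀) (k : ℕ) (f : ℕ → Option (Move d n × ℚ)) :
    Runs (Tree.query x₀ (mkTree k f)) fun o s => s ≤ 2 * k + 1 ∧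
      (o = none → ∀ i < 2 ^ k, ∀ m y, f i = some (m, y) → y < x₀) ∧
      ∀ m, o = some m → ∃ i < 2 ^ k, ∃ y, f i = some (m, y) ∧ x₀ ≤ y ∧
        ∀ j < i, ∀ m' y', f j = some (m', y') → y' < x₀ := by
  induction k generalizing f with
  | zero =>
    rw [mkTree]
    cases hf : f 0 with
    | none => exact Runs.charge ⟨by simp, by simp [hf], by simp⟩
    | some my =>
      obtain ⟨m, y⟩ := my
      refine Runs.charge_bind ?_
      by_cases h : x₀ ≤ y
      · simp only [h, decide_true, if_true]
        refine Runs.pure ⟨by simp, by simp, ?_⟩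
        rintro m' hm
        obtain rfl : m = m' := by simpa using hm
        exact ⟨0, by simp, y, hf, h, by simp⟩
      · simp only [h, decide_false, Bool.false_eq_true, if_false]
        refine Runs.pure ⟨by simp, ?_, by simp⟩
        intro _ i hi m' y' hf'
        obtain rfl : i = 0 := by simpa using hi
        rw [hf] at hf'
        obtain ⟨rfl, rfl⟩ : m = m' ∧ y = y' := by simpa using hf'
        exact not_le.mp h
  | succ k ih =>
    rw [mkTree]
    refine Runs.charge_bind (Runs.charge_bind ?_)
    by_cases h : x₀ ≤ (mkTree k f).top
    · simp only [h, decide_true, if_true]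
      refine (ih f).mono ?_
      rintro o s ⟨hs, hnone, hsome⟩
      refine ⟨by omega, ?_, ?_⟩
      · intro ho
        obtain ⟨i, hi, m, y, hf, hy⟩ := (le_top_mkTree_iff hx k f).mp h
        exact absurd hy (not_le.mpr (hnone ho i hi m y hf))
      · intro m hm
        obtain ⟨i, hi, h'⟩ := hsome m hm
        exact ⟨i, by rw [pow_succ]; omega, h'⟩
    · simp only [h, decide_false, Bool.false_eq_true, if_false]
      have hleft : ∀ i < 2 ^ k, ∀ m y, f i = some (m, y) → y < x₀ := by
        intro i hi m y hf
        by_contra hy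
        exact h ((le_top_mkTree_iff hx k f).mpr ⟨i, hi, m, y, hf, not_lt.mp hy⟩)
      refine (ih fun i => f (2 ^ k + i)).mono ?_
      rintro o s ⟨hs, hnone, hsome⟩
      refine ⟨by omega, ?_, ?_⟩
      · intro ho i hi m y hf
        by_cases hik : i < 2 ^ k
        · exact hleft i hik m y hf
        · refine hnone ho (i - 2 ^ k) (by rw [pow_succ] at hi; omega) m y ?_
          rwa [show 2 ^ k + (i - 2 ^ k) = i by omega]
      · intro m hm
        obtain ⟨i, hi, y, hf, hy, hmin⟩ := hsome m hm
        refine ⟨2 ^ k + i, by rw [pow_succ]; omega, y, hf, hy, fun j hj m' y' hf' => ?_⟩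
        by_cases hjk : j < 2 ^ k
        · exact hleft j hjk m' y' hf'
        · refine hmin (j - 2 ^ k) (by omega) m' y' ?_
          rwa [show 2 ^ k + (j - 2 ^ k) = j by omega]

/-- The leaves of the search tree for a list of moves under the assignment `x`. -/
def leaves (l : List (Move d n)) (x : Item d n × Finset (Fin d) → ℚ) (i : ℕ) :
    Option (Move d n × ℚ) :=
  (l[i]?).map fun m => (m, x (m.item, m.src))

theorem Tree.build_runs (x : Item d n × Finset (Fin d) → ℚ) (k : ℕ) (l : List (Move d n)) :
    Runs (Tree.build x k l) fun r s => s ≤ 2 ^ k * (d + 5) - 3 ∧ r.1 = mkTree k (leaves l x) ∧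
      r.2 = l.drop (2 ^ k) := by
  induction k generalizing l with
  | zero =>
    match l with
    | [] => exact Runs.charge ⟨by simp, by simp [mkTree, leaves], by simp⟩
    | m :: l =>
      exact Runs.charge_bind (Runs.charge ⟨by omega, by simp [mkTree, leaves], by simp⟩)
  | succ k ih =>
    rw [Tree.build]
    refine Runs.seq (ih l) ?_
    rintro ⟨t₁, l₁⟩ s₁ ⟨hs₁, h₁, h₁'⟩
    simp only at h₁ h₁'
    subst h₁ h₁'
    refine Runs.seq (ih _) ?_
    rintro ⟨t₂, l₂⟩ s₂ ⟨hs₂, h₂, h₂'⟩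
    simp only at h₂ h₂'
    subst h₂ h₂'
    refine Runs.charge_bind (Runs.pure ⟨?_, ?_, ?_⟩)
    · have : 1 * 5 ≤ 2 ^ k * (d + 5) := Nat.mul_le_mul Nat.one_le_two_pow (by omega)
      rw [pow_succ, mul_comm (2 ^ k) 2, mul_assoc]
      omega
    · have : leaves (l.drop (2 ^ k)) x = fun i => leaves l x (2 ^ k + i) := by
        funext i
        simp [leaves, List.getElem?_drop]
      rw [mkTree, this]
    · simp only [List.drop_drop]
      congr 1
      ring

/-! ### The moves and their search trees -/

/-- The moves between placements of finite cost. -/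
def IsMove (I : Input d n) (m : Move d n) : Prop :=
  ∃ a b, I.extCost (m.item, m.src) = some a ∧ I.extCost (m.item, m.dst) = some b ∧
    m.cost = b - a

theorem IsMove.ext {I : Input d n} {m m' : Move d n} (h : IsMove I m) (h' : IsMove I m')
    (h1 : m.item = m'.item) (h2 : m.src = m'.src) (h3 : m.dst = m'.dst) : m = m' := by
  obtain ⟨p, S, T, c⟩ := m
  obtain ⟨p', S', T', c'⟩ := m'
  simp only at h1 h2 h3
  subst h1 h2 h3
  obtain ⟨a, b, ha, hb, hc⟩ := h
  obtain ⟨a', b', ha', hb', hc'⟩ := h'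
  simp only at ha hb hc ha' hb' hc'
  rw [ha] at ha'
  rw [hb] at hb'
  obtain rfl := Option.some.inj ha'
  obtain rfl := Option.some.inj hb'
  rw [hc, hc']

theorem netChange_injective (S : Finset (Fin d)) : Function.Injective (netChange S) := by
  intro T T' h
  ext b
  have hb := congrFun h b
  simp only [netChange] at hb
  by_cases h1 : b ∈ T <;> by_cases h2 : b ∈ T' <;> by_cases h3 : b ∈ S <;>
    simp [h1, h2, h3] at hb ⊢

theorem moveCost_runs (I : Input d n) (p : Item d n) (S T : Finset (Fin d)) :
    Runs (moveCost I p S T) fun o s => s ≤ 2 * d + 3 ∧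
      ∀ c, o = some c ↔ IsMove I ⟨p, S, T, c⟩ := by
  refine Runs.charge_bind ?_
  cases ha : I.extCost (p, S) with
  | none => exact Runs.pure ⟨by omega, by simp [IsMove, ha]⟩
  | some a =>
    refine Runs.charge_bind ?_
    cases hb : I.extCost (p, T) with
    | none => exact Runs.pure ⟨by omega, by simp [IsMove, hb]⟩
    | some b =>
      refine Runs.charge_bind (Runs.pure ⟨by omega, fun c => ?_⟩)
      simp [IsMove, ha, hb, eq_comm]

theorem mem_binSets (S : Finset (Fin d)) : S ∈ binSets d := by
  rw [binSets, List.mem_map]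
  refine ⟨(List.finRange d).filter fun b => b ∈ S, List.mem_sublists.mpr List.filter_sublist, ?_⟩
  ext b
  simp

theorem length_binSets (d : ℕ) : (binSets d).length = 2 ^ d := by
  simp [binSets]

theorem nodup_binSets (d : ℕ) : (binSets d).Nodup := by
  have h : (binSets d).toFinset = Finset.univ := by
    ext S
    simp [mem_binSets]
  have h2 : (binSets d).toFinset.card = (binSets d).length := by
    rw [h, length_binSets, Finset.card_univ, Fintype.card_finset, Fintype.card_fin]
  exact Multiset.coe_nodup.mp (Multiset.toFinset_card_eq_card_iff_nodup.mp h2)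

theorem mem_items (I : Input d n) (p : Item d n) : p ∈ I.items := by
  cases p <;> simp [Input.items]

theorem length_items (I : Input d n) : I.items.length = d + n := by
  simp [Input.items]

theorem nodup_items (I : Input d n) : I.items.Nodup := by
  rw [Input.items, List.nodup_append]
  refine ⟨(List.nodup_finRange d).map Sum.inl_injective,
    (List.nodup_finRange n).map Sum.inr_injective, ?_⟩
  rintro a ha b hb rfl
  obtain ⟨i, -, rfl⟩ := List.mem_map.mp ha
  obtain ⟨j, -, h⟩ := List.mem_map.mp hb
  cases h

/-- The moves are listed, for every sign vector `v`, in the order of their costs in `L v`, and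
`pos` gives the positions. -/
structure MoveIndex (I : Input d n) (L : SignVec d → List (Move d n))
    (pos : Item d n × Finset (Fin d) × Finset (Fin d) → ℕ) : Prop where
  mem : ∀ v m, m ∈ L v ↔ IsMove I m ∧ netChange m.src m.dst = v
  nodup : ∀ v, (L v).Nodup
  sorted : ∀ v, (L v).Pairwise fun m m' => m.cost ≤ m'.cost
  pos : ∀ v, ∀ m ∈ L v, (L v)[pos (m.item, m.src, m.dst)]? = some m

/-- The search tree for a list of moves under the assignment `x`, with its depth. -/
def treeEntry (l : List (Move d n)) (x : Item d n × Finset (Fin d) → ℚ) : ℕ × Tree d n :=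
  (Nat.clog 2 l.length, mkTree (Nat.clog 2 l.length) (leaves l x))

/-- The search trees agree with the current assignment. -/
structure Synced (L : SignVec d → List (Move d n))
    (pos : Item d n × Finset (Fin d) × Finset (Fin d) → ℕ) (st : Memory d n) : Prop where
  pos : st.pos = pos
  moves : ∀ v, st.moves v = treeEntry (L v) st.x

/-- An upper bound for the depth of the search trees. -/
def treeDepth (d n : ℕ) : ℕ := Nat.clog 2 ((d + n) * 2 ^ d)

theorem length_bucket_le {I : Input d n} {l : List (Move d n)} {v : SignVec d} (hnd : l.Nodup)
    (hmem : ∀ m ∈ l, IsMove I m ∧ netChange m.src m.dst = v) :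
    l.length ≤ (d + n) * 2 ^ d := by
  have hinj : (l.map fun m => (m.item, m.src)).Nodup := by
    refine (List.nodup_map_iff_inj_on hnd).mpr fun m hm m' hm' h => ?_
    obtain ⟨h1, h2⟩ := Prod.mk.inj h
    refine (hmem m hm).1.ext (hmem m' hm').1 h1 h2 ?_
    refine netChange_injective m.src ?_
    rw [(hmem m hm).2, h2, (hmem m' hm').2]
  have := hinj.length_le_card
  simpa using this

theorem MoveIndex.depth_le {I : Input d n} {L : SignVec d → List (Move d n)}
    {pos : Item d n × Finset (Fin d) × Finset (Fin d) → ℕ} (h : MoveIndex I L pos)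
    (v : SignVec d) : Nat.clog 2 (L v).length ≤ treeDepth d n :=
  Nat.clog_mono_right 2 (length_bucket_le (h.nodup v) fun m hm => (h.mem v m).mp hm)

/-- An upper bound for the number of steps of `setMass`. -/
def setMassTime (d n : ℕ) : ℕ := (d + 1) + (2 ^ d * (6 * d + 6 * treeDepth d n + 8) + 1)

/-- Rewriting one leaf of a tree brings the tree up to date with a change of the mass of the
source of its move, because the tree has only one move from a given source. -/
theorem leaves_update {I : Input d n} {L : SignVec d → List (Move d n)}
    {pos : Item d n × Finset (Fin d) × Finset (Fin d) → ℕ} (hL : MoveIndex I L pos)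
    (x x' : Item d n × Finset (Fin d) → ℚ) (m : Move d n) (hm : IsMove I m) (y : ℚ)
    (hx' : x' = x ∨ x' = Function.update x (m.item, m.src) y) :
    Function.update (leaves (L (netChange m.src m.dst)) x') (pos (m.item, m.src, m.dst))
      (some (m, y)) =
      leaves (L (netChange m.src m.dst)) (Function.update x (m.item, m.src) y) := by
  have hmem : m ∈ L (netChange m.src m.dst) := (hL.mem _ _).mpr ⟨hm, rfl⟩
  have hpos := hL.pos _ m hmem
  funext j
  by_cases hj : j = pos (m.item, m.src, m.dst)
  · subst hj
    rw [Function.update_self, leaves, hpos]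
    simp
  · rw [Function.update_of_ne hj, leaves, leaves]
    cases hm' : (L (netChange m.src m.dst))[j]? with
    | none => rfl
    | some m' =>
      have hmem' : m' ∈ L (netChange m.src m.dst) := List.mem_of_getElem? hm'
      obtain ⟨h1, h2⟩ := (hL.mem _ _).mp hmem'
      have hne : (m'.item, m'.src) ≠ (m.item, m.src) := by
        intro h
        obtain ⟨h3, h4⟩ := Prod.mk.inj h
        have : m' = m := h1.ext hm h3 h4 (netChange_injective m.src (by rw [← h2, h4]))
        subst this
        have hlt := (List.getElem?_eq_some_iff.mp hm').1
        exact hj ((List.getElem?_inj hlt (hL.nodup _)).mp (hm'.trans hpos.symm))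
      rcases hx' with rfl | rfl
      · simp [Function.update_of_ne hne]
      · rfl

theorem setMass_runs {I : Input d n} {L : SignVec d → List (Move d n)}
    {pos : Item d n × Finset (Fin d) × Finset (Fin d) → ℕ} (hL : MoveIndex I L pos)
    {st : Memory d n} (hst : Synced L pos st) (p : Item d n) (S : Finset (Fin d)) (y : ℚ) :
    Runs (setMass I st p S y) fun st' s => s ≤ setMassTime d n ∧ Synced L pos st' ∧
      st'.x = Function.update st.x (p, S) y ∧ st'.home = st.home ∧ st'.frac = st.frac := by
  classical
  refine Runs.charge_bind (Runs.seq (Runs.each (6 * d + 6 * treeDepth d n + 7)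
    (fun (done : List (Finset (Fin d))) (moves : SignVec d → ℕ × Tree d n) =>
      ∀ v, moves v = treeEntry (L v)
        (if ∃ T ∈ done, (∃ c, IsMove I ⟨p, S, T, c⟩) ∧ netChange S T = v then
          Function.update st.x (p, S) y else st.x))
    (fun v => by simp [hst.moves]) ?_) ?_)
  · rintro done T rest moves - hinv
    refine Runs.seq (moveCost_runs I p S T) ?_
    rintro o s ⟨hs, ho⟩
    match o, ho with
    | none, ho =>
      refine Runs.pure ⟨by omega, fun v => ?_⟩
      rw [hinv v]
      congr 1
      refine if_congr ?_ rfl rfl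
      have hno : ¬ ∃ c, IsMove I ⟨p, S, T, c⟩ := by
        rintro ⟨c, hc⟩
        have := (ho c).mpr hc
        cases this
      constructor
      · rintro ⟨T', hT', h⟩
        exact ⟨T', by simp [hT'], h⟩
      · rintro ⟨T', hT', h⟩
        rcases List.mem_append.mp hT' with hT' | hT'
        · exact ⟨T', hT', h⟩
        · obtain rfl := List.mem_singleton.mp hT'
          exact absurd h.1 hno
    | some c, ho =>
      have hm : IsMove I ⟨p, S, T, c⟩ := (ho c).mp rfl
      have hmem : (⟨p, S, T, c⟩ : Move d n) ∈ L (netChange S T) := (hL.mem _ _).mpr ⟨hm, rfl⟩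
      have hpos := hL.pos _ _ hmem
      refine Runs.charge_bind (Runs.charge_bind ?_)
      rw [hinv (netChange S T)]
      simp only [treeEntry]
      refine Runs.charge_bind ?_
      rw [hst.pos]
      generalize hX : (if ∃ T_1 ∈ done, (∃ c, IsMove I ⟨p, S, T_1, c⟩) ∧
        netChange S T_1 = netChange S T then Function.update st.x (p, S) y else st.x) = X
      have hlt := (List.getElem?_eq_some_iff.mp hpos).1
      have hf : leaves (L (netChange S T)) X (pos (p, S, T)) =
          some (⟨p, S, T, c⟩, X (p, S)) := by
        simp only at hpos
        rw [leaves, hpos]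
        rfl
      have hdepth := hL.depth_le (netChange S T)
      refine Runs.seq (Tree.update_runs _ _ (hlt.trans_le (Nat.le_pow_clog (by norm_num) _)) y _
        _ _ hf) ?_
      rintro t s' ⟨hs', rfl⟩
      refine Runs.charge ⟨by omega, fun v => ?_⟩
      by_cases hv : v = netChange S T
      · subst hv
        rw [Function.update_self, if_pos ⟨T, by simp, ⟨c, hm⟩, rfl⟩]
        have hX' : X = st.x ∨ X = Function.update st.x (p, S) y := by
          rw [← hX]
          split_ifs
          · exact Or.inr rfl
          · exact Or.inl rfl
        have := leaves_update hL st.x X ⟨p, S, T, c⟩ hm y hX'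
        simp only at this
        rw [this]
      · rw [Function.update_of_ne hv, hinv v]
        congr 1
        refine if_congr ?_ rfl rfl
        constructor
        · rintro ⟨T', hT', h⟩
          exact ⟨T', by simp [hT'], h⟩
        · rintro ⟨T', hT', h⟩
          rcases List.mem_append.mp hT' with hT' | hT'
          · exact ⟨T', hT', h⟩
          · obtain rfl := List.mem_singleton.mp hT'
            exact absurd h.2.symm hv
  · rintro moves s ⟨hs, hinv⟩
    rw [length_binSets] at hs
    refine Runs.pure ⟨?_, ⟨hst.pos, fun v => ?_⟩, rfl, rfl, rfl⟩
    · have : 6 * d + 6 * treeDepth d n + 7 + 1 = 6 * d + 6 * treeDepth d n + 8 := rfl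
      rw [this] at hs
      unfold setMassTime
      omega
    · simp only
      rw [hinv v]
      split_ifs with h
      · rfl
      · -- no move of the tree starts at the changed placement
        have hleaves : leaves (L v) st.x = leaves (L v) (Function.update st.x (p, S) y) := by
          funext j
          rw [leaves, leaves]
          cases hm' : (L v)[j]? with
          | none => rfl
          | some m' =>
            obtain ⟨h1, h2⟩ := (hL.mem _ _).mp (List.mem_of_getElem? hm')
            have hne : (m'.item, m'.src) ≠ (p, S) := by
              intro he
              obtain ⟨h3, h4⟩ := Prod.mk.inj he
              subst h3 h4
              exact h ⟨m'.dst, mem_binSets _, ⟨m'.cost, h1⟩, h2⟩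
            simp [Function.update_of_ne hne]
        rw [treeEntry, treeEntry, hleaves]

/-! ### The initial search trees -/

/-- The buckets hold exactly the moves with the property `Q`. -/
def Collected (I : Input d n) (Q : Item d n → Finset (Fin d) → Finset (Fin d) → Prop)
    (buckets : SignVec d → List (Move d n)) : Prop :=
  ∀ v, (buckets v).Nodup ∧ ∀ m, m ∈ buckets v ↔
    IsMove I m ∧ netChange m.src m.dst = v ∧ Q m.item m.src m.dst

theorem Collected.congr {I : Input d n} {Q Q' : Item d n → Finset (Fin d) → Finset (Fin d) → Prop}
    {buckets : SignVec d → List (Move d n)} (h : Collected I Q buckets)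
    (hQ : ∀ p S T, Q p S T ↔ Q' p S T) : Collected I Q' buckets := by
  intro v
  refine ⟨(h v).1, fun m => ?_⟩
  rw [(h v).2, hQ]

/-- The loops of `setup` that distribute the moves to the buckets. -/
theorem buckets_runs (I : Input d n) :
    Runs (each I.items (fun _ : SignVec d => ([] : List (Move d n))) fun buckets p =>
      each (binSets d) buckets fun buckets S =>
        each (binSets d) buckets fun buckets T => do
          match ← moveCost I p S T with
          | none => pure buckets
          | some c =>
            let v ← diff S T
            let l ← fetch d buckets v
            store d buckets v (⟨p, S, T, c⟩ :: l)) fun buckets s =>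
      s ≤ (d + n) * (2 ^ d * (2 ^ d * (5 * d + 6) + 2) + 2) + 1 ∧
        Collected I (fun _ _ _ => True) buckets := by
  refine (Runs.each (2 ^ d * (2 ^ d * (5 * d + 6) + 2) + 1)
    (fun (done : List (Item d n)) => Collected I fun p _ _ => p ∈ done) ?_ ?_).mono ?_
  · intro v
    simp
  · rintro done p rest buckets hitems hinv
    have hp : p ∉ done := by
      have := nodup_items I
      rw [hitems, List.nodup_append] at this
      exact fun h => this.2.2 p h p (by simp) rfl
    refine (Runs.each (2 ^ d * (5 * d + 6) + 1) (fun (doneS : List (Finset (Fin d))) =>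
      Collected I fun p' S _ => p' ∈ done ∨ p' = p ∧ S ∈ doneS) (hinv.congr (by simp))
      ?_).mono ?_
    · rintro doneS S restS buckets hS hinv
      have hSn : S ∉ doneS := by
        have := nodup_binSets d
        rw [hS, List.nodup_append] at this
        exact fun h => this.2.2 S h S (by simp) rfl
      refine (Runs.each (5 * d + 5) (fun (doneT : List (Finset (Fin d))) =>
        Collected I fun p' S' T => p' ∈ done ∨ p' = p ∧ (S' ∈ doneS ∨ S' = S ∧ T ∈ doneT))
        (hinv.congr (by simp)) ?_).mono ?_
      · rintro doneT T restT buckets hT hinv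
        have hTn : T ∉ doneT := by
          have := nodup_binSets d
          rw [hT, List.nodup_append] at this
          exact fun h => this.2.2 T h T (by simp) rfl
        refine Runs.seq (moveCost_runs I p S T) ?_
        rintro o s ⟨hs, ho⟩
        match o, ho with
        | none, ho =>
          refine Runs.pure ⟨by omega, fun v => ⟨(hinv v).1, fun m => ?_⟩⟩
          rw [(hinv v).2]
          refine and_congr_right fun hm => and_congr_right fun _ => ?_
          have hne : ¬ (m.item = p ∧ m.src = S ∧ m.dst = T) := by
            rintro ⟨rfl, rfl, rfl⟩
            have := (ho m.cost).mpr hm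
            cases this
          simp only [List.mem_append, List.mem_singleton]
          tauto
        | some c, ho =>
          have hm : IsMove I ⟨p, S, T, c⟩ := (ho c).mp rfl
          refine Runs.charge_bind (Runs.charge_bind (Runs.charge ⟨by omega, fun v => ?_⟩))
          by_cases hv : v = netChange S T
          · subst hv
            rw [Function.update_self]
            obtain ⟨h1, h2⟩ := hinv (netChange S T)
            refine ⟨List.nodup_cons.mpr ⟨fun h => ?_, h1⟩, fun m => ?_⟩
            · have := ((h2 _).mp h).2.2
              simp only at this
              tauto
            · rw [List.mem_cons, h2]
              constructor
              · rintro (rfl | ⟨h3, h4, h5⟩)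
                · exact ⟨hm, rfl, by simp⟩
                · refine ⟨h3, h4, ?_⟩
                  simp only [List.mem_append, List.mem_singleton]
                  tauto
              · rintro ⟨h3, h4, h5⟩
                simp only [List.mem_append, List.mem_singleton] at h5
                by_cases he : m.item = p ∧ m.src = S ∧ m.dst = T
                · exact Or.inl (h3.ext hm he.1 he.2.1 he.2.2)
                · exact Or.inr ⟨h3, h4, by tauto⟩
          · rw [Function.update_of_ne hv]
            refine ⟨(hinv v).1, fun m => ?_⟩
            rw [(hinv v).2]
            refine and_congr_right fun _ => and_congr_right fun hmv => ?_
            have hne : ¬ (m.item = p ∧ m.src = S ∧ m.dst = T) := by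
              rintro ⟨-, h2, h3⟩
              exact hv (by rw [← hmv, h2, h3])
            simp only [List.mem_append, List.mem_singleton]
            tauto
      · rintro buckets s ⟨hs, hinv⟩
        rw [length_binSets] at hs
        refine ⟨hs, hinv.congr fun p' S' T' => ?_⟩
        simp only [mem_binSets, and_true, List.mem_append, List.mem_singleton]
    · rintro buckets s ⟨hs, hinv⟩
      rw [length_binSets] at hs
      refine ⟨hs, hinv.congr fun p' S' T' => ?_⟩
      simp only [mem_binSets, and_true, List.mem_append, List.mem_singleton]
  · rintro buckets s ⟨hs, hinv⟩
    rw [length_items] at hs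
    exact ⟨hs, hinv.congr fun p _ _ => by simp [mem_items]⟩

/-- The loop of `setup` that records the positions of the moves of a list. -/
theorem positions_runs {I : Input d n} (l : List (Move d n)) (hl : ∀ m ∈ l, IsMove I m)
    (hnd : l.Nodup) (pos : Item d n × Finset (Fin d) × Finset (Fin d) → ℕ) :
    Runs (each l.zipIdx pos fun pos (m, i) => store d pos (m.item, m.src, m.dst) i) fun pos' s =>
      s ≤ l.length * (d + 2) + 1 ∧ (∀ m ∈ l, l[pos' (m.item, m.src, m.dst)]? = some m) ∧
      ∀ q, (∀ m ∈ l, (m.item, m.src, m.dst) ≠ q) → pos' q = pos q := by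
  refine (Runs.each (d + 1) (fun (done : List (Move d n × ℕ))
    (pos' : Item d n × Finset (Fin d) × Finset (Fin d) → ℕ) =>
    (∀ mi ∈ done, pos' (mi.1.item, mi.1.src, mi.1.dst) = mi.2) ∧
      ∀ q, (∀ m ∈ l, (m.item, m.src, m.dst) ≠ q) → pos' q = pos q) (by simp) ?_).mono ?_
  · rintro done ⟨m, i⟩ rest pos' hzip ⟨h1, h2⟩
    have hmem : ∀ mi ∈ done ++ [(m, i)], l[mi.2]? = some mi.1 := by
      intro mi hmi
      have : mi ∈ l.zipIdx := by
        rw [hzip]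
        simp only [List.mem_append, List.mem_cons] at *
        tauto
      exact List.mem_zipIdx_iff_getElem?.mp this
    have hmi := hmem (m, i) (by simp)
    refine Runs.charge ⟨le_rfl, fun mi hmi' => ?_, fun q hq => ?_⟩
    · by_cases he : (mi.1.item, mi.1.src, mi.1.dst) = (m.item, m.src, m.dst)
      · rw [he, Function.update_self]
        have hmi2 := hmem mi hmi'
        obtain ⟨e1, e2⟩ := Prod.mk.inj he
        obtain ⟨e2, e3⟩ := Prod.mk.inj e2
        have : mi.1 = m := (hl _ (List.mem_of_getElem? hmi2)).ext
          (hl _ (List.mem_of_getElem? hmi)) e1 e2 e3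
        rw [this] at hmi2
        exact (List.getElem?_inj (List.getElem?_eq_some_iff.mp hmi).1 hnd).mp (hmi.trans hmi2.symm)
      · rw [Function.update_of_ne he]
        rcases List.mem_append.mp hmi' with h | h
        · exact h1 mi h
        · obtain rfl := List.mem_singleton.mp h
          exact absurd rfl he
    · rw [Function.update_of_ne (hq m (List.mem_of_getElem? hmi)).symm]
      exact h2 q hq
  · rintro pos' s ⟨hs, h1, h2⟩
    rw [List.length_zipIdx] at hs
    refine ⟨hs, fun m hm => ?_, h2⟩
    obtain ⟨i, hi⟩ := List.mem_iff_getElem?.mp hm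
    have := h1 (m, i) (List.mem_zipIdx_iff_getElem?.mpr hi)
    simp only at this
    rw [this, hi]

/-- An upper bound for the number of steps in which `setup` treats one bucket. -/
def bucketTime (d B : ℕ) : ℕ :=
  (d + 1) + sortTime B 1 + (B + 1) + (2 * B + 1) * (d + 5) + (d + 1) + (B * (d + 2) + 1)

/-- An upper bound for the number of steps of `setup`. -/
def setupTime (d n : ℕ) : ℕ :=
  (d + 1) * 2 ^ d + (d + 1) * 3 ^ d + 3 * (d + 1) * (d + n) * 2 ^ d + (d + 1) * (d + n) + 3 ^ d +
    ((d + n) * (2 ^ d * (2 ^ d * (5 * d + 6) + 2) + 2) + 1) +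
    (3 ^ d * (bucketTime d ((d + n) * 2 ^ d) + 1) + 1)

theorem setup_runs (I : Input d n) :
    Runs (setup I) fun st s => s ≤ setupTime d n ∧ st.x = I.start ∧ st.home = startHome ∧
      st.frac = [] ∧ ∃ L pos, MoveIndex I L pos ∧ Synced L pos st := by
  classical
  refine Runs.charge_bind (Runs.charge_bind (Runs.charge_bind (Runs.charge_bind
    (Runs.charge_bind (Runs.seq (buckets_runs I) ?_)))))
  rintro buckets s ⟨hs, hbuckets⟩
  refine Runs.seq (Runs.each (bucketTime d ((d + n) * 2 ^ d))
    (fun (done : List (SignVec d)) (mp : (SignVec d → ℕ × Tree d n) ×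
        (Item d n × Finset (Fin d) × Finset (Fin d) → ℕ)) =>
      ∃ L : SignVec d → List (Move d n), ∀ v ∈ done, (L v).Perm (buckets v) ∧
        ((L v).Pairwise fun m m' => m.cost ≤ m'.cost) ∧ mp.1 v = treeEntry (L v) I.start ∧
        ∀ m ∈ L v, (L v)[mp.2 (m.item, m.src, m.dst)]? = some m)
    ⟨fun _ => [], by simp⟩ ?_) ?_
  · rintro done v rest ⟨moves, pos⟩ hvecs ⟨L, hL⟩
    have hv : v ∉ done := by
      have := nodup_signVecs d
      rw [hvecs, List.nodup_append] at this
      exact fun h => this.2.2 v h v (by simp) rfl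
    refine Runs.charge_bind (Runs.seq (mergeSort_runs _
      (fun m m' : Move d n => m.cost ≤ m'.cost) 1 _
      fun a _ b _ => Runs.charge ⟨le_rfl, by simp⟩) ?_)
    rintro l s₁ ⟨hs₁, hperm, hsort⟩
    have hsort' := hsort (fun a b => le_total _ _) fun a b c => le_trans
    have hnd : l.Nodup := hperm.nodup_iff.mpr (hbuckets v).1
    have hlm : ∀ m ∈ l, IsMove I m ∧ netChange m.src m.dst = v := by
      intro m hm
      obtain ⟨h1, h2, -⟩ := ((hbuckets v).2 m).mp (hperm.mem_iff.mp hm)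
      exact ⟨h1, h2⟩
    have hlen := length_bucket_le hnd hlm
    rw [← hperm.length_eq] at hs₁
    refine Runs.charge_bind (Runs.seq (Tree.build_runs I.start (Nat.clog 2 l.length) l) ?_)
    rintro ⟨t, l'⟩ s₂ ⟨hs₂, ht, -⟩
    simp only at ht
    refine Runs.charge_bind (Runs.seq (positions_runs l (fun m hm => (hlm m hm).1) hnd pos) ?_)
    rintro pos' s₃ ⟨hs₃, hpos, hpos'⟩
    refine Runs.pure ⟨?_, Function.update L v l, ?_⟩
    · have e1 := sortTime_mono hlen 1
      have e2 : 2 ^ Nat.clog 2 l.length * (d + 5) ≤ (2 * ((d + n) * 2 ^ d) + 1) * (d + 5) :=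
        Nat.mul_le_mul_right _ ((two_pow_clog_le _).trans (by omega))
      have e3 := Nat.mul_le_mul_right (d + 2) hlen
      unfold bucketTime
      omega
    · intro v' hv'
      by_cases he : v' = v
      · subst he
        simp only [Function.update_self]
        exact ⟨hperm, hsort', by rw [ht]; rfl, hpos⟩
      · rw [Function.update_of_ne he]
        have hv'' : v' ∈ done := by
          rcases List.mem_append.mp hv' with h | h
          · exact h
          · exact absurd (List.mem_singleton.mp h) he
        obtain ⟨h1, h2, h3, h4⟩ := hL v' hv''
        refine ⟨h1, h2, ?_, fun m hm => ?_⟩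
        · simp only [Function.update_of_ne he]
          exact h3
        · simp only
          rw [hpos']
          · exact h4 m hm
          · rintro m' hm' hq
            obtain ⟨-, e2⟩ := Prod.mk.inj hq
            obtain ⟨e2, e3⟩ := Prod.mk.inj e2
            have h5 := ((hbuckets v').2 m).mp (h1.mem_iff.mp hm)
            have h6 := (hlm m' hm').2
            exact he (by rw [← h5.2.1, ← h6, e2, e3])
  · rintro ⟨moves, pos⟩ s' ⟨hs', L, hL⟩
    rw [length_signVecs] at hs'
    refine Runs.pure ⟨?_, rfl, rfl, rfl, L, pos, ?_, rfl, fun v => (hL v (mem_signVecs d v)).2.2.1⟩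
    · unfold setupTime
      omega
    · refine ⟨fun v m => ?_, fun v => ?_, fun v => (hL v (mem_signVecs d v)).2.1,
        fun v => (hL v (mem_signVecs d v)).2.2.2⟩
      · rw [(hL v (mem_signVecs d v)).1.mem_iff, (hbuckets v).2]
        simp
      · exact (hL v (mem_signVecs d v)).1.nodup_iff.mpr (hbuckets v).1

end Trees

/-! ### Feasible assignments with extra items -/

section Feasible

variable {d n : ℕ} {K : Type*} [Field K] [LinearOrder K] [IsStrictOrderedRing K]

/-- The size of an item, where the extra item of a bin is as large as the bin. -/
def Input.extSize (I : Input d n) : Item d n → ℕ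
  | .inl b => I.capacity b
  | .inr p => I.size p

/-- The cost of a placement, with the value `0` in place of `∞`. -/
def Input.finiteCost (I : Input d n) (q : Item d n × Finset (Fin d)) : ℚ := (I.extCost q).getD 0

/-- Feasibility of an assignment of all items, including the extra items: every item is assigned
completely, without placements of infinite cost, and all bins are full. -/
structure ExtFeasible (I : Input d n) (x : Item d n × Finset (Fin d) → K) : Prop where
  nonneg : ∀ q, 0 ≤ x q
  finite : ∀ q, I.extCost q = none → x q = 0
  assigned : ∀ p, ∑ q, (if q.1 = p then 1 else 0) * x q = I.extSize p
  filled : ∀ b, ∑ q, (if b ∈ q.2 then 1 else 0) * x q = I.capacity b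

/-- The cost of an assignment of all items. -/
def Input.extTotal (I : Input d n) (x : Item d n × Finset (Fin d) → K) : K :=
  ∑ q, (I.finiteCost q : K) * x q

theorem ExtFeasible.cast {I : Input d n} {x : Item d n × Finset (Fin d) → ℚ}
    (h : ExtFeasible I x) : ExtFeasible I fun q => (x q : ℝ) where
  nonneg q := by exact_mod_cast h.nonneg q
  finite q hq := by exact_mod_cast h.finite q hq
  assigned p := by
    have := congrArg (fun r : ℚ => (r : ℝ)) (h.assigned p)
    simpa [apply_ite (Rat.cast : ℚ → ℝ)] using this
  filled b := by
    have := congrArg (fun r : ℚ => (r : ℝ)) (h.filled b)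
    simpa [apply_ite (Rat.cast : ℚ → ℝ)] using this

theorem extTotal_cast (I : Input d n) (x : Item d n × Finset (Fin d) → ℚ) :
    I.extTotal (fun q => (x q : ℝ)) = ((I.extTotal x : ℚ) : ℝ) := by
  simp [Input.extTotal]

theorem sum_item_eq {R : Type*} [Semiring R] (x : Item d n × Finset (Fin d) → R) (p : Item d n) :
    ∑ q, (if q.1 = p then 1 else 0) * x q = ∑ S, x (p, S) := by
  rw [Fintype.sum_prod_type]
  rw [Finset.sum_eq_single p]
  · simp
  · intro p' _ hp
    simp [hp]
  · simp

theorem toRat_netChange (S T : Finset (Fin d)) (b : Fin d) :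
    (netChange S T).toRat b = (if b ∈ T then 1 else 0) - (if b ∈ S then 1 else 0) := by
  by_cases h1 : b ∈ T <;> by_cases h2 : b ∈ S <;> simp [SignVec.toRat, netChange, h1, h2]

/-! ### Moving mass -/

/-- The mass `amount` of `item` is to be moved from `src` to `dst`. -/
structure Transfer (d n : ℕ) where
  item : Item d n
  src : Finset (Fin d)
  dst : Finset (Fin d)
  amount : ℚ

/-- The change of the assignment by a transfer. -/
def Transfer.delta (t : Transfer d n) (q : Item d n × Finset (Fin d)) : ℚ :=
  (if q = (t.item, t.dst) then t.amount else 0) - (if q = (t.item, t.src) then t.amount else 0)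

theorem Transfer.sum_delta (t : Transfer d n) (w : Item d n × Finset (Fin d) → ℚ) :
    ∑ q, w q * t.delta q = t.amount * (w (t.item, t.dst) - w (t.item, t.src)) := by
  simp only [Transfer.delta, mul_sub, mul_ite, mul_zero, Finset.sum_sub_distrib,
    Finset.sum_ite_eq', Finset.mem_univ, if_true]
  ring

/-- The assignment after a list of transfers. -/
def transferAll (x : Item d n × Finset (Fin d) → ℚ) (l : List (Transfer d n))
    (q : Item d n × Finset (Fin d)) : ℚ :=
  x q + (l.map fun t => t.delta q).sum

theorem sum_transferAll (x w : Item d n × Finset (Fin d) → ℚ) (l : List (Transfer d n)) :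
    ∑ q, w q * transferAll x l q = ∑ q, w q * x q +
      (l.map fun t => t.amount * (w (t.item, t.dst) - w (t.item, t.src))).sum := by
  simp only [transferAll, mul_add, Finset.sum_add_distrib]
  congr 1
  induction l with
  | nil => simp
  | cons t l ih =>
    simp only [List.map_cons, List.sum_cons, mul_add, Finset.sum_add_distrib, ih]
    rw [t.sum_delta]

theorem transferAll_concat (x : Item d n × Finset (Fin d) → ℚ) (l : List (Transfer d n))
    (t : Transfer d n) (q : Item d n × Finset (Fin d)) :
    transferAll x (l ++ [t]) q = transferAll x l q + t.delta q := by
  simp [transferAll, add_assoc]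

theorem ExtFeasible.transferAll {I : Input d n} {x : Item d n × Finset (Fin d) → ℚ}
    (h : ExtFeasible I x) {l : List (Transfer d n)}
    (hsrc : ∀ t ∈ l, I.extCost (t.item, t.src) ≠ none)
    (hdst : ∀ t ∈ l, I.extCost (t.item, t.dst) ≠ none)
    (hbins : (l.map fun t => t.amount • (netChange t.src t.dst).toRat).sum = 0)
    (hnn : ∀ q, 0 ≤ transferAll x l q) : ExtFeasible I (transferAll x l) where
  nonneg := hnn
  finite q hq := by
    rw [SubsetAssignment.transferAll, h.finite q hq, zero_add]
    refine List.sum_eq_zero fun r hr => ?_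
    obtain ⟨t, ht, rfl⟩ := List.mem_map.mp hr
    rw [Transfer.delta, if_neg, if_neg, sub_zero]
    · rintro rfl
      exact hsrc t ht hq
    · rintro rfl
      exact hdst t ht hq
  assigned p := by
    rw [sum_transferAll, h.assigned]
    simp
  filled b := by
    rw [sum_transferAll, h.filled]
    have hb : ∀ l : List (Transfer d n),
        (l.map fun t => t.amount * ((if b ∈ t.dst then 1 else 0) - if b ∈ t.src then 1 else 0)).sum
          = (l.map fun t => t.amount • (netChange t.src t.dst).toRat).sum b := by
      intro l
      induction l with
      | nil => simp
      | cons t l ih =>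
        simp only [List.map_cons, List.sum_cons, ih, Pi.add_apply, Pi.smul_apply, smul_eq_mul,
          toRat_netChange]
    rw [hb l, hbins]
    simp

theorem extTotal_transferAll (I : Input d n) (x : Item d n × Finset (Fin d) → ℚ)
    (l : List (Transfer d n)) :
    I.extTotal (transferAll x l) = I.extTotal x + (l.map fun t => t.amount *
      (I.finiteCost (t.item, t.dst) - I.finiteCost (t.item, t.src))).sum := by
  simp only [Input.extTotal, Rat.cast_id]
  exact sum_transferAll x I.finiteCost l

theorem IsMove.cost_eq {I : Input d n} {m : Move d n} (h : IsMove I m) :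
    m.cost = I.finiteCost (m.item, m.dst) - I.finiteCost (m.item, m.src) := by
  obtain ⟨a, b, ha, hb, hc⟩ := h
  simp [Input.finiteCost, ha, hb, hc]

theorem IsMove.src_ne {I : Input d n} {m : Move d n} (h : IsMove I m) :
    I.extCost (m.item, m.src) ≠ none := by
  obtain ⟨a, b, ha, hb, hc⟩ := h
  simp [ha]

theorem IsMove.dst_ne {I : Input d n} {m : Move d n} (h : IsMove I m) :
    I.extCost (m.item, m.dst) ≠ none := by
  obtain ⟨a, b, ha, hb, hc⟩ := h
  simp [hb]

/-- An upper bound for the number of steps of `shift`. -/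
def shiftTime (d n : ℕ) : ℕ := 2 * (d + 2) + 2 * setMassTime d n

theorem shift_runs {I : Input d n} {L : SignVec d → List (Move d n)}
    {pos : Item d n × Finset (Fin d) × Finset (Fin d) → ℕ} (hL : MoveIndex I L pos)
    {st : Memory d n} (hst : Synced L pos st) (p : Item d n) (S T : Finset (Fin d)) (δ : ℚ) :
    Runs (shift I st p S T δ) fun st' s => s ≤ shiftTime d n ∧ Synced L pos st' ∧
      (∀ q, st'.x q = st.x q + Transfer.delta ⟨p, S, T, δ⟩ q) ∧ st'.home = st.home ∧
      st'.frac = st.frac := by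
  refine Runs.charge_bind (Runs.charge_bind (Runs.seq (setMass_runs hL hst p S _) ?_))
  rintro st₁ s₁ ⟨hs₁, h₁, hx₁, hh₁, hf₁⟩
  refine Runs.charge_bind (Runs.charge_bind ((setMass_runs hL h₁ p T _).mono ?_))
  rintro st₂ s₂ ⟨hs₂, h₂, hx₂, hh₂, hf₂⟩
  refine ⟨by unfold shiftTime; omega, h₂, fun q => ?_, hh₂.trans hh₁, hf₂.trans hf₁⟩
  rw [hx₂, hx₁, Transfer.delta]
  simp only [Function.update_apply]
  by_cases h1 : q = (p, T) <;> by_cases h2 : q = (p, S)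
  · have h3 : (p, T) = (p, S) := h1.symm.trans h2
    simp only [h1, h3, if_true]
    ring
  · have h3 : (p, T) ≠ (p, S) := fun h => h2 (h1.trans h)
    simp only [h1, h3, if_true, if_false]
    ring
  · simp only [h2, if_true]
    have h3 : (p, S) ≠ (p, T) := fun h => h1 (h2.trans h)
    simp only [h3, if_false]
    ring
  · simp only [h1, h2, if_false]
    ring

/-- A loop whose passes are transfers. -/
theorem shifts_runs {ι : Type} {L : SignVec d → List (Move d n)}
    {pos : Item d n × Finset (Fin d) × Finset (Fin d) → ℕ} (l : List ι) (tr : ι → Transfer d n)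
    (body : Memory d n → ι → Prog (Memory d n)) (c : ℕ) {st : Memory d n} (hst : Synced L pos st)
    (hbody : ∀ i ∈ l, ∀ st', Synced L pos st' → st'.home = st.home → st'.frac = st.frac →
      Runs (body st' i) fun st'' s => s ≤ c ∧ Synced L pos st'' ∧
        (∀ q, st''.x q = st'.x q + (tr i).delta q) ∧ st''.home = st'.home ∧
        st''.frac = st'.frac) :
    Runs (each l st body) fun st' s => s ≤ l.length * (c + 1) + 1 ∧ Synced L pos st' ∧
      st'.x = transferAll st.x (l.map tr) ∧ st'.home = st.home ∧ st'.frac = st.frac := by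
  refine (Runs.each c (fun (done : List ι) (st' : Memory d n) => Synced L pos st' ∧
    st'.x = transferAll st.x (done.map tr) ∧ st'.home = st.home ∧ st'.frac = st.frac)
    ⟨hst, by funext q; simp [transferAll], rfl, rfl⟩ ?_).mono fun _ _ h => h
  rintro done i rest st' hl ⟨h1, h2, h3, h4⟩
  refine (hbody i (by simp [hl]) st' h1 h3 h4).mono ?_
  rintro st'' s ⟨hs, h1', h2', h3', h4'⟩
  refine ⟨hs, h1', ?_, h3'.trans h3, h4'.trans h4⟩
  funext q
  rw [h2', h2, List.map_append, List.map_singleton, transferAll_concat]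

/-! ### Fractional variables -/

/-- The sets `home p` and the list `frac` describe the support of the assignment: every item with
mass somewhere has mass on `home p`, and `frac` lists the other pairs with mass. -/
structure Tidy (st : Memory d n) : Prop where
  nodup : st.frac.Nodup
  frac_ne_zero : ∀ q ∈ st.frac, st.x q ≠ 0
  frac_ne_home : ∀ q ∈ st.frac, q.2 ≠ st.home q.1
  cover : ∀ q, st.x q ≠ 0 → q.2 = st.home q.1 ∨ q ∈ st.frac
  home_ne_zero : ∀ q, st.x q ≠ 0 → st.x (q.1, st.home q.1) ≠ 0

/-- An upper bound for the number of steps of `tidy` with `c` candidates. -/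
def tidyTime (d c : ℕ) : ℕ := c * ((d + 1) * (c + 7) + 1) + 1

theorem tidy_runs {st : Memory d n} (cand : List (Item d n × Finset (Fin d)))
    (hcover : ∀ q, st.x q ≠ 0 → q.2 = st.home q.1 ∨ q ∈ cand) :
    Runs (tidy st cand) fun st' s => s ≤ tidyTime d cand.length ∧ Tidy st' ∧
      st'.x = st.x ∧ st'.moves = st.moves ∧ st'.pos = st.pos ∧
      st'.frac.length ≤ cand.length := by
  refine Runs.seq (Runs.each ((d + 1) * (cand.length + 7))
    (fun (done : List (Item d n × Finset (Fin d)))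
      (hX : (Item d n → Finset (Fin d)) × List (Item d n × Finset (Fin d))) =>
      hX.2.Nodup ∧ (∀ q ∈ hX.2, st.x q ≠ 0 ∧ q.2 ≠ hX.1 q.1 ∧ st.x (q.1, hX.1 q.1) ≠ 0) ∧
      (∀ q ∈ done, st.x q ≠ 0 → (q.2 = hX.1 q.1 ∨ q ∈ hX.2) ∧ st.x (q.1, hX.1 q.1) ≠ 0) ∧
      (∀ p, hX.1 p = st.home p ∨ st.x (p, st.home p) = 0) ∧ hX.2.length ≤ done.length)
    (by simp) ?_) ?_
  · rintro done ⟨p, S⟩ rest ⟨home, X⟩ hl ⟨h1, h2, h3, h4, h5⟩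
    simp only at h1 h2 h3 h4 h5
    have hlen : done.length + 1 ≤ cand.length := by
      rw [hl]
      simp
    have hcost : (d + 1) * (X.length + 1) ≤ (d + 1) * cand.length :=
      Nat.mul_le_mul_left _ (by omega)
    have hcost' : (d + 1) * (cand.length + 7) = (d + 1) * cand.length + 7 * (d + 1) := by ring
    refine Runs.charge_bind (Runs.charge_bind ?_)
    by_cases hy : st.x (p, S) = 0
    · simp only [hy, decide_true, if_true]
      refine Runs.pure ⟨by omega, h1, h2, fun q hq hxq => ?_, h4, by simp; omega⟩
      rcases List.mem_append.mp hq with hq | hq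
      · exact h3 q hq hxq
      · rw [List.mem_singleton.mp hq] at hxq
        exact absurd hy hxq
    simp only [hy, decide_false, Bool.false_eq_true, if_false]
    refine Runs.charge_bind (Runs.charge_bind ?_)
    by_cases hS : S = home p
    · simp only [hS, decide_true, if_true]
      refine Runs.pure ⟨by omega, h1, h2, fun q hq hxq => ?_, h4, by simp; omega⟩
      rcases List.mem_append.mp hq with hq | hq
      · exact h3 q hq hxq
      · obtain rfl := List.mem_singleton.mp hq
        exact ⟨Or.inl rfl, hxq⟩
    simp only [hS, decide_false, Bool.false_eq_true, if_false]
    refine Runs.charge_bind (Runs.charge_bind ?_)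
    by_cases hz : st.x (p, home p) = 0
    · simp only [hz, decide_true, if_true]
      refine Runs.charge_bind (Runs.pure ⟨by omega, h1, fun q hq => ?_, fun q hq hxq => ?_,
        fun p' => ?_, by simp; omega⟩)
      · -- no pair of the item `p` has been listed, because its old home is empty
        have hqp : q.1 ≠ p := by
          rintro rfl
          exact (h2 q hq).2.2 hz
        simp only [Function.update_of_ne hqp]
        exact h2 q hq
      · simp only
        rcases List.mem_append.mp hq with hq' | hq'
        · have hqp : q.1 ≠ p := by
            rintro rfl
            exact (h3 q hq' hxq).2 hz
          simp only [Function.update_of_ne hqp]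
          exact h3 q hq' hxq
        · obtain rfl := List.mem_singleton.mp hq'
          exact ⟨Or.inl (Function.update_self (f := home) p S).symm,
            by rw [Function.update_self]; exact hy⟩
      · simp only
        by_cases hp : p' = p
        · subst hp
          rcases h4 p' with h | h
          · exact Or.inr (h ▸ hz)
          · exact Or.inr h
        · rw [Function.update_of_ne hp]
          exact h4 p'
    simp only [hz, decide_false, Bool.false_eq_true, if_false]
    refine Runs.charge_bind ?_
    have hany : (X.any fun r => decide (r = (p, S))) = true ↔ (p, S) ∈ X := by simp
    by_cases hX : (p, S) ∈ X
    · rw [if_pos (hany.mpr hX)]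
      refine Runs.pure ⟨by omega, h1, h2, fun q hq hxq => ?_, h4, by simp; omega⟩
      rcases List.mem_append.mp hq with hq | hq
      · exact h3 q hq hxq
      · obtain rfl := List.mem_singleton.mp hq
        exact ⟨Or.inr hX, hz⟩
    · rw [if_neg (fun h => hX (hany.mp h))]
      refine Runs.charge ⟨by omega, List.nodup_cons.mpr ⟨hX, h1⟩, fun q hq => ?_,
        fun q hq hxq => ?_, h4, by simp; omega⟩
      · rcases List.mem_cons.mp hq with rfl | hq
        · exact ⟨hy, hS, hz⟩
        · exact h2 q hq
      · rcases List.mem_append.mp hq with hq | hq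
        · obtain ⟨h | h, h'⟩ := h3 q hq hxq
          · exact ⟨Or.inl h, h'⟩
          · exact ⟨Or.inr (List.mem_cons_of_mem _ h), h'⟩
        · obtain rfl := List.mem_singleton.mp hq
          exact ⟨Or.inr (by simp), hz⟩
  · rintro ⟨home, X⟩ s ⟨hs, h1, h2, h3, h4, h5⟩
    simp only at h1 h2 h3 h4 h5
    have hfin : ∀ q, st.x q ≠ 0 → (q.2 = home q.1 ∨ q ∈ X) ∧ st.x (q.1, home q.1) ≠ 0 := by
      intro q hq
      rcases hcover q hq with h | h
      · rcases h4 q.1 with h' | h'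
        · rw [h', ← h]
          exact ⟨Or.inl rfl, hq⟩
        · rw [← h] at h'
          exact absurd h' hq
      · exact h3 q h hq
    exact Runs.pure ⟨by unfold tidyTime; omega, ⟨h1, fun q hq => (h2 q hq).1,
      fun q hq => (h2 q hq).2.1, fun q hq => (hfin q hq).1, fun q hq => (hfin q hq).2⟩,
      rfl, rfl, rfl, h5⟩

theorem ExtFeasible.exists_ne_zero_iff {I : Input d n} {x : Item d n × Finset (Fin d) → K}
    (h : ExtFeasible I x) (p : Item d n) : (∃ S, x (p, S) ≠ 0) ↔ I.extSize p ≠ 0 := by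
  have hp := h.assigned p
  rw [sum_item_eq] at hp
  constructor
  · rintro ⟨S, hS⟩ h0
    rw [h0, Nat.cast_zero, Finset.sum_eq_zero_iff_of_nonneg fun S _ => h.nonneg _] at hp
    exact hS (hp S (Finset.mem_univ _))
  · intro h0
    by_contra hno
    push Not at hno
    rw [Finset.sum_eq_zero fun S _ => hno S] at hp
    exact h0 (by exact_mod_cast hp.symm)

/-- The support of a tidy assignment has one pair for every nonempty item, besides the pairs of the
list `frac`. -/
theorem Tidy.card_support {I : Input d n} {st : Memory d n} (h : Tidy st)
    (hx : ExtFeasible I st.x) :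
    (Finset.univ.filter fun q => st.x q ≠ 0).card =
      st.frac.length + (Finset.univ.filter fun p => I.extSize p ≠ 0).card := by
  classical
  have hdisj : Disjoint st.frac.toFinset
      ((Finset.univ.filter fun p => I.extSize p ≠ 0).image fun p => (p, st.home p)) := by
    rw [Finset.disjoint_left]
    intro q hq hq'
    obtain ⟨p, -, rfl⟩ := Finset.mem_image.mp hq'
    exact h.frac_ne_home _ (List.mem_toFinset.mp hq) rfl
  have hunion : (Finset.univ.filter fun q => st.x q ≠ 0) = st.frac.toFinset ∪
      ((Finset.univ.filter fun p => I.extSize p ≠ 0).image fun p => (p, st.home p)) := by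
    ext q
    simp only [Finset.mem_filter, Finset.mem_univ, true_and, Finset.mem_union,
      List.mem_toFinset, Finset.mem_image]
    constructor
    · intro hq
      rcases h.cover q hq with h' | h'
      · exact Or.inr ⟨q.1, (hx.exists_ne_zero_iff q.1).mp ⟨q.2, hq⟩, by rw [← h']⟩
      · exact Or.inl h'
    · rintro (hq | ⟨p, hp, rfl⟩)
      · exact h.frac_ne_zero q hq
      · obtain ⟨S, hS⟩ := (hx.exists_ne_zero_iff p).mpr hp
        exact h.home_ne_zero (p, S) hS
  rw [hunion, Finset.card_union_of_disjoint hdisj, List.toFinset_card_of_nodup h.nodup,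
    Finset.card_image_of_injective _ fun p p' hp => (Prod.mk.inj hp).1]

end Feasible

/-! ### Restoring a basic assignment -/

section Restore

variable {d n : ℕ}

/-- The properties of the memory that hold throughout: the search trees are up to date, the
assignment is feasible, and its support is described correctly. -/
structure Valid (I : Input d n) (L : SignVec d → List (Move d n))
    (pos : Item d n × Finset (Fin d) × Finset (Fin d) → ℕ) (st : Memory d n) : Prop where
  synced : Synced L pos st
  feasible : ExtFeasible I st.x
  tidy : Tidy st

/-- The net change of the bins by a unit of mass that becomes fractional in position `i`. -/
def fracVec (st : Memory d n) (i : Fin st.frac.length) : Fin d → ℚ :=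
  (netChange (st.home (st.frac.get i).1) (st.frac.get i).2).toRat

/-- The loss of `home p` for the item `p` in position `i`, if the fractional variables grow
by `β`. -/
def netLoss (st : Memory d n) (β : Fin st.frac.length → ℚ) (p : Item d n) : ℚ :=
  ∑ j, if (st.frac.get j).1 = p then β j else 0

/-- The transfer in position `i` if the fractional variables grow by `a * β`. -/
def fracTransfer (st : Memory d n) (β : Fin st.frac.length → ℚ) (a : ℚ)
    (i : Fin st.frac.length) : Transfer d n :=
  ⟨(st.frac.get i).1, st.home (st.frac.get i).1, (st.frac.get i).2, a * β i⟩

/-- The assignment after the fractional variables have grown by `a * β`. -/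
def grow (st : Memory d n) (β : Fin st.frac.length → ℚ) (a : ℚ) :
    Item d n × Finset (Fin d) → ℚ :=
  transferAll st.x ((List.finRange st.frac.length).map (fracTransfer st β a))

theorem grow_apply (st : Memory d n) (β : Fin st.frac.length → ℚ) (a : ℚ)
    (q : Item d n × Finset (Fin d)) :
    grow st β a q = st.x q + ∑ i, (fracTransfer st β a i).delta q := by
  rw [grow, transferAll, List.map_map, Fin.sum_univ_def]
  rfl

theorem Tidy.grow_frac {st : Memory d n} (h : Tidy st) (β : Fin st.frac.length → ℚ) (a : ℚ)
    (k : Fin st.frac.length) :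
    grow st β a (st.frac.get k) = st.x (st.frac.get k) + a * β k := by
  rw [grow_apply]
  congr 1
  rw [Finset.sum_eq_single k]
  · rw [fracTransfer, Transfer.delta, if_pos rfl, if_neg, sub_zero]
    intro he
    exact h.frac_ne_home _ (List.get_mem _ k) (congrArg Prod.snd he)
  · intro i _ hik
    rw [fracTransfer, Transfer.delta, if_neg, if_neg, sub_zero]
    · intro he
      have h1 := congrArg Prod.fst he
      have h2 := congrArg Prod.snd he
      simp only at h1 h2
      rw [← h1] at h2
      exact h.frac_ne_home _ (List.get_mem _ k) h2
    · intro he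
      exact hik (List.nodup_iff_injective_get.mp h.nodup he).symm
  · simp

theorem Tidy.grow_home {st : Memory d n} (h : Tidy st) (β : Fin st.frac.length → ℚ) (a : ℚ)
    (p : Item d n) :
    grow st β a (p, st.home p) = st.x (p, st.home p) - a * netLoss st β p := by
  rw [grow_apply, sub_eq_add_neg, netLoss, Finset.mul_sum, ← Finset.sum_neg_distrib]
  congr 1
  refine Finset.sum_congr rfl fun i _ => ?_
  rw [fracTransfer, Transfer.delta, if_neg, zero_sub]
  · by_cases hp : (st.frac.get i).1 = p
    · rw [if_pos hp, if_pos (by rw [hp])]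
    · rw [if_neg hp, if_neg, mul_zero]
      intro he
      exact hp (congrArg Prod.fst he).symm
  · intro he
    have h1 := congrArg Prod.fst he
    have h2 := congrArg Prod.snd he
    simp only at h1 h2
    exact h.frac_ne_home _ (List.get_mem _ i) (by rw [← h2, h1])

theorem grow_other {st : Memory d n} (β : Fin st.frac.length → ℚ) (a : ℚ)
    {q : Item d n × Finset (Fin d)} (hq : q ∉ st.frac) (hq' : q.2 ≠ st.home q.1) :
    grow st β a q = st.x q := by
  rw [grow_apply, Finset.sum_eq_zero, add_zero]
  intro i _
  rw [fracTransfer, Transfer.delta, if_neg, if_neg, sub_zero]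
  · rintro rfl
    exact hq' rfl
  · intro he
    exact hq (he ▸ List.get_mem _ i)

/-- A largest feasible growth empties a fractional variable or the home of an item. -/
theorem Valid.grow {I : Input d n} {L : SignVec d → List (Move d n)}
    {pos : Item d n × Finset (Fin d) × Finset (Fin d) → ℕ} {st : Memory d n}
    (h : Valid I L pos st) {β : Fin st.frac.length → ℚ} (hβ : ∑ i, β i • fracVec st i = 0)
    {a : ℚ} (ha : 0 < a)
    (hneg : ∀ i, β i < 0 → a * -β i ≤ st.x (st.frac.get i))
    (hnet : ∀ i, 0 < netLoss st β (st.frac.get i).1 →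
      a * netLoss st β (st.frac.get i).1 ≤
        st.x ((st.frac.get i).1, st.home (st.frac.get i).1))
    (hwit : ∃ i, (β i < 0 ∧ a * -β i = st.x (st.frac.get i)) ∨
      (0 < netLoss st β (st.frac.get i).1 ∧ a * netLoss st β (st.frac.get i).1 =
        st.x ((st.frac.get i).1, st.home (st.frac.get i).1))) :
    ExtFeasible I (grow st β a) ∧ (∀ q, grow st β a q ≠ 0 → st.x q ≠ 0) ∧
      ∃ q, st.x q ≠ 0 ∧ grow st β a q = 0 := by
  have htidy := h.tidy
  have hfin : ∀ q, st.x q ≠ 0 → I.extCost q ≠ none := fun q hq hn =>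
    hq (h.feasible.finite q hn)
  have hloss : ∀ p, (¬ ∃ i, (st.frac.get i).1 = p) → netLoss st β p = 0 := by
    intro p hp
    refine Finset.sum_eq_zero fun j _ => if_neg fun hj => hp ⟨j, hj⟩
  have hcases : ∀ q, (∃ k, st.frac.get k = q) ∨ (∃ p, q = (p, st.home p)) ∨
      (q ∉ st.frac ∧ q.2 ≠ st.home q.1) := by
    intro q
    by_cases h1 : q ∈ st.frac
    · exact Or.inl (List.mem_iff_get.mp h1)
    · by_cases h2 : q.2 = st.home q.1
      · exact Or.inr (Or.inl ⟨q.1, by rw [← h2]⟩)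
      · exact Or.inr (Or.inr ⟨h1, h2⟩)
  have hnn : ∀ q, 0 ≤ SubsetAssignment.grow st β a q := by
    intro q
    rcases hcases q with ⟨k, rfl⟩ | ⟨p, rfl⟩ | ⟨h1, h2⟩
    · rw [htidy.grow_frac]
      rcases lt_or_ge (β k) 0 with hk | hk
      · have := hneg k hk
        linarith
      · exact add_nonneg (h.feasible.nonneg _) (mul_nonneg ha.le hk)
    · rw [htidy.grow_home]
      rcases lt_or_ge 0 (netLoss st β p) with hp | hp
      · have hex : ∃ i, (st.frac.get i).1 = p := by
          by_contra hno
          rw [hloss p hno] at hp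
          exact lt_irrefl _ hp
        obtain ⟨i, rfl⟩ := hex
        have := hnet i hp
        linarith
      · have h1 := h.feasible.nonneg (p, st.home p)
        have h2 := mul_nonneg ha.le (neg_nonneg.mpr hp)
        linarith
    · rw [grow_other β a h1 h2]
      exact h.feasible.nonneg q
  refine ⟨?_, ?_, ?_⟩
  · refine h.feasible.transferAll ?_ ?_ ?_ hnn
    · intro t ht
      obtain ⟨i, -, rfl⟩ := List.mem_map.mp ht
      exact hfin _ (htidy.home_ne_zero _ (htidy.frac_ne_zero _ (List.get_mem _ i)))
    · intro t ht
      obtain ⟨i, -, rfl⟩ := List.mem_map.mp ht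
      exact hfin _ (htidy.frac_ne_zero _ (List.get_mem _ i))
    · have := congrArg (fun v => a • v) hβ
      simp only [smul_zero, Finset.smul_sum, smul_smul] at this
      rw [List.map_map, ← this, Fin.sum_univ_def]
      rfl
  · intro q hq
    rcases hcases q with ⟨k, rfl⟩ | ⟨p, rfl⟩ | ⟨h1, h2⟩
    · exact htidy.frac_ne_zero _ (List.get_mem _ k)
    · by_cases hex : ∃ i, (st.frac.get i).1 = p
      · obtain ⟨i, rfl⟩ := hex
        exact htidy.home_ne_zero _ (htidy.frac_ne_zero _ (List.get_mem _ i))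
      · rwa [htidy.grow_home, hloss p hex, mul_zero, sub_zero] at hq
    · rwa [grow_other β a h1 h2] at hq
  · obtain ⟨i, ⟨-, hi⟩ | ⟨-, hi⟩⟩ := hwit
    · refine ⟨st.frac.get i, htidy.frac_ne_zero _ (List.get_mem _ i), ?_⟩
      rw [htidy.grow_frac, ← hi]
      ring
    · refine ⟨_, htidy.home_ne_zero _ (htidy.frac_ne_zero _ (List.get_mem _ i)), ?_⟩
      rw [htidy.grow_home, hi, sub_self]

theorem Valid.isMove_frac {I : Input d n} {L : SignVec d → List (Move d n)}
    {pos : Item d n × Finset (Fin d) × Finset (Fin d) → ℕ} {st : Memory d n}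
    (h : Valid I L pos st) (i : Fin st.frac.length) :
    IsMove I ⟨(st.frac.get i).1, st.home (st.frac.get i).1, (st.frac.get i).2,
      I.finiteCost (st.frac.get i) -
        I.finiteCost ((st.frac.get i).1, st.home (st.frac.get i).1)⟩ := by
  have hx := h.tidy.frac_ne_zero _ (List.get_mem _ i)
  obtain ⟨b, hb⟩ := Option.ne_none_iff_exists'.mp fun hn => hx (h.feasible.finite _ hn)
  obtain ⟨a, ha⟩ := Option.ne_none_iff_exists'.mp fun hn =>
    h.tidy.home_ne_zero _ hx (h.feasible.finite _ hn)
  refine ⟨a, b, ha, hb, ?_⟩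
  simp only [Input.finiteCost, ha, hb, Option.getD_some]

/-- The change of the cost if the fractional variables grow by `β`. -/
def growCost (I : Input d n) (st : Memory d n) (β : Fin st.frac.length → ℚ) : ℚ :=
  ∑ i, β i * (I.finiteCost (st.frac.get i) -
    I.finiteCost ((st.frac.get i).1, st.home (st.frac.get i).1))

theorem extTotal_grow (I : Input d n) (st : Memory d n) (β : Fin st.frac.length → ℚ) (a : ℚ) :
    I.extTotal (grow st β a) = I.extTotal st.x + a * growCost I st β := by
  rw [grow, extTotal_transferAll, growCost, Finset.mul_sum, List.map_map, Fin.sum_univ_def]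
  congr 2
  refine List.map_congr_left fun i _ => ?_
  simp only [Function.comp_apply, fracTransfer]
  ring

theorem sum_finRange_append {r : ℕ} {M : Type*} [AddCommMonoid M] (f : Fin r → M)
    (l : List (Fin r)) (i : Fin r) : ((l ++ [i]).map f).sum = (l.map f).sum + f i := by
  simp

/-- The loop of `cancel` that computes the change of the cost. -/
theorem growCost_runs {I : Input d n} {L : SignVec d → List (Move d n)}
    {pos : Item d n × Finset (Fin d) × Finset (Fin d) → ℕ} {st : Memory d n}
    (h : Valid I L pos st) (β : Fin st.frac.length → ℚ) :
    Runs (each (List.finRange st.frac.length) (0 : ℚ) fun total i => do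
      let (p, S) := st.frac.get i
      let H ← fetch d st.home p
      match ← moveCost I p H S with
      | none => pure total
      | some c =>
        let c ← mul (β i) c
        add total c) fun total s =>
      s ≤ st.frac.length * (3 * d + 7) + 1 ∧ total = growCost I st β := by
  refine (Runs.each (3 * d + 6) (fun (done : List (Fin st.frac.length)) (total : ℚ) =>
    total = (done.map fun i => β i * (I.finiteCost (st.frac.get i) -
      I.finiteCost ((st.frac.get i).1, st.home (st.frac.get i).1))).sum) (by simp) ?_).mono ?_
  · rintro done i rest total - htotal
    refine Runs.charge_bind (Runs.seq (moveCost_runs I _ _ _) ?_)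
    rintro o s ⟨hs, ho⟩
    obtain rfl := (ho _).mpr (h.isMove_frac i)
    refine Runs.charge_bind (Runs.charge ⟨by omega, ?_⟩)
    rw [sum_finRange_append, htotal]
  · rintro total s ⟨hs, htotal⟩
    rw [List.length_finRange] at hs
    exact ⟨hs, by rw [htotal, growCost, Fin.sum_univ_def]⟩

theorem netLoss_runs (st : Memory d n) (β : Fin st.frac.length → ℚ) (p : Item d n) :
    Runs (each (List.finRange st.frac.length) (0 : ℚ) fun net j => do
      if ← charge 1 (decide ((st.frac.get j).1 = p)) then add net (β j) else pure net)
      fun net s => s ≤ st.frac.length * 3 + 1 ∧ net = netLoss st β p := by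
  refine (Runs.each 2 (fun (done : List (Fin st.frac.length)) (net : ℚ) =>
    net = (done.map fun j => if (st.frac.get j).1 = p then β j else 0).sum) (by simp) ?_).mono ?_
  · rintro done i rest net - hnet
    refine Runs.charge_bind ?_
    rw [sum_finRange_append]
    by_cases hp : (st.frac.get i).1 = p
    · rw [if_pos (decide_eq_true hp), if_pos hp]
      exact Runs.charge ⟨by omega, by rw [hnet]⟩
    · rw [if_neg (by simpa using hp), if_neg hp]
      exact Runs.pure ⟨by omega, by rw [hnet, add_zero]⟩
  · rintro net s ⟨hs, hnet⟩
    rw [List.length_finRange] at hs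
    exact ⟨hs, by rw [hnet, netLoss, Fin.sum_univ_def]⟩

theorem optMin_runs (best : Option ℚ) (q : ℚ) :
    Runs (optMin best q) fun o s => s = 1 ∧ ∃ r, o = some r ∧ r ≤ q ∧
      (∀ b, best = some b → r ≤ b) ∧ (r = q ∨ best = some r) := by
  match best with
  | none => exact Runs.charge ⟨rfl, q, rfl, le_rfl, by simp, Or.inl rfl⟩
  | some b =>
    refine Runs.charge ⟨rfl, min b q, rfl, min_le_right _ _, ?_, ?_⟩
    · rintro b' hb
      obtain rfl := Option.some.inj hb
      exact min_le_left _ _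
    · rcases min_choice b q with h | h
      · exact Or.inr (by rw [h])
      · exact Or.inl h

/-- `a` is the largest magnitude that keeps the variables in the positions `done` nonnegative,
`none` if there is no bound. -/
structure GrowBound (st : Memory d n) (β : Fin st.frac.length → ℚ)
    (neg net : Fin st.frac.length → Prop) (o : Option ℚ) : Prop where
  neg_none : o = none → ∀ i, neg i → 0 ≤ β i
  net_none : o = none → ∀ i, net i → netLoss st β (st.frac.get i).1 ≤ 0
  pos : ∀ a, o = some a → 0 < a
  neg_some : ∀ a, o = some a → ∀ i, neg i → β i < 0 → a * -β i ≤ st.x (st.frac.get i)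
  net_some : ∀ a, o = some a → ∀ i, net i → 0 < netLoss st β (st.frac.get i).1 →
    a * netLoss st β (st.frac.get i).1 ≤ st.x ((st.frac.get i).1, st.home (st.frac.get i).1)
  tight : ∀ a, o = some a → ∃ i, (β i < 0 ∧ a * -β i = st.x (st.frac.get i)) ∨
    (0 < netLoss st β (st.frac.get i).1 ∧ a * netLoss st β (st.frac.get i).1 =
      st.x ((st.frac.get i).1, st.home (st.frac.get i).1))

/-- A further bound `q` of the magnitude is taken into account. -/
theorem GrowBound.optMin {st : Memory d n} {β : Fin st.frac.length → ℚ}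
    {neg net neg' net' : Fin st.frac.length → Prop} {best : Option ℚ} {q r : ℚ}
    (h : GrowBound st β neg net best) (hrq : r ≤ q) (hrb : ∀ b, best = some b → r ≤ b)
    (hr : r = q ∨ best = some r) (hq : 0 < q)
    (hneg' : ∀ i, neg' i → neg i ∨ q * -β i ≤ st.x (st.frac.get i))
    (hnet' : ∀ i, net' i → net i ∨ q * netLoss st β (st.frac.get i).1 ≤
      st.x ((st.frac.get i).1, st.home (st.frac.get i).1))
    (htight : ∃ i, (β i < 0 ∧ q * -β i = st.x (st.frac.get i)) ∨
      (0 < netLoss st β (st.frac.get i).1 ∧ q * netLoss st β (st.frac.get i).1 =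
        st.x ((st.frac.get i).1, st.home (st.frac.get i).1))) : GrowBound st β neg' net' (some r) := by
  have hr0 : 0 < r := by
    rcases hr with rfl | hr
    · exact hq
    · exact h.pos r hr
  refine ⟨by simp, by simp, ?_, ?_, ?_, ?_⟩
  · rintro a ha
    obtain rfl := Option.some.inj ha
    exact hr0
  · rintro a ha i hi hβ
    obtain rfl := Option.some.inj ha
    rcases hneg' i hi with h1 | h1
    · cases hb : best with
      | none => exact absurd (h.neg_none hb i h1) (not_le.mpr hβ)
      | some b =>
        exact (mul_le_mul_of_nonneg_right (hrb b hb) (by linarith)).trans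
          (h.neg_some b hb i h1 hβ)
    · exact (mul_le_mul_of_nonneg_right hrq (by linarith)).trans h1
  · rintro a ha i hi hpos
    obtain rfl := Option.some.inj ha
    rcases hnet' i hi with h1 | h1
    · cases hb : best with
      | none => exact absurd (h.net_none hb i h1) (not_le.mpr hpos)
      | some b =>
        exact (mul_le_mul_of_nonneg_right (hrb b hb) hpos.le).trans
          (h.net_some b hb i h1 hpos)
    · exact (mul_le_mul_of_nonneg_right hrq hpos.le).trans h1
  · rintro a ha
    obtain rfl := Option.some.inj ha
    rcases hr with rfl | hr
    · exact htight
    · exact h.tight r hr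

theorem GrowBound.skip {st : Memory d n} {β : Fin st.frac.length → ℚ}
    {neg net neg' net' : Fin st.frac.length → Prop} {best : Option ℚ}
    (h : GrowBound st β neg net best) (hneg' : ∀ i, neg' i → neg i ∨ 0 ≤ β i)
    (hnet' : ∀ i, net' i → net i ∨ netLoss st β (st.frac.get i).1 ≤ 0) :
    GrowBound st β neg' net' best := by
  refine ⟨fun hb i hi => ?_, fun hb i hi => ?_, h.pos, fun a ha i hi hβ => ?_,
    fun a ha i hi hpos => ?_, h.tight⟩
  · exact (hneg' i hi).elim (h.neg_none hb i) id
  · exact (hnet' i hi).elim (h.net_none hb i) id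
  · exact h.neg_some a ha i ((hneg' i hi).resolve_right (not_le.mpr hβ)) hβ
  · exact h.net_some a ha i ((hnet' i hi).resolve_right (not_le.mpr hpos)) hpos

/-- The loop of `cancel` that computes the largest magnitude. -/
theorem growBound_runs {I : Input d n} {L : SignVec d → List (Move d n)}
    {pos : Item d n × Finset (Fin d) × Finset (Fin d) → ℕ} {st : Memory d n}
    (h : Valid I L pos st) (β : Fin st.frac.length → ℚ) :
    Runs (each (List.finRange st.frac.length) none fun a i => do
      let (p, S) := st.frac.get i
      let a ← if ← lt (β i) 0 then do
          let y ← fetch d st.x (p, S)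
          let q ← div y (-β i)
          optMin a q
        else pure a
      let net ← each (List.finRange st.frac.length) (0 : ℚ) fun net j => do
        if ← charge 1 (decide ((st.frac.get j).1 = p)) then add net (β j) else pure net
      if ← lt 0 net then
        let H ← fetch d st.home p
        let y ← fetch d st.x (p, H)
        let q ← div y net
        optMin a q
      else pure a) fun o s =>
      s ≤ st.frac.length * (3 * d + 3 * st.frac.length + 13) + 1 ∧
        GrowBound st β (fun _ => True) (fun _ => True) o := by
  have hnn : ∀ i, 0 ≤ st.x (st.frac.get i) := fun i => h.feasible.nonneg _
  refine (Runs.each (3 * d + 3 * st.frac.length + 12)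
    (fun (done : List (Fin st.frac.length)) (o : Option ℚ) =>
      GrowBound st β (· ∈ done) (· ∈ done) o) ?_ ?_).mono ?_
  · exact ⟨by simp, by simp, by simp, by simp, by simp, by simp⟩
  · rintro done i rest o - hinv
    have hxi : 0 < st.x (st.frac.get i) :=
      lt_of_le_of_ne (hnn i) (h.tidy.frac_ne_zero _ (List.get_mem _ i)).symm
    have hxh : 0 < st.x ((st.frac.get i).1, st.home (st.frac.get i).1) :=
      lt_of_le_of_ne (h.feasible.nonneg _)
        (h.tidy.home_ne_zero _ (h.tidy.frac_ne_zero _ (List.get_mem _ i))).symm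
    -- the second half of a pass, for the bound by the home of the item
    have second : ∀ o' : Option ℚ, GrowBound st β (· ∈ done ++ [i]) (· ∈ done) o' →
        ∀ s₀ ≤ d + 4, Runs (do
          let net ← each (List.finRange st.frac.length) (0 : ℚ) fun net j => do
            if ← charge 1 (decide ((st.frac.get j).1 = (st.frac.get i).1)) then add net (β j)
            else pure net
          if ← lt 0 net then
            let H ← fetch d st.home (st.frac.get i).1
            let y ← fetch d st.x ((st.frac.get i).1, H)
            let q ← div y net
            optMin o' q
          else pure o') fun o'' s => s₀ + s ≤ 3 * d + 3 * st.frac.length + 12 ∧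
            GrowBound st β (· ∈ done ++ [i]) (· ∈ done ++ [i]) o'' := by
      intro o' ho' s₀ hs₀
      refine Runs.seq (netLoss_runs st β _) ?_
      rintro net s ⟨hs, rfl⟩
      refine Runs.charge_bind ?_
      by_cases hpos : 0 < netLoss st β (st.frac.get i).1
      · rw [if_pos (decide_eq_true hpos)]
        refine Runs.charge_bind (Runs.charge_bind (Runs.charge_bind ((optMin_runs _ _).mono ?_)))
        rintro o'' s' ⟨rfl, r, rfl, hrq, hrb, hr⟩
        have hq : st.x ((st.frac.get i).1, st.home (st.frac.get i).1) /
            netLoss st β (st.frac.get i).1 * netLoss st β (st.frac.get i).1 =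
            st.x ((st.frac.get i).1, st.home (st.frac.get i).1) :=
          div_mul_cancel₀ _ hpos.ne'
        refine ⟨by omega, ho'.optMin hrq hrb hr (div_pos hxh hpos) (fun j hj => Or.inl hj)
          (fun j hj => ?_) ⟨i, Or.inr ⟨hpos, hq⟩⟩⟩
        rcases List.mem_append.mp hj with hj | hj
        · exact Or.inl hj
        · obtain rfl := List.mem_singleton.mp hj
          exact Or.inr hq.le
      · rw [if_neg (by simpa using hpos)]
        refine Runs.pure ⟨by omega, ho'.skip (fun j hj => Or.inl hj) fun j hj => ?_⟩
        rcases List.mem_append.mp hj with hj | hj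
        · exact Or.inl hj
        · obtain rfl := List.mem_singleton.mp hj
          exact Or.inr (not_lt.mp hpos)
    refine Runs.charge_bind ?_
    by_cases hβ : β i < 0
    · simp only [hβ, decide_true, if_true]
      refine Runs.charge_bind (Runs.charge_bind (Runs.seq (optMin_runs _ _) ?_))
      rintro o' s' ⟨rfl, r, rfl, hrq, hrb, hr⟩
      have hβ' : 0 < -β i := by linarith
      have hq : st.x (st.frac.get i) / (-β i) * (-β i) = st.x (st.frac.get i) :=
        div_mul_cancel₀ _ hβ'.ne'
      refine (second (some r) ?_ (d + 4) le_rfl).mono ?_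
      · refine hinv.optMin hrq hrb hr (div_pos hxi hβ') (fun j hj => ?_)
          (fun j hj => Or.inl hj) ⟨i, Or.inl ⟨hβ, hq⟩⟩
        rcases List.mem_append.mp hj with hj | hj
        · exact Or.inl hj
        · obtain rfl := List.mem_singleton.mp hj
          exact Or.inr hq.le
      · rintro o'' s ⟨hs, ho⟩
        exact ⟨by omega, ho⟩
    · simp only [hβ, decide_false, Bool.false_eq_true, if_false]
      refine Runs.pure_bind ((second o ?_ 1 (by omega)).mono ?_)
      · refine hinv.skip (fun j hj => ?_) fun j hj => Or.inl hj
        rcases List.mem_append.mp hj with hj | hj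
        · exact Or.inl hj
        · obtain rfl := List.mem_singleton.mp hj
          exact Or.inr (not_lt.mp hβ)
      · rintro o'' s ⟨hs, ho⟩
        exact ⟨by omega, ho⟩
  · rintro o s ⟨hs, ho⟩
    rw [List.length_finRange] at hs
    exact ⟨hs, ho.skip (fun i _ => Or.inl (by simp)) fun i _ => Or.inl (by simp)⟩

/-- An upper bound for the number of steps of `cancel` with `r` fractional variables. -/
def cancelTime (d n r : ℕ) : ℕ :=
  (r * (3 * d + 7) + 1) + 1 + (r + 1) + (r * (3 * d + 3 * r + 13) + 1) +
    (r * (d + 3 + shiftTime d n) + 1) + tidyTime d r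

theorem cancel_runs {I : Input d n} {L : SignVec d → List (Move d n)}
    {pos : Item d n × Finset (Fin d) × Finset (Fin d) → ℕ} (hL : MoveIndex I L pos)
    {st : Memory d n} (h : Valid I L pos st) {β : Fin st.frac.length → ℚ}
    (hβ : ∑ i, β i • fracVec st i = 0) (hne : ∃ i, β i ≠ 0) :
    Runs (cancel I st st.frac β) fun st' s => s ≤ cancelTime d n st.frac.length ∧
      Valid I L pos st' ∧ I.extTotal st'.x ≤ I.extTotal st.x ∧
      st'.frac.length < st.frac.length := by
  unfold cancel
  refine Runs.seq (growCost_runs h β) ?_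
  rintro total s ⟨hs, rfl⟩
  refine Runs.charge_bind ?_
  extract_lets jp
  have fin : ∀ β' : Fin st.frac.length → ℚ, ∑ i, β' i • fracVec st i = 0 → (∃ i, β' i ≠ 0) →
      growCost I st β' ≤ 0 → Runs (jp β') fun st' s' =>
        s' ≤ (st.frac.length * (3 * d + 3 * st.frac.length + 13) + 1) +
          (st.frac.length * (d + 3 + shiftTime d n) + 1) + tidyTime d st.frac.length ∧
        Valid I L pos st' ∧ I.extTotal st'.x ≤ I.extTotal st.x ∧
        st'.frac.length < st.frac.length := by
    intro β' hβ' hne' hcost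
    refine Runs.seq (growBound_runs h β') ?_
    rintro o s₁ ⟨hs₁, hb⟩
    match o, hb with
    | none, hb =>
      exfalso
      -- without negative coefficients, an item with a positive one loses mass at its home
      have hnn : ∀ i, 0 ≤ β' i := fun i => hb.neg_none rfl i trivial
      obtain ⟨i, hi⟩ := hne'
      have hi' : 0 < β' i := lt_of_le_of_ne (hnn i) hi.symm
      have h1 := hb.net_none rfl i trivial
      have h2 : β' i ≤ netLoss st β' (st.frac.get i).1 := by
        have := Finset.single_le_sum
          (f := fun j => if (st.frac.get j).1 = (st.frac.get i).1 then β' j else 0)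
          (fun j _ => by split_ifs; exacts [hnn j, le_rfl]) (Finset.mem_univ i)
        simpa [netLoss] using this
      linarith
    | some a, hb =>
      have ha := hb.pos a rfl
      obtain ⟨hfeas, hsub, q₀, hq₀, hq₀'⟩ := h.grow hβ' ha
        (fun i => hb.neg_some a rfl i trivial) (fun i => hb.net_some a rfl i trivial)
        (hb.tight a rfl)
      refine Runs.seq (shifts_runs (List.finRange st.frac.length) (fracTransfer st β' a) _
        (d + 2 + shiftTime d n) h.synced fun i _ st' hst' hhome _ => ?_) ?_
      · refine Runs.charge_bind (Runs.charge_bind ((shift_runs hL hst' _ _ _ _).mono ?_))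
        rintro st'' s' ⟨hs', hst'', hx, hh, hf⟩
        refine ⟨by omega, hst'', fun q => ?_, hh, hf⟩
        rw [hx, hhome]
        rfl
      rintro st₁ s₂ ⟨hs₂, hsync, hx, hhome, -⟩
      rw [List.length_finRange] at hs₂
      have hx' : st₁.x = grow st β' a := hx
      have hcover : ∀ q, st₁.x q ≠ 0 → q.2 = st₁.home q.1 ∨ q ∈ st.frac := by
        intro q hq
        rw [hhome]
        rw [hx'] at hq
        exact h.tidy.cover q (hsub q hq)
      refine (tidy_runs st.frac hcover).mono ?_
      rintro st₂ s₃ ⟨hs₃, htidy, hx₂, hm₂, hp₂, -⟩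
      have hfeas₂ : ExtFeasible I st₂.x := by
        rw [hx₂, hx']
        exact hfeas
      refine ⟨?_, ⟨⟨hp₂.trans hsync.pos, fun v => ?_⟩, hfeas₂, htidy⟩, ?_, ?_⟩
      · have : d + 2 + shiftTime d n + 1 = d + 3 + shiftTime d n := by ring
        rw [this] at hs₂
        omega
      · rw [hm₂, hx₂]
        exact hsync.moves v
      · rw [hx₂, hx', extTotal_grow]
        have := mul_nonneg ha.le (neg_nonneg.mpr hcost)
        linarith
      · have h1 := h.tidy.card_support h.feasible
        have h2 := htidy.card_support hfeas₂
        have h3 : (Finset.univ.filter fun q => st₂.x q ≠ 0).card <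
            (Finset.univ.filter fun q => st.x q ≠ 0).card := by
          refine Finset.card_lt_card (Finset.ssubset_iff_of_subset ?_ |>.mpr ⟨q₀, ?_, ?_⟩)
          · intro q
            simp only [Finset.mem_filter, Finset.mem_univ, true_and, hx₂, hx']
            exact hsub q
          · simpa using hq₀
          · simp [hx₂, hx', hq₀']
        omega
  by_cases hpos : 0 < growCost I st β
  · simp only [hpos, decide_true, if_true]
    refine Runs.charge_bind ((fin (fun i => -1 * β i) ?_ ?_ ?_).mono ?_)
    · simp only [neg_mul, one_mul, neg_smul, Finset.sum_neg_distrib, hβ, neg_zero]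
    · obtain ⟨i, hi⟩ := hne
      exact ⟨i, by simpa using hi⟩
    · have : growCost I st (fun i => -1 * β i) = - growCost I st β := by
        simp [growCost, Finset.sum_neg_distrib]
      rw [this]
      linarith
    · rintro st' s' ⟨hs', h'⟩
      refine ⟨?_, h'⟩
      unfold cancelTime
      omega
  · simp only [hpos, decide_false, Bool.false_eq_true, if_false]
    refine Runs.charge_bind ((fin β hβ hne (not_lt.mp hpos)).mono ?_)
    rintro st' s' ⟨hs', h'⟩
    refine ⟨?_, h'⟩
    unfold cancelTime
    omega

theorem cancelTime_mono {r r' : ℕ} (h : r ≤ r') (d n : ℕ) :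
    cancelTime d n r ≤ cancelTime d n r' := by
  unfold cancelTime tidyTime
  gcongr

/-- An upper bound for the number of steps of `restore` with `r` fractional variables at the
start. -/
def restoreTime (d n r : ℕ) : ℕ :=
  (r + 1) * (2 * (d + 1) * (r + 1) + depTime d r + cancelTime d n r + 1)

/-- Every pass shortens the list of fractional variables, and the last one finds independent
vectors. -/
theorem restore_runs {I : Input d n} {L : SignVec d → List (Move d n)}
    {pos : Item d n × Finset (Fin d) × Finset (Fin d) → ℕ} (hL : MoveIndex I L pos)
    {st : Memory d n} (h : Valid I L pos st) :
    Runs (restore I st) fun st' s => s ≤ restoreTime d n st.frac.length ∧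
      Valid I L pos st' ∧ I.extTotal st'.x ≤ I.extTotal st.x ∧
      LinearIndependent ℚ (fracVec st') := by
  refine (Runs.loop (2 * (d + 1) * (st.frac.length + 1) + depTime d st.frac.length +
      cancelTime d n st.frac.length)
    (fun k (st' : Memory d n) => Valid I L pos st' ∧ I.extTotal st'.x ≤ I.extTotal st.x ∧
      st'.frac.length = k ∧ k ≤ st.frac.length)
    (fun st' => Valid I L pos st' ∧ I.extTotal st'.x ≤ I.extTotal st.x ∧
      LinearIndependent ℚ (fracVec st')) ?_ st.frac.length st ⟨h, le_rfl, rfl, le_rfl⟩).mono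
    fun st' s hs => hs
  rintro k st' ⟨hv, hc, rfl, hk⟩
  have e1 : 2 * (d + 1) * (st'.frac.length + 1) ≤ 2 * (d + 1) * (st.frac.length + 1) :=
    Nat.mul_le_mul_left _ (by omega)
  have e2 : depTime d st'.frac.length ≤ depTime d st.frac.length := by
    unfold depTime
    gcongr
  have e3 := cancelTime_mono hk d n
  refine Runs.charge_bind (Runs.seq (dependency_runs _) ?_)
  rintro o s ⟨hs, hnone, hsome⟩
  match o, hnone, hsome with
  | none, hnone, _ => exact Runs.pure ⟨by omega, hv, hc, hnone rfl⟩
  | some β, _, hsome =>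
    obtain ⟨hrel, j, hj, -⟩ := hsome β rfl
    refine Runs.seq (cancel_runs hL hv hrel ⟨j, by rw [hj]; exact one_ne_zero⟩) ?_
    rintro st'' s' ⟨hs', hv', hc', hlt⟩
    exact Runs.pure ⟨by omega, st''.frac.length, hlt, hv', hc'.trans hc, rfl, by omega⟩

end Restore

/-! ### Finding an augmentation -/

section Augment

variable {d n : ℕ}

/-- The cost of an augmentation of magnitude `1`. -/
def unitCost (A : Augmentation d n) : ℚ := (A.map fun t => t.2 * t.1.cost).sum

/-- The moves of `A` form an augmentation, and each of them is possible with magnitude `a`, when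
it is considered separately. -/
structure Applicable (I : Input d n) (st : Memory d n) (A : Augmentation d n) (a : ℚ) : Prop where
  length_le : A.length ≤ d + 1
  ne_nil : A ≠ []
  pos : 0 < a
  move : ∀ t ∈ A, IsMove I t.1
  coef_pos : ∀ t ∈ A, 0 < t.2
  mass : ∀ t ∈ A, a * t.2 ≤ st.x (t.1.item, t.1.src)
  rel : (A.map fun t => t.2 • (netChange t.1.src t.1.dst).toRat).sum = 0

/-- A choice of moves for the vectors of a profile that are possible with magnitude `a`. -/
def GoodChoice (I : Input d n) (st : Memory d n) (V : List (SignVec d × ℚ)) (a : ℚ)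
    (mv : SignVec d → Move d n) : Prop :=
  ∀ t ∈ V, IsMove I (mv t.1) ∧ netChange (mv t.1).src (mv t.1).dst = t.1 ∧
    a * t.2 ≤ st.x ((mv t.1).item, (mv t.1).src)

/-- The search tree yields a cheapest move with enough mass. -/
theorem query_treeEntry_runs {I : Input d n} {L : SignVec d → List (Move d n)}
    {pos : Item d n × Finset (Fin d) × Finset (Fin d) → ℕ} (hL : MoveIndex I L pos)
    (x : Item d n × Finset (Fin d) → ℚ) (v : SignVec d) {y : ℚ} (hy : 0 < y) :
    Runs (Tree.query y (treeEntry (L v) x).2) fun o s => s ≤ 2 * treeDepth d n + 1 ∧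
      (o = none → ∀ m, IsMove I m → netChange m.src m.dst = v → x (m.item, m.src) < y) ∧
      ∀ m, o = some m → IsMove I m ∧ netChange m.src m.dst = v ∧ y ≤ x (m.item, m.src) ∧
        ∀ m', IsMove I m' → netChange m'.src m'.dst = v → y ≤ x (m'.item, m'.src) →
          m.cost ≤ m'.cost := by
  have hdepth := hL.depth_le v
  have hindex : ∀ m, IsMove I m → netChange m.src m.dst = v →
      ∃ i < 2 ^ Nat.clog 2 (L v).length, (L v)[i]? = some m := by
    intro m hm hv
    obtain ⟨i, hi⟩ := List.mem_iff_getElem?.mp ((hL.mem v m).mpr ⟨hm, hv⟩)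
    exact ⟨i, (List.getElem?_eq_some_iff.mp hi).1.trans_le (Nat.le_pow_clog (by norm_num) _), hi⟩
  refine (Tree.query_runs hy (Nat.clog 2 (L v).length) (leaves (L v) x)).mono ?_
  rintro o s ⟨hs, hnone, hsome⟩
  refine ⟨by omega, fun ho m hm hv => ?_, fun m ho => ?_⟩
  · obtain ⟨i, hi, hLi⟩ := hindex m hm hv
    exact hnone ho i hi m _ (by rw [leaves, hLi]; rfl)
  · obtain ⟨i, hi, y', hf, hyy, hmin⟩ := hsome m ho
    rw [leaves, Option.map_eq_some_iff] at hf
    obtain ⟨m₁, hLi, he⟩ := hf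
    obtain ⟨rfl, rfl⟩ := Prod.mk.inj he
    obtain ⟨h1, h2⟩ := (hL.mem v m₁).mp (List.mem_of_getElem? hLi)
    refine ⟨h1, h2, hyy, fun m' hm' hv' hy' => ?_⟩
    obtain ⟨j, -, hLj⟩ := hindex m' hm' hv'
    rcases lt_trichotomy j i with hji | hji | hji
    · exact absurd hy' (not_le.mpr (hmin j hji m' _ (by rw [leaves, hLj]; rfl)))
    · subst hji
      rw [hLi] at hLj
      rw [Option.some.inj hLj]
    · obtain ⟨hi', e1⟩ := List.getElem?_eq_some_iff.mp hLi
      obtain ⟨hj', e2⟩ := List.getElem?_eq_some_iff.mp hLj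
      have := List.pairwise_iff_getElem.mp (hL.sorted v) i j hi' hj' hji
      rwa [e1, e2] at this

/-- An upper bound for the number of steps of `matchProfile`. -/
def matchTime (d n : ℕ) : ℕ := (d + 1) * (d + 2 * treeDepth d n + 7) + 1

theorem matchProfile_runs {I : Input d n} {L : SignVec d → List (Move d n)}
    {pos : Item d n × Finset (Fin d) × Finset (Fin d) → ℕ} (hL : MoveIndex I L pos)
    {st : Memory d n} (hst : Synced L pos st) {V : Profile d} (hlen : V.length ≤ d + 1)
    (hpos : ∀ t ∈ V, 0 < t.2) {a : ℚ} (ha : 0 < a) :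
    Runs (matchProfile st V a) fun o s => s ≤ matchTime d n ∧
      (o = none → ∀ mv, ¬ GoodChoice I st V a mv) ∧
      ∀ A c, o = some (A, c) →
        A.map (fun t => (netChange t.1.src t.1.dst, t.2)) = V.reverse ∧
        (∀ t ∈ A, IsMove I t.1 ∧ a * t.2 ≤ st.x (t.1.item, t.1.src)) ∧ c = a * unitCost A ∧
        ∀ mv, GoodChoice I st V a mv → c ≤ a * (V.map fun t => t.2 * (mv t.1).cost).sum := by
  refine (Runs.each (d + 2 * treeDepth d n + 6)
    (fun (done : List (SignVec d × ℚ)) (o : Option (Augmentation d n × ℚ)) =>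
      (o = none → ∀ mv, ¬ GoodChoice I st done a mv) ∧
      ∀ A c, o = some (A, c) →
        A.map (fun t => (netChange t.1.src t.1.dst, t.2)) = done.reverse ∧
        (∀ t ∈ A, IsMove I t.1 ∧ a * t.2 ≤ st.x (t.1.item, t.1.src)) ∧ c = a * unitCost A ∧
        ∀ mv, GoodChoice I st done a mv → c ≤ a * (done.map fun t => t.2 * (mv t.1).cost).sum)
    ?_ ?_).mono ?_
  · refine ⟨by simp, fun A c h => ?_⟩
    obtain ⟨rfl, rfl⟩ : [] = A ∧ 0 = c := by simpa using h
    simp [unitCost]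
  · rintro done ⟨v, α⟩ rest o hV ⟨h1, h2⟩
    have hα : 0 < α := hpos (v, α) (by simp [hV])
    have hsub : ∀ mv, GoodChoice I st (done ++ [(v, α)]) a mv → GoodChoice I st done a mv :=
      fun mv hmv t ht => hmv t (by simp [ht])
    match o, h1, h2 with
    | none, h1, _ =>
      exact Runs.pure ⟨by omega, fun _ mv hmv => h1 rfl mv (hsub mv hmv), by simp⟩
    | some (A, c), _, h2 =>
      obtain ⟨hA, hmove, hc, hmin⟩ := h2 A c rfl
      refine Runs.charge_bind (Runs.charge_bind ?_)
      rw [hst.moves v]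
      refine Runs.seq (query_treeEntry_runs hL st.x v (mul_pos ha hα)) ?_
      rintro o s ⟨hs, hnone, hsome⟩
      match o, hnone, hsome with
      | none, hnone, _ =>
        refine Runs.pure ⟨by omega, fun _ mv hmv => ?_, by simp⟩
        obtain ⟨h3, h4, h5⟩ := hmv (v, α) (by simp)
        exact absurd h5 (not_le.mpr (hnone rfl _ h3 h4))
      | some m, _, hsome =>
        obtain ⟨h3, h4, h5, h6⟩ := hsome m rfl
        refine Runs.charge_bind (Runs.charge_bind (Runs.charge ⟨by omega, by simp, ?_⟩))
        intro A' c' he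
        obtain ⟨rfl, rfl⟩ : (m, α) :: A = A' ∧ c + m.cost * (a * α) = c' := by simpa using he
        refine ⟨by simp [hA, h4], ?_, ?_, fun mv hmv => ?_⟩
        · rintro t ht
          rcases List.mem_cons.mp ht with rfl | ht
          · exact ⟨h3, h5⟩
          · exact hmove t ht
        · rw [hc, unitCost, unitCost, List.map_cons, List.sum_cons]
          ring
        · obtain ⟨h7, h8, h9⟩ := hmv (v, α) (by simp)
          have h10 := hmin mv (hsub mv hmv)
          have h11 := mul_le_mul_of_nonneg_right (h6 _ h7 h8 h9) (mul_pos ha hα).le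
          rw [List.map_append, List.sum_append, mul_add]
          simp only [List.map_cons, List.map_nil, List.sum_cons, List.sum_nil, add_zero]
          linarith
  · rintro o s ⟨hs, h⟩
    refine ⟨hs.trans ?_, h⟩
    unfold matchTime
    have := Nat.mul_le_mul_right (d + 2 * treeDepth d n + 7) hlen
    have e : d + 2 * treeDepth d n + 6 + 1 = d + 2 * treeDepth d n + 7 := rfl
    rw [e]
    omega

/-- The best augmentation so far, where `-best.1` is its estimated gain, and `Seen V a` says that
the profile `V` has been tried with the magnitude `a`. -/
structure BestSoFar (I : Input d n) (st : Memory d n) (Seen : Profile d → ℚ → Prop)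
    (best : ℚ × Option (Augmentation d n)) : Prop where
  nonpos : best.1 ≤ 0
  none_eq : best.2 = none → best.1 = 0
  some_eq : ∀ A, best.2 = some A → best.1 < 0 ∧ ∃ a, Applicable I st A a ∧
    best.1 = a * unitCost A
  le : ∀ V a, Seen V a → ∀ mv, GoodChoice I st V a mv →
    best.1 ≤ a * (V.map fun t => t.2 * (mv t.1).cost).sum

/-- An upper bound for the number of steps of `findAugmentation` with `N` profiles and `J`
magnitudes. -/
def findTime (d n N J : ℕ) : ℕ := 1 + (N * ((J + 1) * (matchTime d n + 4) + 1) + 1)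

/-- The gain `B` of the augmentation found is the largest one over all profiles, all tested
magnitudes and all choices of moves. -/
theorem findAugmentation_runs {I : Input d n} {L : SignVec d → List (Move d n)}
    {pos : Item d n × Finset (Fin d) × Finset (Fin d) → ℕ} (hL : MoveIndex I L pos)
    {st : Memory d n} (hst : Synced L pos st) {P : List (Profile d)}
    (hP : ∀ V ∈ P, NormalizedProfile V) {aMax aMin : ℚ} {J : ℕ} (hmin : 0 < aMin)
    (hmax : aMax = aMin * 2 ^ J) :
    Runs (findAugmentation P aMax aMin st) fun o s => s ≤ findTime d n P.length J ∧
      ∃ B : ℚ, 0 ≤ B ∧ (∀ V ∈ P, ∀ j < J, ∀ mv, GoodChoice I st V (aMin * 2 ^ j) mv →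
        -B ≤ aMin * 2 ^ j * (V.map fun t => t.2 * (mv t.1).cost).sum) ∧
      (o = none → B = 0) ∧
      ∀ A, o = some A → 0 < B ∧ ∃ a, Applicable I st A a ∧ -B = a * unitCost A := by
  refine Runs.charge_bind (Runs.seq (Runs.each ((J + 1) * (matchTime d n + 4))
    (fun (done : List (Profile d)) (best : ℚ × Option (Augmentation d n)) =>
      BestSoFar I st (fun V a => V ∈ done ∧ ∃ j < J, a = aMin * 2 ^ j) best)
    ⟨le_rfl, fun _ => rfl, by simp, by simp⟩ ?_) ?_)
  · rintro done V rest best hl hbest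
    have hV : NormalizedProfile V := hP V (by simp [hl])
    have hlen := hV.length_le
    refine (Runs.loop (matchTime d n + 3)
      (fun k (ab : ℚ × ℚ × Option (Augmentation d n)) => 2 * ab.1 = aMin * 2 ^ k ∧ k ≤ J ∧
        BestSoFar I st (fun W a => (W ∈ done ∧ ∃ j < J, a = aMin * 2 ^ j) ∨
          (W = V ∧ ∃ j < J, k ≤ j ∧ a = aMin * 2 ^ j)) ab.2)
      (fun best => BestSoFar I st (fun W a => W ∈ done ++ [V] ∧ ∃ j < J, a = aMin * 2 ^ j) best)
      ?_ J _ ?_).mono fun _ _ h => h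
    · rintro k ⟨a, best⟩ ⟨hk, hkJ, hb⟩
      simp only at hk hb
      refine Runs.charge_bind ?_
      rcases Nat.eq_zero_or_pos k with rfl | hkpos
      · -- all magnitudes have been tried
        have hlt : a < aMin := by
          rw [pow_zero, mul_one] at hk
          linarith
        simp only [hlt, decide_true, if_true]
        refine Runs.pure ⟨by omega, hb.nonpos, hb.none_eq, hb.some_eq, ?_⟩
        rintro W a' ⟨hW, j, hj, rfl⟩ mv hmv
        rcases List.mem_append.mp hW with hW | hW
        · exact hb.le W _ (Or.inl ⟨hW, j, hj, rfl⟩) mv hmv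
        · exact hb.le W _ (Or.inr ⟨List.mem_singleton.mp hW, j, hj, Nat.zero_le _, rfl⟩) mv hmv
      · obtain ⟨k, rfl⟩ : ∃ i, k = i + 1 := ⟨k - 1, by omega⟩
        have hak : a = aMin * 2 ^ k := by
          rw [pow_succ] at hk
          linarith
        have h2k : (1 : ℚ) ≤ 2 ^ k := one_le_pow₀ (by norm_num)
        have hge : ¬ a < aMin := by
          rw [hak, not_lt]
          exact le_mul_of_one_le_right hmin.le h2k
        have ha : 0 < a := hmin.trans_le (not_lt.mp hge)
        have hhalf : 2 * (a / 2) = aMin * 2 ^ k := by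
          rw [← hak]
          ring
        simp only [hge, decide_false, Bool.false_eq_true, if_false]
        refine Runs.seq (matchProfile_runs hL hst hlen hV.pos ha) ?_
        rintro found s ⟨hs, hnone, hsome⟩
        refine Runs.charge_bind ?_
        match found, hnone, hsome with
        | none, hnone, _ =>
          refine Runs.pure ⟨by omega, k, by omega, hhalf, by omega, hb.nonpos, hb.none_eq,
            hb.some_eq, ?_⟩
          rintro W a' (hW | ⟨rfl, j, hj, hkj, rfl⟩) mv hmv
          · exact hb.le W _ (Or.inl hW) mv hmv
          · rcases Nat.eq_or_lt_of_le hkj with rfl | hkj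
            · exact absurd (hak ▸ hmv) (hnone rfl mv)
            · exact hb.le W _ (Or.inr ⟨rfl, j, hj, hkj, rfl⟩) mv hmv
        | some (A, current), _, hsome =>
          obtain ⟨hA, hmove, hc, hle⟩ := hsome A current rfl
          refine Runs.charge_bind ?_
          by_cases hcur : current < best.1
          · rw [if_pos (decide_eq_true hcur)]
            refine Runs.pure ⟨by omega, k, by omega, hhalf, by omega,
              (hcur.trans_le hb.nonpos).le, by simp, ?_, ?_⟩
            · rintro A' hA'
              obtain rfl : A = A' := by simpa using hA'
              have hlenA : A.length = V.length := by
                have := congrArg List.length hA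
                simpa using this
              have hmem : ∀ t ∈ A, (netChange t.1.src t.1.dst, t.2) ∈ V := by
                intro t ht
                rw [← List.mem_reverse, ← hA]
                exact List.mem_map.mpr ⟨t, ht, rfl⟩
              refine ⟨hcur.trans_le hb.nonpos, a, ⟨hlenA.trans_le hlen, ?_, ha,
                fun t ht => (hmove t ht).1, fun t ht => hV.pos _ (hmem t ht),
                fun t ht => (hmove t ht).2, ?_⟩, hc⟩
              · rintro rfl
                exact hV.ne_nil (List.length_eq_zero_iff.mp hlenA.symm)
              · have h1 : (A.map fun t => t.2 • (netChange t.1.src t.1.dst).toRat) =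
                    (A.map fun t => (netChange t.1.src t.1.dst, t.2)).map
                      fun t => t.2 • t.1.toRat := by
                  rw [List.map_map]
                  rfl
                rw [h1, hA, List.map_reverse, List.sum_reverse]
                exact hV.rel
            · rintro W a' (hW | ⟨rfl, j, hj, hkj, rfl⟩) mv hmv
              · exact hcur.le.trans (hb.le W _ (Or.inl hW) mv hmv)
              · rcases Nat.eq_or_lt_of_le hkj with rfl | hkj
                · rw [← hak] at hmv ⊢
                  exact hle mv hmv
                · exact hcur.le.trans (hb.le W _ (Or.inr ⟨rfl, j, hj, hkj, rfl⟩) mv hmv)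
          · rw [if_neg (by simpa using hcur)]
            refine Runs.pure ⟨by omega, k, by omega, hhalf, by omega, hb.nonpos, hb.none_eq,
              hb.some_eq, ?_⟩
            rintro W a' (hW | ⟨rfl, j, hj, hkj, rfl⟩) mv hmv
            · exact hb.le W _ (Or.inl hW) mv hmv
            · rcases Nat.eq_or_lt_of_le hkj with rfl | hkj
              · rw [← hak] at hmv ⊢
                exact (not_lt.mp hcur).trans (hle mv hmv)
              · exact hb.le W _ (Or.inr ⟨rfl, j, hj, hkj, rfl⟩) mv hmv
    · refine ⟨?_, le_rfl, hbest.nonpos, hbest.none_eq, hbest.some_eq, ?_⟩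
      · simp only
        rw [hmax]
        ring
      · rintro W a' (hW | ⟨rfl, j, hj, hkj, rfl⟩) mv hmv
        · exact hbest.le W _ hW mv hmv
        · omega
  · rintro ⟨b, o⟩ s ⟨hs, hb⟩
    refine Runs.pure ⟨by unfold findTime; omega, -b, by have := hb.nonpos; simp only at this; linarith,
      fun V hV j hj mv hmv => ?_, fun ho => ?_, fun A ho => ?_⟩
    · rw [neg_neg]
      exact hb.le V _ ⟨hV, j, hj, rfl⟩ mv hmv
    · have := hb.none_eq ho
      simp only at this
      rw [this, neg_zero]
    · obtain ⟨h1, a, h2, h3⟩ := hb.some_eq A ho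
      exact ⟨by simp only at h1; linarith, a, h2, by rw [neg_neg]; exact h3⟩

/-! ### Applying an augmentation -/

/-- The mass that an augmentation of magnitude `1` takes from the source of the move `m`. -/
def massUse (A : Augmentation d n) (m : Move d n) : ℚ :=
  (A.map fun t => if t.1.item = m.item ∧ t.1.src = m.src then t.2 else 0).sum

theorem massUse_runs (A : Augmentation d n) (m : Move d n) :
    Runs (each A (0 : ℚ) fun s (m', α') => do
      if ← charge (d + 1) (decide (m'.item = m.item ∧ m'.src = m.src)) then add s α' else pure s)
      fun r s => s ≤ A.length * (d + 3) + 1 ∧ r = massUse A m := by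
  refine (Runs.each (d + 2) (fun (done : List (Move d n × ℚ)) (r : ℚ) =>
    r = massUse done m) (by simp [massUse]) ?_).mono fun _ _ h => h
  rintro done ⟨m', α'⟩ rest r - hr
  have happ : massUse (done ++ [(m', α')]) m = massUse done m +
      if m'.item = m.item ∧ m'.src = m.src then α' else 0 := by
    simp [massUse]
  refine Runs.charge_bind ?_
  rw [happ]
  by_cases h : m'.item = m.item ∧ m'.src = m.src
  · rw [if_pos (decide_eq_true h), if_pos h]
    exact Runs.charge ⟨by omega, by rw [hr]⟩
  · rw [if_neg (by simpa using h), if_neg h]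
    exact Runs.pure ⟨by omega, by rw [hr, add_zero]⟩

theorem Applicable.massUse_pos {I : Input d n} {st : Memory d n} {A : Augmentation d n} {a : ℚ}
    (h : Applicable I st A a) {t : Move d n × ℚ} (ht : t ∈ A) : 0 < massUse A t.1 := by
  have h1 : t.2 ≤ massUse A t.1 := by
    refine List.single_le_sum (fun r hr => ?_) _ (List.mem_map.mpr ⟨t, ht, by simp⟩)
    obtain ⟨t', ht', rfl⟩ := List.mem_map.mp hr
    split_ifs
    · exact (h.coef_pos t' ht').le
    · exact le_rfl
  exact (h.coef_pos t ht).trans_le h1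

theorem Applicable.mul_massUse_le {I : Input d n} {st : Memory d n} {A : Augmentation d n} {a : ℚ}
    (h : Applicable I st A a) (hnn : ∀ q, 0 ≤ st.x q) (m : Move d n) :
    a * massUse A m ≤ (d + 1) * st.x (m.item, m.src) := by
  have h1 : a * massUse A m ≤ A.length • st.x (m.item, m.src) := by
    rw [massUse, ← List.sum_map_mul_left, ← List.length_map (f := fun t : Move d n × ℚ =>
      a * if t.1.item = m.item ∧ t.1.src = m.src then t.2 else 0)]
    refine List.sum_le_card_nsmul _ _ fun r hr => ?_
    obtain ⟨t, ht, rfl⟩ := List.mem_map.mp hr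
    split_ifs with he
    · rw [← he.1, ← he.2]
      exact h.mass t ht
    · rw [mul_zero]
      exact hnn _
  refine h1.trans ?_
  rw [nsmul_eq_mul]
  refine mul_le_mul_of_nonneg_right ?_ (hnn _)
  exact_mod_cast h.length_le

theorem maxMagnitude_runs {I : Input d n} {st : Memory d n} {A : Augmentation d n} {a : ℚ}
    (h : Applicable I st A a) (hnn : ∀ q, 0 ≤ st.x q) :
    Runs (maxMagnitude st A) fun o s =>
      s ≤ (d + 1) * ((d + 1) * (d + 3) + d + 5) + 1 ∧ ∃ M, o = some M ∧ a / (d + 1) ≤ M ∧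
        ∀ t ∈ A, M * massUse A t.1 ≤ st.x (t.1.item, t.1.src) := by
  have hlen := h.length_le
  have hcost : A.length * (d + 3) ≤ (d + 1) * (d + 3) := Nat.mul_le_mul_right _ hlen
  have hd : (0 : ℚ) < d + 1 := by positivity
  refine (Runs.each ((d + 1) * (d + 3) + d + 4)
    (fun (done : List (Move d n × ℚ)) (o : Option ℚ) => (o = none → done = []) ∧
      ∀ M, o = some M → a / (d + 1) ≤ M ∧
        ∀ t ∈ done, M * massUse A t.1 ≤ st.x (t.1.item, t.1.src)) (by simp) ?_).mono ?_
  · rintro done ⟨m, α⟩ rest o hA ⟨h1, h2⟩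
    have hmem : (m, α) ∈ A := by simp [hA]
    have hpos := h.massUse_pos hmem
    refine Runs.seq (massUse_runs A m) ?_
    rintro r s ⟨hs, rfl⟩
    refine Runs.charge_bind (Runs.charge_bind ((optMin_runs _ _).mono ?_))
    rintro o' s' ⟨rfl, M, rfl, hMq, hMb, hM⟩
    refine ⟨by omega, by simp, ?_⟩
    rintro M' hM'
    obtain rfl := Option.some.inj hM'
    have hq : a / (d + 1) ≤ st.x (m.item, m.src) / massUse A m := by
      rw [div_le_div_iff₀ hd hpos, mul_comm (st.x _)]
      exact h.mul_massUse_le hnn m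
    refine ⟨?_, fun t ht => ?_⟩
    · rcases hM with rfl | hM
      · exact hq
      · exact (h2 M hM).1
    · rcases List.mem_append.mp ht with ht | ht
      · cases ho : o with
        | none =>
          rw [h1 ho] at ht
          cases ht
        | some b =>
          have htA : t ∈ A := by simp [hA, ht]
          exact (mul_le_mul_of_nonneg_right (hMb b ho) (h.massUse_pos htA).le).trans
            ((h2 b ho).2 t ht)
      · obtain rfl := List.mem_singleton.mp ht
        exact (mul_le_mul_of_nonneg_right hMq hpos.le).trans (div_mul_cancel₀ _ hpos.ne').le
  · rintro o s ⟨hs, h1, h2⟩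
    refine ⟨hs.trans ?_, ?_⟩
    · have : (d + 1) * (d + 3) + d + 4 + 1 = (d + 1) * (d + 3) + d + 5 := rfl
      rw [this]
      exact Nat.add_le_add_right (Nat.mul_le_mul_right _ hlen) _
    · cases ho : o with
      | none => exact absurd (h1 ho) h.ne_nil
      | some M => exact ⟨M, rfl, h2 M ho⟩

/-- The transfer of a move of an augmentation of magnitude `M`. -/
def augTransfer (M : ℚ) (t : Move d n × ℚ) : Transfer d n :=
  ⟨t.1.item, t.1.src, t.1.dst, M * t.2⟩

/-- An upper bound for the number of steps of `applyAugmentation` with `r` fractional variables. -/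
def applyTime (d n r : ℕ) : ℕ :=
  ((d + 1) * ((d + 1) * (d + 3) + d + 5) + 1) + ((d + 1) * (shiftTime d n + 2) + 1) +
    (d + r + 2) + tidyTime d (d + 1 + r)

/-- At most `d + 1` moves share a source, so the augmentation can be applied with the fraction
`1 / (d + 1)` of a magnitude that is possible for each move separately. -/
theorem applyAugmentation_runs {I : Input d n} {L : SignVec d → List (Move d n)}
    {pos : Item d n × Finset (Fin d) × Finset (Fin d) → ℕ} (hL : MoveIndex I L pos)
    {st : Memory d n} (hv : Valid I L pos st) {A : Augmentation d n} {a : ℚ}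
    (h : Applicable I st A a) (hcost : unitCost A ≤ 0) :
    Runs (applyAugmentation I st A) fun st' s => s ≤ applyTime d n st.frac.length ∧
      Valid I L pos st' ∧ I.extTotal st'.x ≤ I.extTotal st.x + a / (d + 1) * unitCost A ∧
      st'.frac.length ≤ d + 1 + st.frac.length := by
  have hnn := hv.feasible.nonneg
  have hlen := h.length_le
  refine Runs.seq (maxMagnitude_runs h hnn) ?_
  rintro o s₁ ⟨hs₁, M, rfl, haM, hM⟩
  have hM0 : 0 < M := lt_of_lt_of_le (div_pos h.pos (by positivity)) haM
  refine Runs.seq (shifts_runs A (augTransfer M) _ (shiftTime d n + 1) hv.synced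
    fun t _ st' hst' _ _ => ?_) ?_
  · refine Runs.charge_bind ((shift_runs hL hst' _ _ _ _).mono ?_)
    rintro st'' s' ⟨hs', h1, h2, h3, h4⟩
    exact ⟨by omega, h1, h2, h3, h4⟩
  rintro st₁ s₂ ⟨hs₂, hsync, hx, hhome, hfrac⟩
  have hsub : ∀ (l : Augmentation d n) (f g : Move d n × ℚ → ℚ),
      (l.map fun t => f t - g t).sum = (l.map f).sum - (l.map g).sum := by
    intro l f g
    induction l with
    | nil => simp
    | cons t l ih =>
      simp only [List.map_cons, List.sum_cons, ih]
      ring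
  have hdelta : ∀ q, st₁.x q = st.x q +
      ((A.map fun t => if q = (t.1.item, t.1.dst) then M * t.2 else 0).sum -
        M * (A.map fun t => if q = (t.1.item, t.1.src) then t.2 else 0).sum) := by
    intro q
    rw [hx, transferAll, List.map_map, ← List.sum_map_mul_left, ← hsub]
    refine congrArg (fun r => st.x q + r) (congrArg List.sum (List.map_congr_left fun t _ => ?_))
    simp only [Function.comp_apply, augTransfer, Transfer.delta]
    rw [mul_ite, mul_zero]
    exact congrArg₂ (fun r s : ℚ => r - s) (if_congr Iff.rfl rfl rfl) (if_congr Iff.rfl rfl rfl)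
  have hin : ∀ q, 0 ≤ (A.map fun t => if q = (t.1.item, t.1.dst) then M * t.2 else 0).sum := by
    intro q
    refine List.sum_nonneg fun r hr => ?_
    obtain ⟨t, ht, rfl⟩ := List.mem_map.mp hr
    split_ifs
    · exact (mul_pos hM0 (h.coef_pos t ht)).le
    · exact le_rfl
  have hout : ∀ q, 0 ≤ (A.map fun t => if q = (t.1.item, t.1.src) then t.2 else 0).sum := by
    intro q
    refine List.sum_nonneg fun r hr => ?_
    obtain ⟨t, ht, rfl⟩ := List.mem_map.mp hr
    split_ifs
    · exact (h.coef_pos t ht).le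
    · exact le_rfl
  have hnn₁ : ∀ q, 0 ≤ st₁.x q := by
    intro q
    rw [hdelta]
    have h1 := hin q
    by_cases hex : ∃ t ∈ A, q = (t.1.item, t.1.src)
    · obtain ⟨t, ht, rfl⟩ := hex
      have h2 := hM t ht
      have h3 : (A.map fun t' => if (t.1.item, t.1.src) = (t'.1.item, t'.1.src) then t'.2
          else 0).sum = massUse A t.1 := by
        rw [massUse]
        congr 2
        funext t'
        simp only [Prod.mk.injEq]
        refine if_congr ?_ rfl rfl
        rw [eq_comm (a := t.1.item), eq_comm (a := t.1.src)]
      rw [h3]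
      linarith
    · have h3 : (A.map fun t => if q = (t.1.item, t.1.src) then t.2 else 0).sum = 0 := by
        refine List.sum_eq_zero fun r hr => ?_
        obtain ⟨t, ht, rfl⟩ := List.mem_map.mp hr
        exact if_neg fun he => hex ⟨t, ht, he⟩
      rw [h3]
      have := hnn q
      linarith
  have hfeas : ExtFeasible I st₁.x := by
    rw [hx]
    refine hv.feasible.transferAll ?_ ?_ ?_ (by rw [← hx]; exact hnn₁)
    · intro t ht
      obtain ⟨t, ht', rfl⟩ := List.mem_map.mp ht
      exact (h.move t ht').src_ne
    · intro t ht
      obtain ⟨t, ht', rfl⟩ := List.mem_map.mp ht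
      exact (h.move t ht').dst_ne
    · have := congrArg (fun v => M • v) h.rel
      simp only [smul_zero, List.smul_sum, List.map_map] at this
      rw [List.map_map, ← this]
      congr 2
      funext t
      simp [augTransfer, smul_smul]
  refine Runs.charge_bind ((tidy_runs _ fun q hq => ?_).mono ?_)
  · rw [hfrac, hhome]
    by_cases hxq : st.x q = 0
    · by_cases hex : ∃ t ∈ A, q = (t.1.item, t.1.dst)
      · obtain ⟨t, ht, rfl⟩ := hex
        exact Or.inr (List.mem_append_left _ (List.mem_map.mpr ⟨t, ht, rfl⟩))
      · have h3 : (A.map fun t => if q = (t.1.item, t.1.dst) then M * t.2 else 0).sum = 0 := by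
          refine List.sum_eq_zero fun r hr => ?_
          obtain ⟨t, ht, rfl⟩ := List.mem_map.mp hr
          exact if_neg fun he => hex ⟨t, ht, he⟩
        have h4 := hnn₁ q
        rw [hdelta, hxq, h3] at hq h4
        have h5 := mul_nonneg hM0.le (hout q)
        exact absurd (by linarith) hq
    · exact (hv.tidy.cover q hxq).imp id fun hf => List.mem_append_right _ hf
  rintro st₂ s₃ ⟨hs₃, htidy, hx₂, hm₂, hp₂, hl₂⟩
  have hcand : (A.map (fun t => (t.1.item, t.1.dst)) ++ st₁.frac).length ≤
      d + 1 + st.frac.length := by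
    rw [List.length_append, List.length_map, hfrac]
    omega
  refine ⟨?_, ⟨⟨hp₂.trans hsync.pos, fun v => ?_⟩, by rw [hx₂]; exact hfeas, htidy⟩, ?_,
    hl₂.trans hcand⟩
  · have e1 : tidyTime d (A.map (fun t => (t.1.item, t.1.dst)) ++ st₁.frac).length ≤
        tidyTime d (d + 1 + st.frac.length) := by
      unfold tidyTime
      gcongr
    have e2 : A.length * (shiftTime d n + 1 + 1) ≤ (d + 1) * (shiftTime d n + 2) :=
      Nat.mul_le_mul_right _ hlen
    rw [hfrac] at hs₃ e1 ⊢
    unfold applyTime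
    omega
  · rw [hm₂, hx₂]
    exact hsync.moves v
  · rw [hx₂, hx, extTotal_transferAll, List.map_map]
    have h1 : (A.map ((fun t : Transfer d n => t.amount * (I.finiteCost (t.item, t.dst) -
        I.finiteCost (t.item, t.src))) ∘ augTransfer M)).sum = M * unitCost A := by
      rw [unitCost, ← List.sum_map_mul_left]
      refine congrArg List.sum (List.map_congr_left fun t ht => ?_)
      simp only [Function.comp_apply, augTransfer]
      rw [(h.move t ht).cost_eq]
      ring
    rw [h1]
    have := mul_le_mul_of_nonneg_right haM (neg_nonneg.mpr hcost)
    linarith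

end Augment

/-! ### Denominators of basic assignments -/

section Basic

variable {d n : ℕ}

theorem Tidy.sum_frac {st : Memory d n} (h : Tidy st) {M : Type*} [AddCommMonoid M]
    (f : Item d n × Finset (Fin d) → M) (hf : ∀ q, q ∉ st.frac → f q = 0) :
    ∑ j : Fin st.frac.length, f (st.frac.get j) = ∑ q, f q := by
  classical
  have h1 : ∑ j : Fin st.frac.length, f (st.frac.get j) = (st.frac.map f).sum := by
    rw [← List.sum_ofFn]
    congr 1
    exact List.ofFn_getElem_eq_map st.frac f
  rw [h1, ← List.sum_toFinset _ h.nodup]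
  refine Finset.sum_subset (Finset.subset_univ _) fun q _ hq => hf q ?_
  rwa [List.mem_toFinset] at hq

theorem sum_item_mul {R : Type*} [Semiring R] (x : Item d n × Finset (Fin d) → R)
    (w : Item d n → R) : ∑ q, w q.1 * x q = ∑ p, w p * ∑ S, x (p, S) := by
  rw [Fintype.sum_prod_type]
  exact Finset.sum_congr rfl fun p _ => by rw [Finset.mul_sum]

/-- In a basic assignment the fractional variables solve a linear system whose columns are
independent sign vectors, so Cramer's rule bounds their common denominator. -/
theorem Valid.exists_denominator {I : Input d n} {L : SignVec d → List (Move d n)}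
    {pos : Item d n × Finset (Fin d) × Finset (Fin d) → ℕ} {st : Memory d n}
    (h : Valid I L pos st) (hi : LinearIndependent ℚ (fracVec st)) :
    ∃ Δ : ℕ, 0 < Δ ∧ Δ ≤ d ^ d ∧ ∀ q, (Δ : ℚ) * st.x q ∈ (Int.castRingHom ℚ).range := by
  classical
  have hsum : ∀ p, ∑ S, st.x (p, S) = I.extSize p := fun p => by
    rw [← sum_item_eq]
    exact h.feasible.assigned p
  obtain ⟨Δ, h0, hD, hz⟩ := exists_common_denominator
    (fun j => netChange (st.home (st.frac.get j).1) (st.frac.get j).2) hi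
    (fun j => st.x (st.frac.get j))
    (fun k => (I.capacity k : ℤ) - ∑ p, (if k ∈ st.home p then 1 else 0) * (I.extSize p : ℤ))
    (fun k => by
      simp only [toRat_netChange]
      rw [h.tidy.sum_frac (fun q => st.x q * ((if k ∈ q.2 then 1 else 0) -
        if k ∈ st.home q.1 then 1 else 0))]
      · have h1 := h.feasible.filled k
        have h2 := sum_item_mul st.x fun p => if k ∈ st.home p then 1 else 0
        simp only [hsum] at h2
        push_cast
        rw [← h1, ← h2, ← Finset.sum_sub_distrib]
        refine Finset.sum_congr rfl fun q _ => ?_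
        rw [mul_comm, sub_mul]
      · intro q hq
        by_cases hx : st.x q = 0
        · rw [hx, zero_mul]
        · rw [(h.tidy.cover q hx).resolve_right hq, sub_self, mul_zero])
  have hfrac : ∀ q ∈ st.frac, (Δ : ℚ) * st.x q ∈ (Int.castRingHom ℚ).range := by
    intro q hq
    obtain ⟨j, rfl⟩ := List.mem_iff_get.mp hq
    obtain ⟨z, hz⟩ := hz j
    exact ⟨z, hz.symm⟩
  have hother : ∀ q, q.2 ≠ st.home q.1 → (Δ : ℚ) * st.x q ∈ (Int.castRingHom ℚ).range := by
    intro q hq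
    by_cases hx : st.x q = 0
    · rw [hx, mul_zero]
      exact zero_mem _
    · exact hfrac q ((h.tidy.cover q hx).resolve_left hq)
  refine ⟨Δ, h0, hD, fun q => ?_⟩
  by_cases hq : q.2 = st.home q.1
  · -- the mass on `home p` is what the other placements leave of the integral size
    have h1 : st.x q = I.extSize q.1 - ∑ S ∈ Finset.univ.erase q.2, st.x (q.1, S) := by
      rw [← hsum, ← Finset.add_sum_erase _ _ (Finset.mem_univ q.2)]
      simp
    rw [h1, mul_sub, Finset.mul_sum]
    refine sub_mem ⟨Δ * I.extSize q.1, by simp⟩ (sum_mem fun S hS => hother (q.1, S) ?_)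
    rw [← hq]
    exact (Finset.mem_erase.mp hS).1
  · exact hother q hq

theorem one_div_le_of_mul_mem {Δ D : ℕ} {r : ℚ} (h0 : 0 < Δ) (hD : Δ ≤ D)
    (h : (Δ : ℚ) * r ∈ (Int.castRingHom ℚ).range) (hr : 0 < r) : 1 / (D : ℚ) ≤ r := by
  obtain ⟨z, hz⟩ := h
  have h1 : (0 : ℚ) < Δ := by exact_mod_cast h0
  have h2 : (Δ : ℚ) ≤ D := by exact_mod_cast hD
  have hz' : (z : ℚ) = Δ * r := hz
  have h3 : 0 < z := by
    have : (0 : ℚ) < z := by rw [hz']; exact mul_pos h1 hr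
    exact_mod_cast this
  have h4 : (1 : ℚ) ≤ Δ * r := by
    rw [← hz']
    exact_mod_cast h3
  rw [div_le_iff₀ (h1.trans_le h2), mul_comm]
  exact h4.trans (mul_le_mul_of_nonneg_right h2 hr.le)

theorem Valid.one_div_le_mass {I : Input d n} {L : SignVec d → List (Move d n)}
    {pos : Item d n × Finset (Fin d) × Finset (Fin d) → ℕ} {st : Memory d n}
    (h : Valid I L pos st) (hi : LinearIndependent ℚ (fracVec st))
    {q : Item d n × Finset (Fin d)} (hq : st.x q ≠ 0) : 1 / ((d ^ d : ℕ) : ℚ) ≤ st.x q := by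
  obtain ⟨Δ, h0, hD, hz⟩ := h.exists_denominator hi
  exact one_div_le_of_mul_mem h0 hD (hz q) (lt_of_le_of_ne (h.feasible.nonneg q) hq.symm)

theorem Valid.length_frac_le {st : Memory d n} (hi : LinearIndependent ℚ (fracVec st)) :
    st.frac.length ≤ d := by
  simpa using hi.fintype_card_le_finrank

theorem finiteCost_eq_natCast (I : Input d n) (q : Item d n × Finset (Fin d)) :
    ∃ c : ℕ, I.finiteCost q = c := by
  obtain ⟨b | p, S⟩ := q
  · refine ⟨0, ?_⟩
    by_cases h : S = ∅ ∨ S = {b} <;> simp [Input.finiteCost, Input.extCost, h]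
  · exact ⟨I.cost p S, rfl⟩

/-- Two basic assignments of different costs differ by at least the inverse of the product of their
denominators. -/
theorem Valid.one_div_le_sub {I : Input d n} {L : SignVec d → List (Move d n)}
    {pos : Item d n × Finset (Fin d) × Finset (Fin d) → ℕ} {st st' : Memory d n}
    (h : Valid I L pos st) (hi : LinearIndependent ℚ (fracVec st))
    (h' : Valid I L pos st') (hi' : LinearIndependent ℚ (fracVec st'))
    (hlt : I.extTotal st'.x < I.extTotal st.x) :
    1 / ((d ^ d * d ^ d : ℕ) : ℚ) ≤ I.extTotal st.x - I.extTotal st'.x := by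
  obtain ⟨Δ, h0, hD, hz⟩ := h.exists_denominator hi
  obtain ⟨Δ', h0', hD', hz'⟩ := h'.exists_denominator hi'
  have key : ∀ (c : ℕ) (x : Item d n × Finset (Fin d) → ℚ),
      (∀ q, (c : ℚ) * x q ∈ (Int.castRingHom ℚ).range) →
      (c : ℚ) * I.extTotal x ∈ (Int.castRingHom ℚ).range := by
    intro c x hx
    rw [Input.extTotal, Finset.mul_sum]
    refine sum_mem fun q _ => ?_
    obtain ⟨k, hk⟩ := finiteCost_eq_natCast I q
    rw [hk, Rat.cast_natCast, mul_left_comm]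
    exact mul_mem ⟨k, by simp⟩ (hx q)
  refine one_div_le_of_mul_mem (Nat.mul_pos h0 h0') (Nat.mul_le_mul hD hD') ?_ (sub_pos.mpr hlt)
  rw [mul_sub]
  refine sub_mem ?_ ?_
  · rw [Nat.cast_mul, mul_comm (Δ : ℚ), mul_assoc]
    exact mul_mem ⟨Δ', by simp⟩ (key _ _ hz)
  · rw [Nat.cast_mul, mul_assoc]
    exact mul_mem ⟨Δ, by simp⟩ (key _ _ hz')

end Basic

/-! ### The optimality gap of a basic assignment -/

section Gap

variable {d n : ℕ}

/-- The magnitudes `aMin * 2 ^ j` with `j < J` approximate every number between `aMin` and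
`aMin * 2 ^ J` up to a factor of `2`. -/
theorem exists_magnitude {c a : ℚ} (hca : c ≤ a) {J : ℕ} (hJ : 0 < J)
    (haJ : a ≤ c * 2 ^ J) : ∃ j < J, c * 2 ^ j ≤ a ∧ a ≤ 2 * (c * 2 ^ j) := by
  induction J with
  | zero => omega
  | succ J ih =>
    rcases Nat.eq_zero_or_pos J with rfl | hJ'
    · refine ⟨0, hJ, by simpa using hca, ?_⟩
      simp only [zero_add, pow_one] at haJ
      rw [pow_zero, mul_one]
      linarith
    · by_cases h : a ≤ c * 2 ^ J
      · obtain ⟨j, hj, h1⟩ := ih hJ' h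
        exact ⟨j, by omega, h1⟩
      · refine ⟨J, by omega, (not_le.mp h).le, ?_⟩
        rw [pow_succ] at haJ
        linarith

/-- The range from `aMin` to `aMax` contains, up to rounding, the largest magnitudes of all
augmentations of basic assignments that can lower the cost. -/
structure MagnitudeRange (I : Input d n) (aMax aMin : ℚ) (J : ℕ) : Prop where
  pos : 0 < aMin
  eq : aMax = aMin * 2 ^ J
  size_le : ∀ p, ((d ^ d : ℕ) : ℚ) * I.size p ≤ aMax
  one_le : 1 ≤ aMax
  small : ((d : ℚ) + 1) * (((d ^ d : ℕ) : ℚ) * ((d ^ d : ℕ) : ℚ)) * aMin ≤ 1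

/-- No augmentation along a profile in `P` with a tested magnitude lowers the cost by more than `B`.
Each of its moves only has to be possible when it is considered separately. -/
def GainAtMost (I : Input d n) (st : Memory d n) (P : List (Profile d)) (aMin : ℚ) (J : ℕ)
    (B : ℚ) : Prop :=
  ∀ V ∈ P, ∀ j < J, ∀ mv, GoodChoice I st V (aMin * 2 ^ j) mv →
    -B ≤ aMin * 2 ^ j * (V.map fun t => t.2 * (mv t.1).cost).sum

theorem finiteCost_inl (I : Input d n) (b : Fin d) (S : Finset (Fin d)) :
    I.finiteCost (.inl b, S) = 0 := by
  by_cases h : S = ∅ ∨ S = {b} <;> simp [Input.finiteCost, Input.extCost, h]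

theorem list_exists_min {α : Type*} (l : List α) (hl : l ≠ []) (f : α → ℚ) :
    ∃ a ∈ l, ∀ b ∈ l, f a ≤ f b := by
  induction l with
  | nil => exact absurd rfl hl
  | cons a l ih =>
    rcases eq_or_ne l [] with rfl | hne
    · exact ⟨a, by simp, by simp⟩
    · obtain ⟨b, hb, hmin⟩ := ih hne
      rcases le_total (f a) (f b) with h | h
      · refine ⟨a, by simp, fun c hc => ?_⟩
        rcases List.mem_cons.mp hc with rfl | hc
        · exact le_rfl
        · exact h.trans (hmin c hc)
      · refine ⟨b, by simp [hb], fun c hc => ?_⟩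
        rcases List.mem_cons.mp hc with rfl | hc
        · exact h
        · exact hmin c hc

/-- If no augmentation gains more than `B`, then the moves of a profile become nonnegative in total
after a penalty of `2 * B / x(p, S)` per unit of mass.  The factor `2` is lost to the rounding of
magnitudes; augmentations with magnitudes beyond the tested range use extra items only and have
cost `0`. -/
theorem GainAtMost.sum_nonneg {I : Input d n} {L : SignVec d → List (Move d n)}
    {pos : Item d n × Finset (Fin d) × Finset (Fin d) → ℕ} {st : Memory d n}
    (hv : Valid I L pos st) (hi : LinearIndependent ℚ (fracVec st)) {P : List (Profile d)}
    {aMax aMin : ℚ} {J : ℕ} (hr : MagnitudeRange I aMax aMin J) {B : ℚ} (hB0 : 0 ≤ B)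
    (hB : GainAtMost I st P aMin J B) {V : Profile d} (hVP : V ∈ P) (hV : NormalizedProfile V)
    {mv : SignVec d → Move d n} (hmv : ∀ t ∈ V, IsMove I (mv t.1) ∧
      netChange (mv t.1).src (mv t.1).dst = t.1 ∧ st.x ((mv t.1).item, (mv t.1).src) ≠ 0) :
    0 ≤ (V.map fun t => t.2 *
      ((mv t.1).cost + 2 * B / st.x ((mv t.1).item, (mv t.1).src))).sum := by
  set y : SignVec d × ℚ → ℚ := fun t => st.x ((mv t.1).item, (mv t.1).src) with hy
  have hD : (1 : ℚ) ≤ ((d ^ d : ℕ) : ℚ) := by exact_mod_cast one_le_self_pow_self d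
  have hD0 : (0 : ℚ) < ((d ^ d : ℕ) : ℚ) := by linarith
  have hypos : ∀ t ∈ V, 0 < y t := fun t ht =>
    lt_of_le_of_ne (hv.feasible.nonneg _) (hmv t ht).2.2.symm
  have hpen : ∀ t ∈ V, 0 ≤ t.2 * (2 * B / y t) := fun t ht =>
    mul_nonneg (hV.pos t ht).le (div_nonneg (by linarith) (hypos t ht).le)
  have hfree : (∀ t ∈ V, (mv t.1).cost = 0) →
      0 ≤ (V.map fun t => t.2 * ((mv t.1).cost + 2 * B / y t)).sum := by
    intro h
    refine List.sum_nonneg fun r hr => ?_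
    obtain ⟨t, ht, rfl⟩ := List.mem_map.mp hr
    rw [h t ht, zero_add]
    exact hpen t ht
  rcases Nat.eq_zero_or_pos d with rfl | hd
  · refine hfree fun t ht => ?_
    rw [(hmv t ht).1.cost_eq, Subsingleton.elim (mv t.1).src (mv t.1).dst, sub_self]
  have hd1 : (1 : ℚ) ≤ d := by exact_mod_cast hd
  have hJ : 0 < J := by
    rcases Nat.eq_zero_or_pos J with rfl | h
    · exfalso
      have h1 := hr.one_le
      have h2 := hr.small
      rw [hr.eq, pow_zero, mul_one] at h1
      have h3 : (1 : ℚ) ≤ ((d ^ d : ℕ) : ℚ) * ((d ^ d : ℕ) : ℚ) := one_le_mul_of_one_le_of_one_le hD hD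
      nlinarith [mul_le_mul h3 h1 zero_le_one (by positivity)]
    · exact h
  obtain ⟨t₀, ht₀, hmin⟩ := list_exists_min V hV.ne_nil fun t => y t / t.2
  set a := y t₀ / t₀.2 with ha
  have hapos : 0 < a := div_pos (hypos t₀ ht₀) (hV.pos t₀ ht₀)
  have hfit : ∀ t ∈ V, a * t.2 ≤ y t := fun t ht => (le_div_iff₀ (hV.pos t ht)).mp (hmin t ht)
  rcases le_or_gt a aMax with hle | hgt
  · -- compare with a tested magnitude within a factor of `2` of the largest possible one
    have hlow : aMin ≤ a := by
      have h1 := hv.one_div_le_mass hi (hmv t₀ ht₀).2.2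
      have h2 := (hV.bounds ht₀).2
      have h3 := hr.small
      rw [div_le_iff₀ hD0] at h1
      rw [ha, le_div_iff₀ (hV.pos t₀ ht₀)]
      have h4 : aMin * t₀.2 ≤ aMin * ((d ^ d : ℕ) : ℚ) :=
        mul_le_mul_of_nonneg_left (by exact_mod_cast h2) hr.pos.le
      have h5 : (((d ^ d : ℕ) : ℚ) * ((d ^ d : ℕ) : ℚ)) * aMin ≤ 1 := by
        have := mul_nonneg (mul_nonneg (by linarith : (0 : ℚ) ≤ d)
          (mul_nonneg hD0.le hD0.le)) hr.pos.le
        linarith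
      have h6 : ((d ^ d : ℕ) : ℚ) * (aMin * ((d ^ d : ℕ) : ℚ)) ≤
          ((d ^ d : ℕ) : ℚ) * y t₀ := by
        have : ((d ^ d : ℕ) : ℚ) * (aMin * ((d ^ d : ℕ) : ℚ)) =
          ((d ^ d : ℕ) : ℚ) * ((d ^ d : ℕ) : ℚ) * aMin := by ring
        rw [this]
        refine h5.trans ?_
        rw [mul_comm]
        exact h1
      exact h4.trans (le_of_mul_le_mul_left h6 hD0)
    obtain ⟨j, hj, hja, haj⟩ := exists_magnitude hlow hJ (hle.trans hr.eq.le)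
    have hpj : 0 < aMin * 2 ^ j := mul_pos hr.pos (by positivity)
    have h1 := hB V hVP j hj mv fun t ht => ⟨(hmv t ht).1, (hmv t ht).2.1,
      (mul_le_mul_of_nonneg_right hja (hV.pos t ht).le).trans (hfit t ht)⟩
    have h2 : -(2 * B / a) ≤ (V.map fun t => t.2 * (mv t.1).cost).sum := by
      rw [neg_le_iff_add_nonneg, ← mul_nonneg_iff_of_pos_left hpj, mul_add]
      have h3 : B ≤ aMin * 2 ^ j * (2 * B / a) := by
        rw [mul_div_assoc', le_div_iff₀ hapos]
        have := mul_le_mul_of_nonneg_left haj hB0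
        linarith
      linarith
    have h3 : 2 * B / a ≤ (V.map fun t => t.2 * (2 * B / y t)).sum := by
      have h4 : 2 * B / a = t₀.2 * (2 * B / y t₀) := by
        have h5 := (hypos t₀ ht₀).ne'
        have h6 := (hV.pos t₀ ht₀).ne'
        rw [ha]
        field_simp
      rw [h4]
      refine List.single_le_sum (fun r hr => ?_) _ (List.mem_map.mpr ⟨t₀, ht₀, rfl⟩)
      obtain ⟨t, ht, rfl⟩ := List.mem_map.mp hr
      exact hpen t ht
    have h4 : (V.map fun t => t.2 * ((mv t.1).cost + 2 * B / y t)).sum =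
        (V.map fun t => t.2 * (mv t.1).cost).sum + (V.map fun t => t.2 * (2 * B / y t)).sum := by
      rw [← List.sum_map_add]
      simp only [mul_add]
    rw [h4]
    linarith
  · refine hfree fun t ht => ?_
    have h1 := hfit t ht
    have h2 := (hV.bounds ht).1
    have hfeas := hv.feasible
    rw [(hmv t ht).1.cost_eq]
    rcases hm : mv t.1 with ⟨p, S, T, c⟩
    cases p with
    | inl b => simp [finiteCost_inl]
    | inr p =>
      exfalso
      have h3 : y t ≤ I.size p := by
        have h4 := hfeas.assigned (.inr p)
        rw [sum_item_eq] at h4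
        have h5 := Finset.single_le_sum (f := fun S => st.x (Sum.inr p, S))
          (fun S _ => hfeas.nonneg _) (Finset.mem_univ S)
        rw [h4] at h5
        simpa [hy, hm, Input.extSize] using h5
      have h4 := hr.size_le p
      have h5 : a * (1 / (d ^ d : ℚ)) ≤ I.size p :=
        (mul_le_mul_of_nonneg_left h2 hapos.le).trans (h1.trans h3)
      rw [← Nat.cast_pow, mul_one_div, div_le_iff₀ hD0] at h5
      linarith

/-- The mass of the item `p` that is moved from `S` to `T` when the assignment `x` is transformed
into the assignment `y` by spreading the mass of every placement proportionally. -/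
noncomputable def coupling (I : Input d n) (x y : Item d n × Finset (Fin d) → ℝ)
    (m : Item d n × Finset (Fin d) × Finset (Fin d)) : ℝ :=
  x (m.1, m.2.1) * y (m.1, m.2.2) / I.extSize m.1

theorem sum_coupling_dst {I : Input d n} {x y : Item d n × Finset (Fin d) → ℝ}
    (hx : ExtFeasible I x) (hy : ExtFeasible I y) (w : Item d n × Finset (Fin d) → ℝ) :
    ∑ m, coupling I x y m * w (m.1, m.2.2) = ∑ q, w q * y q := by
  rw [Fintype.sum_prod_type, Fintype.sum_prod_type]
  refine Finset.sum_congr rfl fun p _ => ?_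
  rw [Fintype.sum_prod_type, Finset.sum_comm]
  refine Finset.sum_congr rfl fun T _ => ?_
  simp only [coupling]
  have h1 := hx.assigned p
  rw [sum_item_eq] at h1
  have h2 : ∑ S, x (p, S) * y (p, T) / (I.extSize p : ℝ) * w (p, T) =
      (∑ S, x (p, S)) * (y (p, T) / (I.extSize p : ℝ) * w (p, T)) := by
    rw [Finset.sum_mul]
    exact Finset.sum_congr rfl fun S _ => by ring
  rw [h2, h1]
  by_cases h0 : I.extSize p = 0
  · have h3 : y (p, T) = 0 := by
      by_contra h
      exact (hy.exists_ne_zero_iff p).mp ⟨T, h⟩ h0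
    simp [h3]
  · have : (I.extSize p : ℝ) ≠ 0 := by exact_mod_cast h0
    field_simp

theorem sum_coupling_src {I : Input d n} {x y : Item d n × Finset (Fin d) → ℝ}
    (hx : ExtFeasible I x) (hy : ExtFeasible I y) (w : Item d n × Finset (Fin d) → ℝ) :
    ∑ m, coupling I x y m * w (m.1, m.2.1) = ∑ q, w q * x q := by
  rw [← sum_coupling_dst hy hx w]
  refine Fintype.sum_equiv ((Equiv.refl _).prodCongr (Equiv.prodComm _ _)) _ _ ?_
  rintro ⟨p, S, T⟩
  simp [coupling, mul_comm (x (p, S))]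

/-- If no augmentation gains more than `B`, then the assignment costs at most `2 * B * s` more than
any other one, where `s` is the size of its support: its difference to the other assignment is a
combination of augmentations. -/
theorem GainAtMost.gap_le {I : Input d n} {L : SignVec d → List (Move d n)}
    {pos : Item d n × Finset (Fin d) × Finset (Fin d) → ℕ} {st : Memory d n}
    (hv : Valid I L pos st) (hi : LinearIndependent ℚ (fracVec st)) {P : List (Profile d)}
    (hP : ∀ V ∈ P, NormalizedProfile V) (hcomplete : ∀ W, IsProfile W → Lists P W)
    {aMax aMin : ℚ} {J : ℕ} (hr : MagnitudeRange I aMax aMin J) {B : ℚ} (hB0 : 0 ≤ B)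
    (hB : GainAtMost I st P aMin J B) {y : Item d n × Finset (Fin d) → ℝ}
    (hy : ExtFeasible I y) :
    ((I.extTotal st.x : ℚ) : ℝ) - I.extTotal y ≤ 2 * B * (n + 2 * d) := by
  classical
  have hx := hv.feasible.cast
  set x : Item d n × Finset (Fin d) → ℝ := fun q => (st.x q : ℝ) with hxdef
  set f := coupling I x y with hf
  have hf0 : ∀ m, 0 ≤ f m := fun m =>
    div_nonneg (mul_nonneg (hx.nonneg _) (hy.nonneg _)) (Nat.cast_nonneg _)
  -- the penalized cost of a move
  let ψ : Item d n × Finset (Fin d) × Finset (Fin d) → ℚ := fun m =>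
    I.finiteCost (m.1, m.2.2) - I.finiteCost (m.1, m.2.1) + 2 * B / st.x (m.1, m.2.1)
  let M : SignVec d → Finset (Item d n × Finset (Fin d) × Finset (Fin d)) := fun v =>
    Finset.univ.filter fun m => I.extCost (m.1, m.2.1) ≠ none ∧ I.extCost (m.1, m.2.2) ≠ none ∧
      st.x (m.1, m.2.1) ≠ 0 ∧ netChange m.2.1 m.2.2 = v
  let g : SignVec d → ℝ := fun v =>
    ∑ m ∈ Finset.univ.filter (fun m : Item d n × Finset (Fin d) × Finset (Fin d) =>
      netChange m.2.1 m.2.2 = v), f m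
  have hg0 : ∀ v, 0 ≤ g v := fun v => Finset.sum_nonneg fun m _ => hf0 m
  have hfM : ∀ m, f m ≠ 0 → m ∈ M (netChange m.2.1 m.2.2) := by
    intro m hm
    have h1 : x (m.1, m.2.1) ≠ 0 := fun h => hm (by simp [hf, coupling, h])
    have h2 : y (m.1, m.2.2) ≠ 0 := fun h => hm (by simp [hf, coupling, h])
    refine Finset.mem_filter.mpr ⟨Finset.mem_univ _, fun h => h1 (hx.finite _ h),
      fun h => h2 (hy.finite _ h), fun h => h1 (by simp [hxdef, h]), rfl⟩
  let W : Finset (SignVec d) := Finset.univ.filter fun v => g v ≠ 0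
  have hWM : ∀ v ∈ W, ∃ m ∈ M v, ∀ m' ∈ M v, ψ m ≤ ψ m' := by
    intro v hvW
    obtain ⟨m, hm, hfm⟩ := Finset.exists_ne_zero_of_sum_ne_zero (Finset.mem_filter.mp hvW).2
    refine Finset.exists_min_image _ _ ⟨m, ?_⟩
    rw [← (Finset.mem_filter.mp hm).2]
    exact hfM m hfm
  let φ : SignVec d → ℝ := fun v =>
    if h : ∃ m ∈ M v, ∀ m' ∈ M v, ψ m ≤ ψ m' then (ψ h.choose : ℝ) else 0
  have hφle : ∀ m, f m * φ (netChange m.2.1 m.2.2) ≤ f m * ψ m := by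
    intro m
    by_cases hm : f m = 0
    · simp [hm]
    · refine mul_le_mul_of_nonneg_left ?_ (hf0 m)
      have hmM := hfM m hm
      have hex := Finset.exists_min_image (M (netChange m.2.1 m.2.2)) ψ ⟨m, hmM⟩
      simp only [φ]
      rw [dif_pos hex]
      exact_mod_cast hex.choose_spec.2 m hmM
  have hgsum : ∀ w : SignVec d → ℝ, ∑ v ∈ W, g v * w v = ∑ m, f m * w (netChange m.2.1 m.2.2) := by
    intro w
    have h1 : ∑ v ∈ W, g v * w v = ∑ v, g v * w v := by
      refine Finset.sum_subset (Finset.subset_univ _) fun v _ hv => ?_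
      have : g v = 0 := by simpa [W] using hv
      rw [this, zero_mul]
    rw [h1, ← Finset.sum_fiberwise_of_maps_to (s := Finset.univ) (t := Finset.univ)
      (g := fun m : Item d n × Finset (Fin d) × Finset (Fin d) => netChange m.2.1 m.2.2)
      fun _ _ => Finset.mem_univ _]
    refine Finset.sum_congr rfl fun v _ => ?_
    rw [Finset.sum_mul]
    refine Finset.sum_congr rfl fun m hm => ?_
    rw [(Finset.mem_filter.mp hm).2]
  have hmain : 0 ≤ ∑ v ∈ W, g v * φ v := by
    refine sum_nonneg_of_profiles φ g W
      (fun v hvW => lt_of_le_of_ne (hg0 v) (Finset.mem_filter.mp hvW).2.symm) ?_ ?_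
    · intro k
      rw [hgsum fun v => (v.toRat k : ℝ)]
      have h1 := sum_coupling_dst hx hy fun q => if k ∈ q.2 then 1 else 0
      have h2 := sum_coupling_src hx hy fun q => if k ∈ q.2 then 1 else 0
      rw [hy.filled] at h1
      rw [hx.filled] at h2
      have h3 : ∀ m : Item d n × Finset (Fin d) × Finset (Fin d),
          f m * ((netChange m.2.1 m.2.2).toRat k : ℝ) =
            f m * (if k ∈ m.2.2 then 1 else 0) - f m * if k ∈ m.2.1 then 1 else 0 := by
        intro m
        rw [toRat_netChange, ← mul_sub]
        split_ifs <;> simp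
      rw [Finset.sum_congr rfl fun m _ => h3 m, Finset.sum_sub_distrib]
      exact sub_eq_zero.mpr (h1.trans h2.symm)
    · intro V hVW hVprof
      obtain ⟨V', hV'P, rfl⟩ := hcomplete V hVprof
      have hV' := hP V' hV'P
      refine ⟨V'.coef, hV'.coef_pos, hV'.coef_rel, ?_⟩
      rw [Profile.sum_support hV'.nodup fun v a => (a : ℝ) * φ v]
      obtain ⟨t₀, ht₀⟩ := List.exists_mem_of_ne_nil _ hV'.ne_nil
      have hmem : ∀ t ∈ V', t.1 ∈ W := fun t ht =>
        hVW (List.mem_toFinset.mpr (List.mem_map.mpr ⟨t, ht, rfl⟩))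
      have m₀ := (hWM _ (hmem t₀ ht₀)).choose
      let mv : SignVec d → Move d n := fun v =>
        let m := if h : ∃ m ∈ M v, ∀ m' ∈ M v, ψ m ≤ ψ m' then h.choose else m₀
        ⟨m.1, m.2.1, m.2.2, I.finiteCost (m.1, m.2.2) - I.finiteCost (m.1, m.2.1)⟩
      have hmv : ∀ t ∈ V', (IsMove I (mv t.1) ∧ netChange (mv t.1).src (mv t.1).dst = t.1 ∧
          st.x ((mv t.1).item, (mv t.1).src) ≠ 0) ∧
          φ t.1 = (((mv t.1).cost + 2 * B / st.x ((mv t.1).item, (mv t.1).src) : ℚ) : ℝ) := by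
        intro t ht
        have hex := hWM _ (hmem t ht)
        obtain ⟨h1, h2, h3, h4⟩ := (Finset.mem_filter.mp hex.choose_spec.1).2
        simp only [mv, φ]
        rw [dif_pos hex, dif_pos hex]
        refine ⟨⟨?_, h4, h3⟩, rfl⟩
        obtain ⟨a, ha⟩ := Option.ne_none_iff_exists'.mp h1
        obtain ⟨b, hb⟩ := Option.ne_none_iff_exists'.mp h2
        exact ⟨a, b, ha, hb,
          congrArg₂ (fun r s : Option ℚ => r.getD 0 - s.getD 0) hb ha⟩
      have h1 := hB.sum_nonneg hv hi hr hB0 hV'P hV' fun t ht => (hmv t ht).1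
      have h2 : (V'.map fun t => (t.2 : ℝ) * φ t.1).sum = (((V'.map fun t => t.2 *
          ((mv t.1).cost + 2 * B / st.x ((mv t.1).item, (mv t.1).src))).sum : ℚ) : ℝ) := by
        rw [Rat.cast_list_sum, List.map_map]
        refine congrArg List.sum (List.map_congr_left fun t ht => ?_)
        rw [(hmv t ht).2]
        simp
      rw [h2]
      exact_mod_cast h1
  rw [hgsum] at hmain
  have hub := hmain.trans (Finset.sum_le_sum fun m _ => hφle m)
  have hψ : ∀ m, f m * (ψ m : ℝ) = f m * (I.finiteCost (m.1, m.2.2) : ℝ) -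
      f m * (I.finiteCost (m.1, m.2.1) : ℝ) + f m * ((2 * B / st.x (m.1, m.2.1) : ℚ) : ℝ) := by
    intro m
    simp only [ψ]
    push_cast
    ring
  rw [Finset.sum_congr rfl fun m _ => hψ m, Finset.sum_add_distrib, Finset.sum_sub_distrib,
    sum_coupling_dst hx hy fun q => (I.finiteCost q : ℝ),
    sum_coupling_src hx hy fun q => (I.finiteCost q : ℝ),
    sum_coupling_src hx hy fun q => ((2 * B / st.x q : ℚ) : ℝ)] at hub
  have hpen : ∑ q, ((2 * B / st.x q : ℚ) : ℝ) * x q =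
      2 * B * ((Finset.univ.filter fun q => st.x q ≠ 0).card : ℝ) := by
    have h1 : ∀ q, ((2 * B / st.x q : ℚ) : ℝ) * x q = if st.x q ≠ 0 then (2 * B : ℝ) else 0 := by
      intro q
      by_cases hq : st.x q = 0
      · simp [hxdef, hq]
      · have : (st.x q : ℝ) ≠ 0 := by exact_mod_cast hq
        rw [if_pos hq]
        simp only [hxdef]
        push_cast
        field_simp
    rw [Finset.sum_congr rfl fun q _ => h1 q, ← Finset.sum_filter, Finset.sum_const, nsmul_eq_mul,
      mul_comm]
  have hcard : ((Finset.univ.filter fun q => st.x q ≠ 0).card : ℝ) ≤ n + 2 * d := by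
    have h1 := hv.tidy.card_support hv.feasible
    have h2 := Valid.length_frac_le hi
    have h3 : (Finset.univ.filter fun p : Item d n => I.extSize p ≠ 0).card ≤ d + n := by
      refine (Finset.card_filter_le _ _).trans ?_
      rw [Finset.card_univ, Fintype.card_sum, Fintype.card_fin, Fintype.card_fin]
    have h4 : (Finset.univ.filter fun q => st.x q ≠ 0).card ≤ n + 2 * d := by omega
    exact_mod_cast h4
  have hB0' : (0 : ℝ) ≤ 2 * B := by exact_mod_cast (by linarith : (0 : ℚ) ≤ 2 * B)
  have hfin := mul_le_mul_of_nonneg_left hcard hB0'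
  rw [hpen] at hub
  have hxt := extTotal_cast I st.x
  simp only [Input.extTotal] at hxt ⊢
  rw [← hxt]
  simp only [hxdef] at hub
  linarith

end Gap

/-! ### Assignments with and without extra items -/

section Extend

variable {d n : ℕ}

/-- The load of the bin `b`. -/
def load (y : Fin n → Finset (Fin d) → ℝ) (b : Fin d) : ℝ := ∑ S with b ∈ S, ∑ p, y p S

/-- Fill the bins with the extra items.  The rest of an extra item is placed on `∅`. -/
def Input.extend (I : Input d n) (y : Fin n → Finset (Fin d) → ℝ) :
    Item d n × Finset (Fin d) → ℝ
  | (.inl b, S) =>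
    (if S = {b} then I.capacity b - load y b else 0) + if S = ∅ then load y b else 0
  | (.inr p, S) => y p S

theorem sum_extend_extra (I : Input d n) (y : Fin n → Finset (Fin d) → ℝ) (b : Fin d)
    (w : Finset (Fin d) → ℝ) : ∑ S, w S * I.extend y (.inl b, S) =
      w {b} * (I.capacity b - load y b) + w ∅ * load y b := by
  simp [Input.extend, mul_add, Finset.sum_add_distrib]

theorem sum_bin_mul (y : Fin n → Finset (Fin d) → ℝ) (b : Fin d) :
    ∑ p, ∑ S, (if b ∈ S then 1 else 0) * y p S = load y b := by
  rw [load, Finset.sum_comm, Finset.sum_filter]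
  refine Finset.sum_congr rfl fun S _ => ?_
  split_ifs <;> simp

theorem Input.IsFeasible.extend {I : Input d n} {y : Fin n → Finset (Fin d) → ℝ}
    (h : I.IsFeasible y) : ExtFeasible I (I.extend y) where
  nonneg := by
    rintro ⟨b | p, S⟩
    · have h1 : 0 ≤ load y b := Finset.sum_nonneg fun S _ => Finset.sum_nonneg fun p _ => h.nonneg p S
      have h2 : load y b ≤ I.capacity b := h.capacity_le b
      simp only [Input.extend]
      split_ifs <;> linarith
    · exact h.nonneg p S
  finite := by
    rintro ⟨b | p, S⟩ hq
    · by_cases hS : S = ∅ ∨ S = {b}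
      · simp [Input.extCost, hS] at hq
      · push Not at hS
        simp [Input.extend, hS.1.ne_empty, hS.2]
    · simp [Input.extCost] at hq
  assigned p := by
    rw [sum_item_eq]
    cases p with
    | inl b =>
      have := sum_extend_extra I y b fun _ => 1
      simp only [one_mul] at this
      rw [this, Input.extSize]
      ring
    | inr p => exact h.assigned p
  filled b := by
    rw [Fintype.sum_prod_type, Fintype.sum_sum_type]
    have h1 : ∀ b' : Fin d, ∑ S, (if b ∈ S then 1 else 0) * I.extend y (Sum.inl b', S) =
        if b = b' then I.capacity b' - load y b' else 0 := by
      intro b'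
      rw [sum_extend_extra I y b' fun S => if b ∈ S then 1 else 0]
      simp
    rw [Finset.sum_congr rfl fun b' _ => h1 b', Finset.sum_ite_eq, if_pos (Finset.mem_univ b)]
    have h2 := sum_bin_mul y b
    simp only [Input.extend]
    rw [h2]
    ring

theorem extTotal_eq (I : Input d n) (x : Item d n × Finset (Fin d) → ℝ) :
    I.extTotal x = I.totalCost fun p S => x (.inr p, S) := by
  rw [Input.extTotal, Fintype.sum_prod_type, Fintype.sum_sum_type]
  simp only [finiteCost_inl, Rat.cast_zero, zero_mul, Finset.sum_const_zero, zero_add]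
  rw [Input.totalCost]
  refine Finset.sum_congr rfl fun p _ => Finset.sum_congr rfl fun S _ => ?_
  simp [Input.finiteCost, Input.extCost]

theorem ExtFeasible.restrict {I : Input d n} {x : Item d n × Finset (Fin d) → ℝ}
    (h : ExtFeasible I x) : I.IsFeasible fun p S => x (.inr p, S) where
  nonneg p S := h.nonneg _
  assigned p := by
    have := h.assigned (.inr p)
    rwa [sum_item_eq] at this
  capacity_le b := by
    have h1 := h.filled b
    rw [Fintype.sum_prod_type, Fintype.sum_sum_type] at h1
    have h2 : 0 ≤ ∑ b' : Fin d, ∑ S, (if b ∈ S then 1 else 0) * x (Sum.inl b', S) :=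
      Finset.sum_nonneg fun b' _ => Finset.sum_nonneg fun S _ =>
        mul_nonneg (by split_ifs <;> norm_num) (h.nonneg _)
    have h3 := sum_bin_mul (fun p S => x (Sum.inr p, S)) b
    rw [h3, load] at h1
    linarith

theorem ExtFeasible.isOptimal {I : Input d n} {x : Item d n × Finset (Fin d) → ℝ}
    (h : ExtFeasible I x) (hmin : ∀ y : Item d n × Finset (Fin d) → ℝ, ExtFeasible I y →
      I.extTotal x ≤ I.extTotal y) : I.IsOptimal fun p S => x (.inr p, S) := by
  refine ⟨h.restrict, fun y hy => ?_⟩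
  have := hmin _ hy.extend
  rw [extTotal_eq, extTotal_eq] at this
  exact this

theorem ExtFeasible.extTotal_nonneg {I : Input d n} {x : Item d n × Finset (Fin d) → ℝ}
    (h : ExtFeasible I x) : 0 ≤ I.extTotal x := by
  refine Finset.sum_nonneg fun q _ => mul_nonneg ?_ (h.nonneg q)
  obtain ⟨c, hc⟩ := finiteCost_eq_natCast I q
  rw [hc]
  positivity

/-! ### The initial assignment -/

theorem start_eq (I : Input d n) (q : Item d n × Finset (Fin d)) :
    I.start q = if q.2 = startHome q.1 then (I.extSize q.1 : ℚ) else 0 := by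
  obtain ⟨b | p, S⟩ := q <;> rfl

theorem start_feasible (I : Input d n) : ExtFeasible I I.start where
  nonneg q := by
    rw [start_eq]
    split_ifs <;> positivity
  finite := by
    rintro ⟨b | p, S⟩ hq
    · rw [start_eq, if_neg]
      intro hS
      change S = {b} at hS
      simp [Input.extCost, hS] at hq
    · simp [Input.extCost] at hq
  assigned p := by
    rw [sum_item_eq]
    simp [start_eq]
  filled b := by
    rw [Fintype.sum_prod_type]
    simp only [start_eq, mul_ite, mul_zero, Finset.sum_ite_eq', Finset.mem_univ, if_true]
    rw [Fintype.sum_sum_type]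
    simp [startHome, Input.extSize]

theorem extTotal_start_le (I : Input d n) :
    I.extTotal I.start ≤ (n : ℚ) * I.maxStorageCost := by
  have h1 : I.extTotal I.start = ∑ p : Fin n, (I.cost p ∅ : ℚ) * I.size p := by
    rw [Input.extTotal, Fintype.sum_prod_type]
    simp only [start_eq, mul_ite, mul_zero, Finset.sum_ite_eq', Finset.mem_univ, if_true]
    rw [Fintype.sum_sum_type]
    simp [startHome, Input.extSize, Input.finiteCost, Input.extCost]
  rw [h1]
  have h2 : ∀ p ∈ (Finset.univ : Finset (Fin n)), (I.cost p ∅ : ℚ) * I.size p ≤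
      I.maxStorageCost := by
    intro p hp
    have h3 : I.cost p ∅ * I.size p ≤ I.maxStorageCost :=
      (Finset.le_sup (f := fun S => I.cost p S * I.size p) (Finset.mem_univ ∅)).trans
        (Finset.le_sup (f := fun p => Finset.univ.sup fun S => I.cost p S * I.size p) hp)
    exact_mod_cast h3
  have := Finset.sum_le_card_nsmul _ _ _ h2
  simpa using this

theorem start_valid {I : Input d n} {L : SignVec d → List (Move d n)}
    {pos : Item d n × Finset (Fin d) × Finset (Fin d) → ℕ} {st : Memory d n}
    (hs : Synced L pos st) (hx : st.x = I.start) (hh : st.home = startHome) (hf : st.frac = []) :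
    Valid I L pos st ∧ LinearIndependent ℚ (fracVec st) := by
  refine ⟨⟨hs, hx ▸ start_feasible I, ⟨by simp [hf], by simp [hf], by simp [hf], ?_, ?_⟩⟩, ?_⟩
  · intro q hq
    rw [hx, start_eq] at hq
    rw [hh]
    by_contra h
    push Not at h
    exact hq (if_neg h.1)
  · intro q hq
    rw [hx, start_eq] at hq ⊢
    rw [hh, if_pos rfl]
    intro h0
    exact hq (by split_ifs <;> simp [h0])
  · have : IsEmpty (Fin st.frac.length) := by
      rw [hf]
      exact Fin.isEmpty
    exact linearIndependent_empty_type

end Extend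

/-! ### The range of magnitudes -/

section Magnitudes

variable {d n : ℕ}

/-- An upper bound for the number of magnitudes. -/
def halvings (I : Input d n) : ℕ :=
  Nat.clog 2 (max 1 I.maxSize * d ^ d * ((d + 1) * (d ^ d * d ^ d)))

/-- An upper bound for the number of steps of `magnitudeBounds` with at most `J` magnitudes. -/
def boundsTime (d n J : ℕ) : ℕ := (n * 3 + 1) + (d * 2 + 1) + 4 + (J + 1) * 3

theorem magnitudeBounds_runs (I : Input d n) :
    Runs (magnitudeBounds I) fun r s => s ≤ boundsTime d n (halvings I) ∧
      ∃ J ≤ halvings I, MagnitudeRange I r.1 r.2 J := by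
  refine Runs.seq (Runs.each 2 (fun (done : List (Fin n)) (Z : ℚ) => 1 ≤ Z ∧
    Z ≤ ((max 1 I.maxSize : ℕ) : ℚ) ∧ ∀ p ∈ done, (I.size p : ℚ) ≤ Z) ?_ ?_) ?_
  · refine ⟨le_rfl, ?_, by simp⟩
    exact_mod_cast le_max_left 1 I.maxSize
  · rintro done p rest Z - ⟨h1, h2, h3⟩
    refine Runs.charge_bind (Runs.charge ⟨le_rfl, h1.trans (le_max_left _ _), max_le h2 ?_, ?_⟩)
    · have : I.size p ≤ max 1 I.maxSize :=
        (Finset.le_sup (f := I.size) (Finset.mem_univ p)).trans (le_max_right _ _)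
      exact_mod_cast this
    · intro q hq
      rcases List.mem_append.mp hq with hq | hq
      · exact (h3 q hq).trans (le_max_left _ _)
      · rw [List.mem_singleton.mp hq]
        exact le_max_right _ _
  rintro Z s₁ ⟨hs₁, hZ1, hZ2, hZ3⟩
  refine Runs.seq (Runs.each 1 (fun (done : List (Fin d)) (D : ℚ) =>
    D = ((d ^ done.length : ℕ) : ℚ)) (by simp) ?_) ?_
  · rintro done b rest D - rfl
    exact Runs.charge ⟨le_rfl, by rw [List.length_append, List.length_singleton, pow_succ]; simp⟩
  rintro D s₂ ⟨hs₂, hD⟩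
  rw [List.length_finRange] at hs₁ hs₂ hD
  have hD1 : 1 ≤ D := by
    rw [hD]
    exact_mod_cast one_le_self_pow_self d
  have hD0 : 0 < D := by linarith
  have hd0 : (0 : ℚ) < (d : ℚ) + 1 := by positivity
  have hD3 : 0 < ((d : ℚ) + 1) * (D * D) := by positivity
  have hmax : D * Z * (((d : ℚ) + 1) * (D * D)) ≤ 2 ^ halvings I := by
    have h1 := Nat.le_pow_clog (b := 2) (by norm_num)
      (max 1 I.maxSize * d ^ d * ((d + 1) * (d ^ d * d ^ d)))
    have h2 : ((max 1 I.maxSize * d ^ d * ((d + 1) * (d ^ d * d ^ d)) : ℕ) : ℚ) ≤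
        ((2 ^ halvings I : ℕ) : ℚ) := by exact_mod_cast h1
    rw [Nat.cast_mul, Nat.cast_mul, Nat.cast_mul, Nat.cast_mul, ← hD] at h2
    push_cast at h2
    refine le_trans (mul_le_mul_of_nonneg_right ?_ hD3.le) h2
    rw [mul_comm]
    exact mul_le_mul_of_nonneg_right (by exact_mod_cast hZ2) hD0.le
  refine Runs.charge_bind (Runs.charge_bind (Runs.charge_bind (Runs.charge_bind
    (Runs.seq (Runs.loop 2 (fun k (a : ℚ) => ∃ j, j + k = halvings I ∧ D * Z = a * 2 ^ j)
      (fun a => a ≤ 1 / (((d : ℚ) + 1) * (D * D)) ∧ ∃ j ≤ halvings I, D * Z = a * 2 ^ j)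
      ?_ (halvings I) _ ⟨0, by omega, by simp⟩) ?_))))
  · rintro k a ⟨j, hj, ha⟩
    refine Runs.charge_bind ?_
    by_cases hle : a ≤ 1 / (((d : ℚ) + 1) * (D * D))
    · rw [if_pos (decide_eq_true hle)]
      exact Runs.pure ⟨by omega, hle, j, by omega, ha⟩
    · rw [if_neg (by simpa using hle)]
      have hk : 0 < k := by
        rcases Nat.eq_zero_or_pos k with rfl | hk
        · exfalso
          apply hle
          rw [le_div_iff₀ hD3]
          obtain rfl : j = halvings I := by omega
          rw [ha] at hmax
          have h2 : (0 : ℚ) < 2 ^ halvings I := by positivity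
          have h3 : a * (((d : ℚ) + 1) * (D * D)) * 2 ^ halvings I ≤ 1 * 2 ^ halvings I := by
            linarith
          exact le_of_mul_le_mul_right h3 h2
        · exact hk
      refine Runs.charge_bind (Runs.pure ⟨le_rfl, k - 1, by omega, j + 1, by omega, ?_⟩)
      rw [ha, pow_succ]
      ring
  · rintro aMin s₃ ⟨hs₃, hlow, J, hJ, heq⟩
    have h2J : (0 : ℚ) < 2 ^ J := by positivity
    have hDZ : 1 ≤ D * Z := one_le_mul_of_one_le_of_one_le hD1 hZ1
    refine Runs.pure ⟨by unfold boundsTime; omega, J, hJ, ?_, heq, fun p => ?_, hDZ, ?_⟩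
    · refine pos_of_mul_pos_left ?_ h2J.le
      rw [← heq]
      linarith
    · rw [← hD]
      exact mul_le_mul_of_nonneg_left (hZ3 p (List.mem_finRange p)) hD0.le
    · rw [← hD, mul_comm]
      exact (le_div_iff₀ hD3).mp hlow

end Magnitudes

/-! ### The main loop -/

section Main

variable {d n : ℕ}

theorem findTime_mono {N N' J J' : ℕ} (hN : N ≤ N') (hJ : J ≤ J') (d n : ℕ) :
    findTime d n N J ≤ findTime d n N' J' := by
  unfold findTime
  gcongr

theorem applyTime_mono {r r' : ℕ} (h : r ≤ r') (d n : ℕ) :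
    applyTime d n r ≤ applyTime d n r' := by
  unfold applyTime tidyTime
  gcongr

theorem restoreTime_mono {r r' : ℕ} (h : r ≤ r') (d n : ℕ) :
    restoreTime d n r ≤ restoreTime d n r' := by
  unfold restoreTime depTime
  have := cancelTime_mono h d n
  gcongr

/-- An upper bound for the number of steps of a pass of the main loop with at most `J`
magnitudes. -/
def passTime (d n J : ℕ) : ℕ :=
  findTime d n (profileBound d) J + applyTime d n d + restoreTime d n (2 * d + 1)

/-- An upper bound for the number of steps of `mainLoop` with `R` augmentations and at most `J`
magnitudes. -/
def mainTime (d n J R : ℕ) : ℕ :=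
  setupTime d n + preprocessTime d + boundsTime d n J + (R + 1) * (passTime d n J + 1)

/-- The relative decrease of the optimality gap by an augmentation. -/
noncomputable def contraction (d n : ℕ) : ℝ := 1 - 1 / (2 * (d + 1) * (n + 2 * d))

/-- Every augmentation lowers the optimality gap by a constant factor, and by at least the inverse
of the product of two denominators.  Hence there is no room for more than `R` augmentations. -/
theorem mainLoop_runs (I : Input d n) (hn : 0 < n) {R : ℕ}
    (hR : contraction d n ^ R * (n * I.maxStorageCost) < 1 / ((d ^ d * d ^ d : ℕ) : ℝ)) :
    Runs (mainLoop I) fun x s => s ≤ mainTime d n (halvings I) R ∧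
      I.IsOptimal fun p S => (x p S : ℝ) := by
  have hn1 : (1 : ℝ) ≤ n := by exact_mod_cast hn
  have hd0 : (0 : ℝ) ≤ d := by positivity
  set M : ℝ := 2 * (d + 1) * (n + 2 * d) with hM
  have hM1 : 1 ≤ M := by
    rw [hM]
    nlinarith
  have hcon : contraction d n = 1 - 1 / M := rfl
  have hc0 : 0 ≤ contraction d n := by
    rw [hcon, sub_nonneg, div_le_one (by linarith)]
    exact hM1
  refine Runs.seq (setup_runs I) ?_
  rintro st₀ s₁ ⟨hs₁, hx₀, hh₀, hf₀, L, pos, hL, hsync⟩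
  obtain ⟨hv₀, hi₀⟩ := start_valid hsync hx₀ hh₀ hf₀
  refine Runs.seq (preprocess_runs d) ?_
  rintro P s₂ ⟨hs₂, hlen, hP, hcomplete⟩
  refine Runs.seq (magnitudeBounds_runs I) ?_
  rintro ⟨aMax, aMin⟩ s₃ ⟨hs₃, J, hJ, hr⟩
  simp only at hr
  refine (Runs.loop (passTime d n (halvings I))
    (fun k (st : Memory d n) => Valid I L pos st ∧ LinearIndependent ℚ (fracVec st) ∧
      ∃ i, i + k = R ∧ ∀ y : Item d n × Finset (Fin d) → ℝ, ExtFeasible I y →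
        ((I.extTotal st.x : ℚ) : ℝ) - I.extTotal y ≤
          contraction d n ^ i * (n * I.maxStorageCost))
    (fun x => I.IsOptimal fun p S => (x p S : ℝ)) ?_ R st₀ ⟨hv₀, hi₀, 0, by omega, ?_⟩).mono ?_
  · rintro k st ⟨hv, hi, i, hik, hgap⟩
    refine Runs.seq (findAugmentation_runs hL hv.synced hP hr.pos hr.eq) ?_
    rintro o c₁ ⟨hc₁, B, hB0, hB, hnone, hsome⟩
    have hfind : c₁ ≤ findTime d n (profileBound d) (halvings I) :=
      hc₁.trans (findTime_mono hlen hJ d n)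
    have hgapB := fun y (hy : ExtFeasible I y) =>
      GainAtMost.gap_le hv hi hP hcomplete hr hB0 hB (y := y) hy
    match o, hnone, hsome with
    | none, hnone, _ =>
      refine Runs.pure ⟨by unfold passTime; omega, ?_⟩
      refine ExtFeasible.isOptimal hv.feasible.cast fun y hy => ?_
      have := hgapB y hy
      rw [hnone rfl] at this
      rw [extTotal_cast]
      simpa using this
    | some A, _, hsome =>
      obtain ⟨hBpos, a, happ, hBa⟩ := hsome A rfl
      have hunit : unitCost A ≤ 0 := by
        by_contra h
        have := mul_pos happ.pos (not_le.mp h)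
        linarith
      refine Runs.seq (applyAugmentation_runs hL hv happ hunit) ?_
      rintro st₁ c₂ ⟨hc₂, hv₁, htot₁, hlen₁⟩
      refine Runs.seq (restore_runs hL hv₁) ?_
      rintro st₂ c₃ ⟨hc₃, hv₂, htot₂, hi₂⟩
      have hl := Valid.length_frac_le hi
      have ht₂ := applyTime_mono hl d n
      have ht₃ := restoreTime_mono (show st₁.frac.length ≤ 2 * d + 1 by omega) d n
      have hdec : I.extTotal st₂.x ≤ I.extTotal st.x - B / (d + 1) := by
        have h1 : a / (d + 1) * unitCost A = -B / (d + 1) := by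
          rw [hBa]
          ring
        rw [h1, neg_div] at htot₁
        linarith
      have hBd : 0 < B / ((d : ℚ) + 1) := by positivity
      have hdec' : ((I.extTotal st₂.x : ℚ) : ℝ) ≤ (I.extTotal st.x : ℚ) - (B : ℝ) / (d + 1) := by
        exact_mod_cast hdec
      have hstep := hv.one_div_le_sub hi hv₂ hi₂ (by linarith)
      have hstep' : 1 / ((d ^ d * d ^ d : ℕ) : ℝ) ≤
          ((I.extTotal st.x : ℚ) : ℝ) - (I.extTotal st₂.x : ℚ) := by
        have := (Rat.cast_le (K := ℝ)).mpr hstep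
        push_cast at this ⊢
        exact this
      have hk : 0 < k := by
        -- the gap is at least the difference to the next assignment, which is not too small
        rcases Nat.eq_zero_or_pos k with rfl | hk
        · exfalso
          have h1 := hgap _ hv₂.feasible.cast
          rw [extTotal_cast] at h1
          obtain rfl : i = R := by omega
          linarith
        · exact hk
      refine Runs.pure ⟨by unfold passTime; omega, k - 1, by omega, hv₂, hi₂, i + 1, by omega,
        fun y hy => ?_⟩
      have h1 := hgapB y hy
      have h2 : (((I.extTotal st.x : ℚ) : ℝ) - I.extTotal y) / M ≤ (B : ℝ) / (d + 1) := by
        rw [div_le_div_iff₀ (by linarith) (by linarith), hM]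
        have := mul_le_mul_of_nonneg_right h1 (show (0 : ℝ) ≤ d + 1 by linarith)
        linarith
      have h3 : ((I.extTotal st₂.x : ℚ) : ℝ) - I.extTotal y ≤
          contraction d n * (((I.extTotal st.x : ℚ) : ℝ) - I.extTotal y) := by
        rw [hcon, sub_mul, one_mul, one_div_mul_eq_div]
        linarith
      rw [pow_succ, mul_comm (contraction d n ^ i), mul_assoc]
      exact h3.trans (mul_le_mul_of_nonneg_left (hgap y hy) hc0)
  · intro y hy
    rw [pow_zero, one_mul, hx₀]
    have h1 : ((I.extTotal I.start : ℚ) : ℝ) ≤ n * I.maxStorageCost := by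
      exact_mod_cast extTotal_start_le I
    have := hy.extTotal_nonneg
    linarith
  · rintro x c ⟨hc, hopt⟩
    exact ⟨by unfold mainTime; omega, hopt⟩

end Main

/-! ### Binomial coefficients -/

section Choose

theorem two_mul_le_three_pow (d : ℕ) : 2 * d ≤ 3 ^ d := by
  induction d with
  | zero => simp
  | succ d ih =>
    have : 0 < 3 ^ d := by positivity
    rw [pow_succ]
    omega

theorem choose_le_choose_of_le_half {N j k : ℕ} (hjk : j ≤ k) (hk : 2 * k ≤ N) :
    N.choose j ≤ N.choose k := by
  induction k, hjk using Nat.le_induction with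
  | base => exact le_rfl
  | succ k hjk ih =>
    exact (ih (by omega)).trans (Nat.choose_le_succ_of_lt_half_left (by omega))

/-- As `2 * d ≤ 3 ^ d`, the ratio of the two binomial coefficients is at least
`3 ^ d / (2 * (d + 1))`. -/
theorem profileBound_le (d : ℕ) : profileBound d ≤ 2 * (d + 1) * (3 ^ d).choose (d + 1) := by
  have h1 := two_mul_le_three_pow d
  have h2 := Nat.choose_succ_right_eq (3 ^ d) d
  have h3 : 3 ^ d ≤ 2 * (3 ^ d - d) := by omega
  refine (Nat.mul_le_mul_left _ h3).trans (le_of_eq ?_)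
  calc (3 ^ d).choose d * (2 * (3 ^ d - d)) = 2 * ((3 ^ d).choose d * (3 ^ d - d)) := by ring
    _ = 2 * (d + 1) * (3 ^ d).choose (d + 1) := by rw [← h2]; ring

theorem sum_choose_le (d : ℕ) : ∑ j ∈ Finset.range (d + 1), (3 ^ d + 1).choose j ≤
    2 * (d + 1) * (3 ^ d).choose d := by
  have h1 := two_mul_le_three_pow d
  have h2 : ∀ j ∈ Finset.range (d + 1), (3 ^ d + 1).choose j ≤ 2 * (3 ^ d).choose d := by
    intro j hj
    rw [Finset.mem_range] at hj
    rcases j with _ | j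
    · have : 0 < (3 ^ d).choose d := Nat.choose_pos (by omega)
      rw [Nat.choose_zero_right]
      omega
    · rw [Nat.choose_succ_succ']
      have h3 := choose_le_choose_of_le_half (show j ≤ d by omega) h1
      have h4 := choose_le_choose_of_le_half (show j + 1 ≤ d by omega) h1
      omega
  refine (Finset.sum_le_card_nsmul _ _ _ h2).trans (le_of_eq ?_)
  rw [Finset.card_range, smul_eq_mul]
  ring

/-- For `d ≥ 2` the bound follows from `C(3 ^ d, 3) ≤ C(3 ^ d, d + 1)`. -/
theorem pow_le_choose (d : ℕ) : 27 ^ d ≤ 9 * (3 ^ d).choose (d + 1) := by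
  rcases Nat.lt_or_ge d 2 with h | h
  · interval_cases d <;> decide
  · have h9 : 9 ≤ 3 ^ d := by
      calc 9 = 3 ^ 2 := by norm_num
        _ ≤ 3 ^ d := Nat.pow_le_pow_right (by norm_num) h
    have hhalf : ∀ d, 2 ≤ d → 2 * (d + 1) ≤ 3 ^ d := by
      intro d hd
      induction d, hd using Nat.le_induction with
      | base => norm_num
      | succ d hd ih =>
        rw [pow_succ]
        omega
    have h1 := choose_le_choose_of_le_half (show 3 ≤ d + 1 by omega) (hhalf d h)
    refine le_trans ?_ (Nat.mul_le_mul_left 9 h1)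
    have h2 : 27 ^ d = (3 ^ d) ^ 3 := by
      rw [← pow_mul, mul_comm, pow_mul]
      norm_num
    rw [h2]
    generalize 3 ^ d = N at h9
    obtain ⟨m, rfl⟩ : ∃ m, N = m + 9 := ⟨N - 9, by omega⟩
    have h3 : (m + 9).choose 3 * 6 = (m + 9) * (m + 8) * (m + 7) := by
      have := Nat.descFactorial_eq_factorial_mul_choose (m + 9) 3
      simp [Nat.descFactorial, Nat.factorial] at this
      linarith
    nlinarith

theorem one_le_choose (d : ℕ) : 1 ≤ (3 ^ d).choose (d + 1) := by
  refine Nat.choose_pos ?_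
  have h : ∀ d, d + 1 ≤ 3 ^ d := by
    intro d
    induction d with
    | zero => simp
    | succ d ih =>
      rw [pow_succ]
      omega
  exact h d

end Choose

/-! ### Bounds up to polynomial factors in the dimension -/

section PolyLE

variable {ι : Type} {δ f f' g g' : ι → ℕ}

/-- `f` is bounded by `g` up to a factor that is polynomial in `δ`. -/
def PolyLE (δ f g : ι → ℕ) : Prop := ∃ K k : ℕ, ∀ i, f i ≤ K * (δ i + 1) ^ k * g i

namespace PolyLE

theorem mono (h : PolyLE δ f g) (hg : ∀ i, g i ≤ g' i) : PolyLE δ f g' := by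
  obtain ⟨K, k, h⟩ := h
  exact ⟨K, k, fun i => (h i).trans (Nat.mul_le_mul_left _ (hg i))⟩

theorem of_le (h : ∀ i, f i ≤ g i) : PolyLE δ f g := ⟨1, 0, by simpa using h⟩

theorem anti (h : PolyLE δ f g) (hf : ∀ i, f' i ≤ f i) : PolyLE δ f' g := by
  obtain ⟨K, k, h⟩ := h
  exact ⟨K, k, fun i => (hf i).trans (h i)⟩

theorem add (h : PolyLE δ f g) (h' : PolyLE δ f' g) : PolyLE δ (fun i => f i + f' i) g := by
  obtain ⟨K, k, h⟩ := h
  obtain ⟨K', k', h'⟩ := h'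
  refine ⟨K + K', k + k', fun i => ?_⟩
  have h1 : (δ i + 1) ^ k ≤ (δ i + 1) ^ (k + k') :=
    Nat.pow_le_pow_right (Nat.succ_pos _) (by omega)
  have h2 : (δ i + 1) ^ k' ≤ (δ i + 1) ^ (k + k') :=
    Nat.pow_le_pow_right (Nat.succ_pos _) (by omega)
  rw [add_mul, add_mul]
  exact Nat.add_le_add
    ((h i).trans (Nat.mul_le_mul_right _ (Nat.mul_le_mul_left _ h1)))
    ((h' i).trans (Nat.mul_le_mul_right _ (Nat.mul_le_mul_left _ h2)))

theorem mul (h : PolyLE δ f g) (h' : PolyLE δ f' g') :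
    PolyLE δ (fun i => f i * f' i) fun i => g i * g' i := by
  obtain ⟨K, k, h⟩ := h
  obtain ⟨K', k', h'⟩ := h'
  refine ⟨K * K', k + k', fun i => (Nat.mul_le_mul (h i) (h' i)).trans (le_of_eq ?_)⟩
  rw [pow_add]
  ring

theorem trans (h : PolyLE δ f g) (h' : PolyLE δ g g') : PolyLE δ f g' := by
  obtain ⟨K, k, h⟩ := h
  obtain ⟨K', k', h'⟩ := h'
  refine ⟨K * K', k + k', fun i => (h i).trans ((Nat.mul_le_mul_left _ (h' i)).trans
    (le_of_eq ?_))⟩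
  rw [pow_add]
  ring

theorem poly_mul (h : PolyLE δ f fun _ => 1) (h' : PolyLE δ f' g) :
    PolyLE δ (fun i => f i * f' i) g :=
  (h.mul h').mono fun _ => (one_mul _).le

theorem mul_poly (h : PolyLE δ f g) (h' : PolyLE δ f' fun _ => 1) :
    PolyLE δ (fun i => f i * f' i) g :=
  (h.mul h').mono fun _ => (mul_one _).le

theorem const (hg : ∀ i, 1 ≤ g i) (K : ℕ) : PolyLE δ (fun _ => K) g :=
  ⟨K, 0, fun i => by
    rw [pow_zero, mul_one]
    exact Nat.le_mul_of_pos_right _ (hg i)⟩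

theorem dim (hg : ∀ i, 1 ≤ g i) : PolyLE δ (fun i => δ i) g :=
  ⟨1, 1, fun i => by
    rw [pow_one, one_mul]
    exact (Nat.le_succ _).trans (Nat.le_mul_of_pos_right _ (hg i))⟩

end PolyLE

end PolyLE

/-! ### The running time -/

section RunningTime

/-- The number of binary digits of `m`, up to rounding. -/
def bits (m : ℕ) : ℕ := Nat.clog 2 (max 1 m) + 1

theorem one_le_bits (m : ℕ) : 1 ≤ bits m := Nat.succ_pos _

/-- The constant is an upper bound for `3 / log 2`. -/
theorem bits_le_lg (m : ℕ) : (bits m : ℝ) ≤ 5 * lg m := by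
  have hlog2 : (0.6931471803 : ℝ) < Real.log 2 := Real.log_two_gt_d9
  have h1 : Real.log 2 ≤ lg m := Real.log_le_log (by norm_num) (le_max_left _ _)
  have h2 : ((Nat.clog 2 (max 1 m) : ℕ) : ℝ) * Real.log 2 ≤ lg m + Real.log 2 := by
    rcases Nat.lt_or_ge 1 m with h | h
    · have h3 := Nat.pow_pred_clog_lt_self (b := 2) (by norm_num) h
      have h4 : 0 < Nat.clog 2 m := Nat.clog_pos (by norm_num) h
      obtain ⟨j, hj⟩ : ∃ j, Nat.clog 2 m = j + 1 := ⟨_, (Nat.succ_pred_eq_of_pos h4).symm⟩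
      rw [max_eq_right h.le, hj]
      rw [hj, Nat.pred_succ] at h3
      have h5 : (2 : ℝ) ^ j ≤ m := by exact_mod_cast h3.le
      have h6 : Real.log ((2 : ℝ) ^ j) ≤ lg m :=
        Real.log_le_log (by positivity) (h5.trans (le_max_right _ _))
      rw [Real.log_pow] at h6
      push_cast
      linarith
    · rw [max_eq_left h, Nat.clog_one_right]
      norm_num
      linarith
  have h3 : (bits m : ℝ) = (Nat.clog 2 (max 1 m) : ℕ) + 1 := by
    unfold bits
    push_cast
    ring
  have h4 : (bits m : ℝ) * Real.log 2 ≤ 3 * lg m := by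
    rw [h3]
    linarith
  have h5 : (0 : ℝ) ≤ bits m := Nat.cast_nonneg _
  nlinarith

theorem clog_le_of_le_two_pow {m k : ℕ} (h : m ≤ 2 ^ k) : Nat.clog 2 m ≤ k :=
  Nat.clog_le_of_le_pow h

theorem treeDepth_le {d n : ℕ} (hn : 0 < n) : treeDepth d n ≤ 2 * (d + 1) * bits n := by
  have h1 : n ≤ 2 ^ Nat.clog 2 n := Nat.le_pow_clog (by norm_num) n
  have h2 : d + 1 ≤ 2 ^ d := Nat.lt_two_pow_self
  have h3 : treeDepth d n ≤ Nat.clog 2 n + d + d := by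
    refine clog_le_of_le_two_pow ?_
    rw [pow_add, pow_add]
    refine Nat.mul_le_mul_right _ ?_
    calc d + n ≤ n * (d + 1) := by nlinarith
      _ ≤ 2 ^ Nat.clog 2 n * 2 ^ d := Nat.mul_le_mul h1 h2
  have h4 : bits n = Nat.clog 2 n + 1 := by rw [bits, max_eq_right hn]
  rw [h4]
  nlinarith

theorem self_pow_self_le (d : ℕ) : d ^ d ≤ 2 ^ (d * d) := by
  rw [pow_mul]
  exact Nat.pow_le_pow_left Nat.lt_two_pow_self.le d

theorem halvings_le {d n : ℕ} (I : Input d n) :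
    halvings I + 1 ≤ 4 * (d + 1) ^ 2 * bits I.maxSize := by
  have h1 : max 1 I.maxSize ≤ 2 ^ Nat.clog 2 (max 1 I.maxSize) := Nat.le_pow_clog (by norm_num) _
  have h2 : d + 1 ≤ 2 ^ d := Nat.lt_two_pow_self
  have h3 := self_pow_self_le d
  have h4 : halvings I ≤ Nat.clog 2 (max 1 I.maxSize) + d * d + (d + (d * d + d * d)) := by
    refine clog_le_of_le_two_pow ?_
    rw [pow_add, pow_add, pow_add, pow_add]
    gcongr
  unfold bits
  nlinarith [Nat.zero_le (Nat.clog 2 (max 1 I.maxSize) * d)]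

/-- An upper bound for the number of augmentations. -/
def augmentationBound {d n : ℕ} (I : Input d n) : ℕ :=
  2 * (d + 1) * (n + 2 * d) * (Nat.clog 2 (max 1 (n * I.maxStorageCost)) + 2 * (d * d)) + 1

theorem augmentationBound_le {d n : ℕ} (I : Input d n) (hn : 0 < n) :
    augmentationBound I + 1 ≤ 10 * (d + 1) ^ 4 * (n * bits (n * I.maxStorageCost)) := by
  unfold augmentationBound bits
  generalize Nat.clog 2 (max 1 (n * I.maxStorageCost)) = l
  have h1 : n + 2 * d ≤ 2 * (d + 1) * n := by nlinarith
  have h2 : l + 2 * (d * d) ≤ 2 * (d + 1) ^ 2 * (l + 1) := by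
    nlinarith [Nat.zero_le (l * d)]
  have h3 : 2 * (d + 1) * (n + 2 * d) * (l + 2 * (d * d)) ≤
      8 * ((d + 1) ^ 4 * (n * (l + 1))) := by
    calc 2 * (d + 1) * (n + 2 * d) * (l + 2 * (d * d))
        ≤ 2 * (d + 1) * (2 * (d + 1) * n) * (2 * (d + 1) ^ 2 * (l + 1)) := by gcongr
      _ = 8 * ((d + 1) ^ 4 * (n * (l + 1))) := by ring
  have h4 : 1 ≤ (d + 1) ^ 4 * (n * (l + 1)) :=
    Nat.mul_pos (by positivity) (Nat.mul_pos hn (Nat.succ_pos _))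
  calc _ ≤ 8 * ((d + 1) ^ 4 * (n * (l + 1))) + 1 + 1 := by omega
    _ ≤ 10 * ((d + 1) ^ 4 * (n * (l + 1))) := by omega
    _ = _ := by ring

/-- After this number of passes the gap would be smaller than any possible improvement. -/
theorem contraction_pow_mul_lt {d n : ℕ} (I : Input d n) (hn : 0 < n) :
    contraction d n ^ augmentationBound I * (n * I.maxStorageCost) <
      1 / ((d ^ d * d ^ d : ℕ) : ℝ) := by
  have hn1 : (1 : ℝ) ≤ n := by exact_mod_cast hn
  have hd0 : (0 : ℝ) ≤ d := by positivity
  set M : ℝ := 2 * (d + 1) * (n + 2 * d) with hM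
  have hM1 : 1 ≤ M := by
    rw [hM]
    nlinarith
  have hM0 : 0 < M := by linarith
  have hcon : contraction d n = 1 - 1 / M := rfl
  have hc0 : 0 ≤ contraction d n := by
    rw [hcon, sub_nonneg, div_le_one hM0]
    exact hM1
  set l := Nat.clog 2 (max 1 (n * I.maxStorageCost)) + 2 * (d * d) with hl
  have hR : (augmentationBound I : ℝ) = M * l + 1 := by
    rw [augmentationBound, ← hl, hM]
    push_cast
    ring
  have h1 : contraction d n ^ augmentationBound I ≤ Real.exp (-(l + 1 / M)) := by
    have h2 : contraction d n ≤ Real.exp (-(1 / M)) := by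
      have := Real.add_one_le_exp (-(1 / M))
      rw [hcon]
      linarith
    refine (pow_le_pow_left₀ hc0 h2 _).trans (le_of_eq ?_)
    rw [← Real.exp_nat_mul, hR]
    congr 1
    field_simp
  have hD : (0 : ℝ) < ((d ^ d * d ^ d : ℕ) : ℝ) := by
    have := one_le_self_pow_self d
    exact_mod_cast Nat.mul_pos this this
  have h3 : (n * I.maxStorageCost : ℝ) * ((d ^ d * d ^ d : ℕ) : ℝ) ≤ Real.exp l := by
    have h4 : n * I.maxStorageCost * (d ^ d * d ^ d) ≤ 2 ^ l := by
      have h5 : n * I.maxStorageCost ≤ 2 ^ Nat.clog 2 (max 1 (n * I.maxStorageCost)) :=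
        (le_max_right _ _).trans (Nat.le_pow_clog (by norm_num) _)
      have h6 := self_pow_self_le d
      rw [hl, pow_add, two_mul, pow_add]
      gcongr
    have h5 : ((n * I.maxStorageCost * (d ^ d * d ^ d) : ℕ) : ℝ) ≤ 2 ^ l := by exact_mod_cast h4
    have h6 : (2 : ℝ) ^ l ≤ Real.exp l := by
      have h7 := Real.add_one_le_exp (1 : ℝ)
      have h8 := pow_le_pow_left₀ (by norm_num : (0 : ℝ) ≤ 2) (by linarith : 2 ≤ Real.exp 1) l
      rwa [← Real.exp_nat_mul, mul_one] at h8
    refine le_trans (le_of_eq ?_) (h5.trans h6)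
    push_cast
    ring
  rw [lt_div_iff₀ hD, mul_assoc]
  calc contraction d n ^ augmentationBound I *
        ((n * I.maxStorageCost : ℝ) * ((d ^ d * d ^ d : ℕ) : ℝ))
      ≤ Real.exp (-(l + 1 / M)) * Real.exp l :=
        mul_le_mul h1 h3 (by positivity) (Real.exp_pos _).le
    _ = Real.exp (-(1 / M)) := by
        rw [← Real.exp_add]
        congr 1
        ring
    _ < 1 := by
        rw [Real.exp_lt_one_iff]
        have : 0 < 1 / M := by positivity
        linarith

end RunningTime

/-! ### The total running time -/

section Total

/-- An instance of the problem with at least one item. -/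
structure Instance where
  d : ℕ
  n : ℕ
  input : Input d n
  pos : 0 < n

namespace Instance

/-- The binomial coefficient that bounds the number of profiles. -/
def profiles (i : Instance) : ℕ := (3 ^ i.d).choose (i.d + 1)

/-- The logarithmic factor for the number of items. -/
def itemBits (i : Instance) : ℕ := bits i.n

/-- The logarithmic factor for the number of magnitudes. -/
def sizeBits (i : Instance) : ℕ := bits i.input.maxSize

/-- The logarithmic factor for the initial gap. -/
def costBits (i : Instance) : ℕ := bits (i.n * i.input.maxStorageCost)

theorem one_le_profiles (i : Instance) : 1 ≤ i.profiles := one_le_choose _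

theorem one_le_itemBits (i : Instance) : 1 ≤ i.itemBits := one_le_bits _

theorem one_le_sizeBits (i : Instance) : 1 ≤ i.sizeBits := one_le_bits _

theorem one_le_costBits (i : Instance) : 1 ≤ i.costBits := one_le_bits _

end Instance

open Instance

theorem pow_polyLE {b : ℕ} (hb : b ≤ 27) : PolyLE Instance.d (fun i => b ^ i.d) profiles :=
  ⟨9, 0, fun i => by
    rw [pow_zero, mul_one]
    exact (Nat.pow_le_pow_left hb _).trans (pow_le_choose i.d)⟩

theorem profileBound_polyLE : PolyLE Instance.d (fun i => profileBound i.d) profiles :=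
  ⟨2, 1, fun i => by
    rw [pow_one]
    exact profileBound_le i.d⟩

theorem treeDepth_polyLE : PolyLE Instance.d (fun i => treeDepth i.d i.n) itemBits :=
  ⟨2, 1, fun i => by
    rw [pow_one]
    exact treeDepth_le i.pos⟩

theorem halvings_polyLE : PolyLE Instance.d (fun i => halvings i.input + 1) sizeBits :=
  ⟨4, 2, fun i => halvings_le i.input⟩

theorem augmentationBound_polyLE :
    PolyLE Instance.d (fun i => augmentationBound i.input + 1) fun i => i.n * i.costBits :=
  ⟨10, 4, fun i => augmentationBound_le i.input i.pos⟩

section Poly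

variable {ι : Type} {δ r : ι → ℕ}

theorem PolyLE.refl (δ f : ι → ℕ) : PolyLE δ f f := PolyLE.of_le fun _ => le_rfl

theorem PolyLE.depTime (hr : PolyLE δ r fun _ => 1) :
    PolyLE δ (fun i => depTime (δ i) (r i)) fun _ => 1 := by
  unfold SubsetAssignment.depTime
  repeat' first
    | exact .const (fun _ => le_rfl) _
    | exact .dim fun _ => le_rfl
    | exact hr
    | apply PolyLE.add
    | apply PolyLE.poly_mul

theorem PolyLE.tidyTime (hr : PolyLE δ r fun _ => 1) :
    PolyLE δ (fun i => tidyTime (δ i) (r i)) fun _ => 1 := by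
  unfold SubsetAssignment.tidyTime
  repeat' first
    | exact .const (fun _ => le_rfl) _
    | exact .dim fun _ => le_rfl
    | exact hr
    | apply PolyLE.add
    | apply PolyLE.poly_mul

theorem PolyLE.sortTime {B k g h : ι → ℕ} (hB : PolyLE δ B g) (hg : ∀ i, 1 ≤ g i)
    (hlog : PolyLE δ (fun i => Nat.clog 2 (B i)) h) (hh : ∀ i, 1 ≤ h i)
    (hk : PolyLE δ k fun _ => 1) :
    PolyLE δ (fun i => sortTime (B i) (k i)) fun i => g i * h i := by
  unfold SubsetAssignment.sortTime
  refine .mul (.add (.poly_mul (.const (fun _ => le_rfl) _) hB) (.const hg _))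
    (.mul_poly (.add hlog (.const hh _)) (.poly_mul (.const (fun _ => le_rfl) _)
      (.add hk (.const (fun _ => le_rfl) _))))

theorem PolyLE.expandTime (δ : ι → ℕ) :
    PolyLE δ (fun i => expandTime (δ i)) fun _ => 1 := by
  have hd : PolyLE δ (fun i => δ i) fun _ => 1 := .dim fun _ => le_rfl
  have hd1 : PolyLE δ (fun i => δ i + 1) fun _ => 1 := .add hd (.const (fun _ => le_rfl) _)
  have hsort : PolyLE δ (fun i => SubsetAssignment.sortTime (δ i + 1) (δ i)) fun _ => 1 :=
    PolyLE.sortTime (g := fun _ => 1) (h := fun _ => 1) hd1 (fun _ => le_rfl)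
      (hd1.anti fun i => clog_le_of_le_two_pow Nat.lt_two_pow_self.le) (fun _ => le_rfl) hd
  unfold SubsetAssignment.expandTime
  exact .add (.add (.add (.poly_mul hd1 hd1) hd1.depTime)
    (.add (.poly_mul hd1 (.add hd (.const (fun _ => le_rfl) _))) (.const (fun _ => le_rfl) _)))
    (.add hsort (.add hd (.const (fun _ => le_rfl) _)))

end Poly

theorem preprocessTime_polyLE : PolyLE Instance.d (fun i => preprocessTime i.d) profiles := by
  have h1 : ∀ k, PolyLE Instance.d (fun _ => k) fun _ => 1 := .const fun _ => le_rfl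
  have hc : ∀ k, PolyLE Instance.d (fun _ => k) profiles := .const one_le_profiles
  have hd : PolyLE Instance.d (fun i => i.d) fun _ => 1 := .dim fun _ => le_rfl
  have hd1 : PolyLE Instance.d (fun i => i.d + 1) fun _ => 1 := .add hd (h1 1)
  have hchoose : PolyLE Instance.d (fun i => (3 ^ i.d).choose i.d) profiles :=
    profileBound_polyLE.anti fun i => Nat.le_mul_of_pos_right _ (by positivity)
  have hcmp : PolyLE Instance.d (fun i => (i.d + 1) * (2 * i.d + 3)) fun _ => 1 :=
    .poly_mul hd1 (.add (.poly_mul (h1 2) hd) (h1 3))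
  have hsub : PolyLE Instance.d (fun i => sublistsTime i.d (3 ^ i.d)) profiles := by
    refine PolyLE.anti (f := fun i => 2 * (2 * (i.d + 1) * (3 ^ i.d).choose i.d) +
      2 * (i.d * (3 ^ i.d).choose i.d)) ?_ fun i => ?_
    · exact .add (.poly_mul (h1 2) (.poly_mul (.poly_mul (h1 2) hd1) hchoose))
        (.poly_mul (h1 2) (.poly_mul hd hchoose))
    · exact (sublistsTime_lt i.d (3 ^ i.d)).le.trans
        (Nat.add_le_add_right (Nat.mul_le_mul_left 2 (sum_choose_le i.d)) _)
  have hlog : PolyLE Instance.d (fun i => Nat.clog 2 (profileBound i.d)) fun _ => 1 := by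
    have hsq : PolyLE Instance.d (fun i => 2 * i.d * (i.d + 1)) fun _ => 1 :=
      .poly_mul (.poly_mul (h1 2) hd) hd1
    refine hsq.anti fun i => clog_le_of_le_two_pow ?_
    calc profileBound i.d ≤ (3 ^ i.d) ^ i.d * 3 ^ i.d :=
          Nat.mul_le_mul_right _ (Nat.choose_le_pow _ _)
      _ = (3 ^ i.d) ^ (i.d + 1) := (pow_succ _ _).symm
      _ ≤ (4 ^ i.d) ^ (i.d + 1) :=
          Nat.pow_le_pow_left (Nat.pow_le_pow_left (by norm_num) _) _
      _ = 2 ^ (2 * i.d * (i.d + 1)) := by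
          rw [show (4 : ℕ) = 2 ^ 2 from rfl, ← pow_mul, ← pow_mul, ← mul_assoc]
  have hsort : PolyLE Instance.d
      (fun i => sortTime (profileBound i.d) ((i.d + 1) * (2 * i.d + 3))) profiles :=
    (PolyLE.sortTime profileBound_polyLE one_le_profiles hlog (fun _ => le_rfl) hcmp).mono
      fun i => (mul_one _).le
  have h3 : ∀ i : Instance, 1 ≤ 3 ^ i.d := fun i => Nat.one_le_pow _ _ (by norm_num)
  have hmain : PolyLE Instance.d (fun i => (3 ^ i.d).choose i.d * ((i.d + 1) * i.d +
      depTime i.d i.d + (3 ^ i.d * (expandTime i.d + 2) + 1) + 1)) profiles := by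
    refine (PolyLE.mul (.refl _ _) ?_).trans profileBound_polyLE
    refine .add (.add (.add ((PolyLE.poly_mul hd1 hd).mono h3) (hd.depTime.mono h3))
      (.add (.mul_poly (.refl _ _) (.add (.expandTime _) (h1 2))) (.const h3 1))) (.const h3 1)
  unfold preprocessTime
  exact .add (.add (.add (.add (.poly_mul hd1 (pow_polyLE (by norm_num))) hsub)
    (.add hmain (hc 1))) hsort)
    (.add (.mul_poly profileBound_polyLE (.add hcmp (h1 1))) (hc 1))

/-- The factor `n * log n` of the bound for the initial memory. -/
def Instance.itemWork (i : Instance) : ℕ := i.n * i.itemBits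

theorem Instance.one_le_itemWork (i : Instance) : 1 ≤ i.itemWork :=
  Nat.mul_pos i.pos i.one_le_itemBits

theorem setupTime_polyLE :
    PolyLE Instance.d (fun i => setupTime i.d i.n) fun i => i.profiles * i.itemWork := by
  have h1 : ∀ k, PolyLE Instance.d (fun _ => k) fun _ => 1 := .const fun _ => le_rfl
  have hd : PolyLE Instance.d (fun i => i.d) fun _ => 1 := .dim fun _ => le_rfl
  have hd1 : PolyLE Instance.d (fun i => i.d + 1) fun _ => 1 := .add hd (h1 1)
  have hw : ∀ {f}, PolyLE Instance.d f (fun i => i.n) → PolyLE Instance.d f itemWork :=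
    fun h => h.mono fun i => Nat.le_mul_of_pos_right _ i.one_le_itemBits
  have hgw : ∀ {f}, PolyLE Instance.d f itemWork →
      PolyLE Instance.d f fun i => i.profiles * i.itemWork :=
    fun h => h.mono fun i => Nat.le_mul_of_pos_left _ i.one_le_profiles
  have hgc : ∀ {f}, PolyLE Instance.d f profiles →
      PolyLE Instance.d f fun i => i.profiles * i.itemWork :=
    fun h => h.mono fun i => Nat.le_mul_of_pos_right _ i.one_le_itemWork
  have hk : ∀ k, PolyLE Instance.d (fun _ => k) fun i => i.profiles * i.itemWork :=
    fun k => hgc (.const one_le_profiles k)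
  have hn : PolyLE Instance.d (fun i => i.d + i.n) fun i => i.n :=
    .add (.dim fun i => i.pos) (.refl _ _)
  have h2p : ∀ i : Instance, 1 ≤ 2 ^ i.d := fun i => Nat.one_le_pow _ _ (by norm_num)
  have h4p : ∀ i : Instance, 1 ≤ 4 ^ i.d := fun i => Nat.one_le_pow _ _ (by norm_num)
  -- the lists of moves
  have hmoves : PolyLE Instance.d
      (fun i => 2 ^ i.d * (2 ^ i.d * (5 * i.d + 6) + 2) + 2) fun i => 4 ^ i.d := by
    refine .add (PolyLE.mono (g := fun i => 2 ^ i.d * 2 ^ i.d) (.mul (.refl _ _)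
      (.add (.mul_poly (.refl _ _) (.add (.poly_mul (h1 5) hd) (h1 6))) (.const h2p 2)))
      fun i => ?_) (.const h4p 2)
    rw [← mul_pow]
    norm_num
  have hB : PolyLE Instance.d (fun i => (i.d + i.n) * 2 ^ i.d) fun i => 2 ^ i.d * i.n :=
    (hn.mul (.refl _ _)).mono fun i => (Nat.mul_comm _ _).le
  have hB1 : ∀ i : Instance, 1 ≤ 2 ^ i.d * i.n := fun i => Nat.mul_pos (h2p i) i.pos
  have hsort : PolyLE Instance.d (fun i => sortTime ((i.d + i.n) * 2 ^ i.d) 1)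
      fun i => 2 ^ i.d * i.itemWork :=
    (PolyLE.sortTime hB hB1 treeDepth_polyLE one_le_itemBits (h1 1)).mono fun i =>
      (Nat.mul_assoc _ _ _).le
  have hBw : ∀ {f}, PolyLE Instance.d f (fun i => 2 ^ i.d * i.n) →
      PolyLE Instance.d f fun i => 2 ^ i.d * i.itemWork :=
    fun h => h.mono fun i => Nat.mul_le_mul_left _
      (Nat.le_mul_of_pos_right _ i.one_le_itemBits)
  have hbucket : PolyLE Instance.d (fun i => bucketTime i.d ((i.d + i.n) * 2 ^ i.d) + 1)
      fun i => 2 ^ i.d * i.itemWork := by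
    have hone : ∀ {f}, PolyLE Instance.d f (fun _ => 1) →
        PolyLE Instance.d f fun i => 2 ^ i.d * i.n := fun h => h.mono hB1
    unfold bucketTime
    exact .add (.add (.add (.add (.add (.add (hBw (hone hd1)) hsort)
      (hBw (.add hB (hone (h1 1)))))
      (hBw (.mul_poly (.add (.poly_mul (h1 2) hB) (hone (h1 1))) (.add hd (h1 5)))))
      (hBw (hone hd1))) (hBw (.add (.mul_poly hB (.add hd (h1 2))) (hone (h1 1)))))
      (hBw (hone (h1 1)))
  have htrees : PolyLE Instance.d
      (fun i => 3 ^ i.d * (bucketTime i.d ((i.d + i.n) * 2 ^ i.d) + 1))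
      fun i => i.profiles * i.itemWork := by
    have h6 : PolyLE Instance.d (fun i => 6 ^ i.d * i.itemWork) fun i =>
        i.profiles * i.itemWork := .mul (pow_polyLE (by norm_num)) (.refl _ _)
    refine PolyLE.trans (.mono (.mul (.refl _ _) hbucket) fun i => ?_) h6
    rw [← mul_assoc, ← mul_pow]
    norm_num
  unfold setupTime
  refine .add (.add (.add (.add (.add (.add ?_ ?_) ?_) ?_) ?_) (.add ?_ (hk 1)))
    (.add htrees (hk 1))
  · exact hgc (.poly_mul hd1 (pow_polyLE (by norm_num)))
  · exact hgc (.poly_mul hd1 (pow_polyLE (by norm_num)))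
  · exact (PolyLE.mul (hw (.poly_mul (.poly_mul (h1 3) hd1) hn))
      (pow_polyLE (by norm_num))).mono fun i => (Nat.mul_comm _ _).le
  · exact hgw (hw (.poly_mul hd1 hn))
  · exact hgc (pow_polyLE (by norm_num))
  · exact (PolyLE.mul (hw hn) (hmoves.trans (pow_polyLE (by norm_num)))).mono
      fun i => (Nat.mul_comm _ _).le

theorem boundsTime_polyLE : PolyLE Instance.d
    (fun i => boundsTime i.d i.n (halvings i.input)) fun i => i.n * i.sizeBits := by
  have h1 : ∀ k, PolyLE Instance.d (fun _ => k) fun _ => 1 := .const fun _ => le_rfl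
  have hg : ∀ i : Instance, 1 ≤ i.n * i.sizeBits := fun i => Nat.mul_pos i.pos i.one_le_sizeBits
  have hk : ∀ k, PolyLE Instance.d (fun _ => k) fun i => i.n * i.sizeBits := .const hg
  unfold boundsTime
  refine .add (.add (.add (.add (.mul_poly ?_ (h1 3)) (hk 1))
    (.add (.mul_poly (.dim hg) (h1 2)) (hk 1))) (hk 4)) (.mul_poly ?_ (h1 3))
  · exact .of_le fun i => Nat.le_mul_of_pos_right _ i.one_le_sizeBits
  · exact halvings_polyLE.mono fun i => Nat.le_mul_of_pos_left _ i.pos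

/-- The factor of the bound for an update of the memory. -/
def Instance.updateWork (i : Instance) : ℕ := i.profiles * i.itemBits

theorem Instance.one_le_updateWork (i : Instance) : 1 ≤ i.updateWork :=
  Nat.mul_pos i.one_le_profiles i.one_le_itemBits

theorem shiftTime_polyLE : PolyLE Instance.d (fun i => shiftTime i.d i.n) updateWork := by
  have h1 : ∀ k, PolyLE Instance.d (fun _ => k) fun _ => 1 := .const fun _ => le_rfl
  have hd : PolyLE Instance.d (fun i => i.d) updateWork := .dim one_le_updateWork
  have hk : ∀ k, PolyLE Instance.d (fun _ => k) updateWork := .const one_le_updateWork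
  have hset : PolyLE Instance.d (fun i => setMassTime i.d i.n) updateWork := by
    unfold setMassTime
    exact .add (.add hd (hk 1)) (.add (.mul (pow_polyLE (by norm_num))
      (.add (.add (.poly_mul (h1 6) (.dim one_le_itemBits))
        (.poly_mul (h1 6) treeDepth_polyLE)) (.const one_le_itemBits 8))) (hk 1))
  unfold shiftTime
  exact .add (.poly_mul (h1 2) (.add hd (hk 2))) (.poly_mul (h1 2) hset)

theorem passTime_polyLE : PolyLE Instance.d
    (fun i => passTime i.d i.n (halvings i.input) + 1) fun i => i.sizeBits * i.updateWork := by
  have h1 : ∀ k, PolyLE Instance.d (fun _ => k) fun _ => 1 := .const fun _ => le_rfl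
  have hd : PolyLE Instance.d (fun i => i.d) fun _ => 1 := .dim fun _ => le_rfl
  have hd1 : PolyLE Instance.d (fun i => i.d + 1) fun _ => 1 := .add hd (h1 1)
  have hu : ∀ {f}, PolyLE Instance.d f (fun _ => 1) → PolyLE Instance.d f updateWork :=
    fun h => h.mono one_le_updateWork
  have hg : ∀ {f}, PolyLE Instance.d f updateWork →
      PolyLE Instance.d f fun i => i.sizeBits * i.updateWork :=
    fun h => h.mono fun i => Nat.le_mul_of_pos_left _ i.one_le_sizeBits
  have hr : PolyLE Instance.d (fun i => 2 * i.d + 1) fun _ => 1 :=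
    .add (.poly_mul (h1 2) hd) (h1 1)
  have hmatch : PolyLE Instance.d (fun i => matchTime i.d i.n + 4) itemBits := by
    have hk : ∀ k, PolyLE Instance.d (fun _ => k) itemBits := .const one_le_itemBits
    unfold matchTime
    exact .add (.add (.poly_mul hd1 (.add (.add (.dim one_le_itemBits)
      (.poly_mul (h1 2) treeDepth_polyLE)) (hk 7))) (hk 1)) (hk 4)
  have hfind : PolyLE Instance.d
      (fun i => findTime i.d i.n (profileBound i.d) (halvings i.input))
      fun i => i.sizeBits * i.updateWork := by
    have hone : ∀ i : Instance, 1 ≤ i.sizeBits * i.itemBits := fun i =>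
      Nat.mul_pos i.one_le_sizeBits i.one_le_itemBits
    unfold findTime
    refine .add (hg (hu (h1 1))) (.add ?_ (hg (hu (h1 1))))
    exact (PolyLE.mul profileBound_polyLE (.add (.mul halvings_polyLE hmatch)
      (.const hone 1))).mono fun i => (Nat.mul_left_comm _ _ _).le
  have happly : PolyLE Instance.d (fun i => applyTime i.d i.n i.d) updateWork := by
    unfold applyTime
    exact .add (.add (.add
      (hu (.add (.poly_mul hd1 (.add (.add (.poly_mul hd1 (.add hd (h1 3))) hd) (h1 5))) (h1 1)))
      (.add (.poly_mul hd1 (.add shiftTime_polyLE (hu (h1 2)))) (hu (h1 1))))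
      (hu (.add (.add hd hd) (h1 2)))) (hu (.tidyTime (.add hd1 hd)))
  have hcancel : PolyLE Instance.d (fun i => cancelTime i.d i.n (2 * i.d + 1)) updateWork := by
    unfold cancelTime
    exact .add (.add (.add (.add (.add
      (hu (.add (.poly_mul hr (.add (.poly_mul (h1 3) hd) (h1 7))) (h1 1))) (hu (h1 1)))
      (hu (.add hr (h1 1))))
      (hu (.add (.poly_mul hr (.add (.add (.poly_mul (h1 3) hd) (.poly_mul (h1 3) hr)) (h1 13)))
        (h1 1))))
      (.add (.poly_mul hr (.add (hu (.add hd (h1 3))) shiftTime_polyLE)) (hu (h1 1))))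
      (hu hr.tidyTime)
  have hrestore : PolyLE Instance.d (fun i => restoreTime i.d i.n (2 * i.d + 1)) updateWork := by
    unfold restoreTime
    exact .poly_mul (.add hr (h1 1)) (.add (.add (.add
      (hu (.poly_mul (.poly_mul (h1 2) hd1) (.add hr (h1 1)))) (hu hr.depTime)) hcancel)
      (hu (h1 1)))
  unfold passTime
  exact .add (.add (.add hfind (hg happly)) (hg hrestore)) (hg (hu (h1 1)))

/-- The main loop is the product of the number of augmentations and of the time for one of them;
the other parts of the algorithm are dominated by it. -/
theorem mainTime_polyLE : PolyLE Instance.d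
    (fun i => mainTime i.d i.n (halvings i.input) (augmentationBound i.input))
    fun i => i.profiles * (i.n * i.itemBits * i.costBits * i.sizeBits) := by
  have hpos : ∀ i : Instance, 1 ≤ i.profiles ∧ 1 ≤ i.n ∧ 1 ≤ i.itemBits ∧ 1 ≤ i.costBits ∧
      1 ≤ i.sizeBits := fun i =>
    ⟨i.one_le_profiles, i.pos, i.one_le_itemBits, i.one_le_costBits, i.one_le_sizeBits⟩
  unfold mainTime
  refine .add (.add (.add ?_ ?_) ?_) ?_
  · refine setupTime_polyLE.mono fun i => Nat.mul_le_mul_left _ ?_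
    obtain ⟨-, -, -, h4, h5⟩ := hpos i
    exact (Nat.le_mul_of_pos_right _ h4).trans (Nat.le_mul_of_pos_right _ h5)
  · refine preprocessTime_polyLE.mono fun i => Nat.le_mul_of_pos_right _ ?_
    obtain ⟨-, h2, h3, h4, h5⟩ := hpos i
    exact Nat.mul_pos (Nat.mul_pos (Nat.mul_pos h2 h3) h4) h5
  · refine boundsTime_polyLE.mono fun i => ?_
    obtain ⟨h1, h2, h3, h4, h5⟩ := hpos i
    refine le_trans ?_ (Nat.le_mul_of_pos_left _ h1)
    refine Nat.mul_le_mul_right _ ?_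
    exact (Nat.le_mul_of_pos_right _ h3).trans (Nat.le_mul_of_pos_right _ h4)
  · refine (augmentationBound_polyLE.mul passTime_polyLE).mono fun i => le_of_eq ?_
    rw [updateWork]
    ring

/-- Passage from binary digits to logarithms. -/
theorem cast_le_of_bits {d n : ℕ} (I : Input d n) {t K k c : ℕ}
    (h : t ≤ K * (d + 1) ^ k * (c * (n * bits n * bits (n * I.maxStorageCost) *
      bits I.maxSize))) :
    (t : ℝ) ≤ (K * 125 : ℕ) * (c : ℝ) * ((d : ℝ) + 1) ^ k *
      (n * lg n * lg (n * I.maxStorageCost) * lg I.maxSize) := by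
  have h1 := bits_le_lg n
  have h2 := bits_le_lg (n * I.maxStorageCost)
  have h3 := bits_le_lg I.maxSize
  rw [Nat.cast_mul] at h2
  have h4 : (t : ℝ) ≤ K * ((d : ℝ) + 1) ^ k * (c * (n * bits n * bits (n * I.maxStorageCost) *
      bits I.maxSize)) := by exact_mod_cast h
  have h5 : (0 : ℝ) ≤ 5 * lg n := (Nat.cast_nonneg _).trans h1
  have h6 : (0 : ℝ) ≤ 5 * lg (n * I.maxStorageCost) := (Nat.cast_nonneg _).trans h2
  calc (t : ℝ) ≤ _ := h4
    _ ≤ K * ((d : ℝ) + 1) ^ k * (c * (n * (5 * lg n) * (5 * lg (n * I.maxStorageCost)) *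
        (5 * lg I.maxSize))) := by gcongr
    _ = _ := by
        push_cast
        ring

end Total

end SubsetAssignment

theorem mainTheorem1 :
    (∃ K k : ℕ, ∀ (d n : ℕ) (I : SubsetAssignment.Input d n), 0 < n →
      ∃ (x : Fin n → Finset (Fin d) → ℚ) (t : ℕ),
        SubsetAssignment.HaltsWith (SubsetAssignment.mainLoop I) x t ∧
        I.IsOptimal (fun p S => (x p S : ℝ)) ∧
        (t : ℝ) ≤ K * ((3 ^ d).choose (d + 1) : ℝ) * ((d : ℝ) + 1) ^ k *
          (n * SubsetAssignment.lg n * SubsetAssignment.lg (n * I.maxStorageCost) *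
            SubsetAssignment.lg I.maxSize)) ∧
    ∀ d : ℕ, SubsetAssignment.numProfiles d ≤ (3 ^ d).choose (d + 1) := by
  refine ⟨?_, SubsetAssignment.numProfiles_le⟩
  obtain ⟨K, k, h⟩ := SubsetAssignment.mainTime_polyLE
  refine ⟨K * 125, k, fun d n I hn => ?_⟩
  obtain ⟨x, t, hrun, ht, hopt⟩ := (SubsetAssignment.mainLoop_runs I hn
    (SubsetAssignment.contraction_pow_mul_lt I hn)).haltsWith
  refine ⟨x, t, hrun, hopt, ?_⟩
  exact SubsetAssignment.cast_le_of_bits I (ht.trans (h ⟨d, n, I, hn⟩))
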